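/- Let $d\ge 2$ and let $D\subset\mathbb{R}^d$ be a bounded domain (nonempty, open, connected) with $C^\infty$ boundary, i.e. near every boundary point $D$ is, after a rigid motion, the part above the graph of a $C^\infty$ function. Let $\sigma$ be the $(d-1)$-dimensional surface measure on $\partial D$. Let $\kappa$ be a symmetric matrix-valued function on $D$ with components in $L^\infty(D)$ such that, for some $c>0$, $c^{-1}|\xi|^2\le \xi\cdot\kappa(x)\xi\le c|\xi|^2$ for all $\xi\in\mathbb{R}^d$ and a.e. $x\in D$. Let $$\mathcal{E}(v,w)=\int_D \kappa\nabla v\cdot\nabla w\,dx,\qquad v,w\in\mathcal{D}(\mathcal{E})=H^1(D),$$ where gradients are distributional and functions are real-valued. Let $\mathcal{D}_e(\mathcal{E})$ be its extended Dirichlet space, i.e. the set of functions $v:D\to\mathbb{R}$ (modulo equality a.e.) for which there is a sequence $(v_k)$ in $H^1(D)$ with $v_k\to v$ a.e. on $D$ and $\mathcal{E}(v_m-v_n,v_m-v_n)\to0$ as $m,n\to\infty$. Then $\mathcal{D}_e(\mathcal{E})=H^1(D)$; in particular every $v\in\mathcal{D}_e(\mathcal{E})$ has a boundary trace $v|_{\partial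 D}=\gamma v\in L^2(\partial D,\sigma)$, where $\gamma$ is the standard trace operator on $H^1(D)$ (the continuous extension of $w\mapsto w|_{\partial D}$, $w\in C^\infty(\overline D)$). Moreover, let $\widehat{\mathcal{E}}$ be the trace Dirichlet form on $L^2(\partial D,\sigma)$, $$\widehat{\mathcal{E}}(v,w)=\mathcal{E}(\mathcal{H}v,\mathcal{H}w),\qquad \mathcal{D}(\widehat{\mathcal{E}})=\mathcal{D}_e(\mathcal{E})|_{\partial D}\cap L^2(\partial D,\sigma),$$ where $\mathcal{H}\phi$ is the solution $u\in H^1(D)$ of $\nabla\cdot(\kappa\nabla u)=0$ in $D$, $u|_{\partial D}=\phi$. Then $$\mathcal{D}(\widehat{\mathcal{E}})=H^{1/2}(\partial D)=\Big\{\phi\in L^2(\partial D,\sigma):\int_{\partial D}\int_{\partial D}\frac{|\phi(x)-\phi(y)|^2}{|x-y|^{d}}\,d\sigma(x)\,d\sigma(y)<\infty\Big\}.$$ -/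

import Mathlib

open MeasureTheory Filter Topology
open scoped ContDiff

noncomputable section

namespace TraceForm

/-- Euclidean space `ℝ^d`. -/
abbrev Eu (d : ℕ) : Type := EuclideanSpace ℝ (Fin d)

/-- A bounded domain (nonempty, open, connected) in `ℝ^d` with smooth boundary: near every boundary
point, after a rigid motion onto `ℝ^(d-1) × ℝ`, the set is the part above the graph of a `C^∞`
function. -/
structure IsSmoothBoundedDomain {d : ℕ} (D : Set (Eu d)) : Prop where
  isOpen : IsOpen D
  isConnected : IsConnected D
  isBounded : Bornology.IsBounded D
  smooth_boundary : ∀ x ∈ frontier D, ∃ r : ℝ, 0 < r ∧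
    ∃ (T : Eu d ≃ᵃⁱ[ℝ] WithLp 2 (Eu (d - 1) × ℝ)) (g : Eu (d - 1) → ℝ),
      ContDiff ℝ ∞ g ∧ ∀ y ∈ Metric.ball x r, (y ∈ D ↔ g (T y).fst < (T y).snd)

/-- A symmetric, bounded, uniformly elliptic conductivity with components in `L^∞(D)`. -/
structure IsConductivity {d : ℕ} (D : Set (Eu d)) (κ : Eu d → Matrix (Fin d) (Fin d) ℝ) :
    Prop where
  memLp_top : ∀ i j, MemLp (fun x => κ x i j) ⊤ (volume.restrict D)
  symm : ∀ᵐ x ∂(volume.restrict D), (κ x).IsSymm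
  elliptic : ∃ c : ℝ, 0 < c ∧ ∀ᵐ x ∂(volume.restrict D), ∀ ξ : Eu d,
    c⁻¹ * ‖ξ‖ ^ 2 ≤ ∑ i, ∑ j, ξ i * κ x i j * ξ j ∧
      ∑ i, ∑ j, ξ i * κ x i j * ξ j ≤ c * ‖ξ‖ ^ 2

/-- The test functions `C_c^∞(D)`. -/
structure IsTestFunction {d : ℕ} (D : Set (Eu d)) (φ : Eu d → ℝ) : Prop where
  smooth : ContDiff ℝ ∞ φ
  compact : HasCompactSupport φ
  supp : tsupport φ ⊆ D

/-- `G ∈ L²(D; ℝ^d)` is the distributional gradient of `u` in `D`. -/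
structure IsWeakGradient {d : ℕ} (D : Set (Eu d)) (u : Eu d → ℝ) (G : Eu d → Eu d) : Prop where
  memLp : MemLp G 2 (volume.restrict D)
  integral_eq : ∀ φ : Eu d → ℝ, IsTestFunction D φ → ∀ e : Eu d,
    ∫ x in D, u x * fderiv ℝ φ x e = - ∫ x in D, inner ℝ (G x) e * φ x

/-- The Sobolev space `H¹(D)`, as a set of functions (only their values a.e. on `D` matter). -/
def H1 {d : ℕ} (D : Set (Eu d)) : Set (Eu d → ℝ) :=
  {u | MemLp u 2 (volume.restrict D) ∧ ∃ G, IsWeakGradient D u G}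

open Classical in
/-- The distributional gradient in `D`, well defined a.e. on `D` for `u ∈ H¹(D)`. -/
def weakGrad {d : ℕ} (D : Set (Eu d)) (u : Eu d → ℝ) : Eu d → Eu d :=
  if h : ∃ G, IsWeakGradient D u G then h.choose else 0

/-- The form `ℰ(v, w) = ∫_D κ ∇v · ∇w dx`. -/
def energy {d : ℕ} (D : Set (Eu d)) (κ : Eu d → Matrix (Fin d) (Fin d) ℝ)
    (v w : Eu d → ℝ) : ℝ :=
  ∫ x in D, ∑ i, ∑ j, κ x i j * weakGrad D v x j * weakGrad D w x i

/-- The extended Dirichlet space `𝒟ₑ(ℰ)` of `(ℰ, H¹(D))`: the (a.e. finite) functions that are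
a.e. limits on `D` of `ℰ`-Cauchy sequences in `H¹(D)`. -/
def extendedDomain {d : ℕ} (D : Set (Eu d)) (κ : Eu d → Matrix (Fin d) (Fin d) ℝ) :
    Set (Eu d → ℝ) :=
  {u | ∃ v : ℕ → Eu d → ℝ, (∀ k, v k ∈ H1 D) ∧
    (∀ ε : ℝ, 0 < ε → ∃ N : ℕ, ∀ m ≥ N, ∀ n ≥ N, energy D κ (v m - v n) (v m - v n) < ε) ∧
    ∀ᵐ x ∂(volume.restrict D), Tendsto (fun k => v k x) atTop (𝓝 (u x))}

/-- The surface measure `σ` on `∂D`: the `(d-1)`-dimensional Hausdorff measure, normalized so as to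
agree with Lebesgue measure on `ℝ^(d-1)`. -/
def surfaceMeasure {d : ℕ} (D : Set (Eu d)) : Measure (Eu d) :=
  (Measure.euclideanHausdorffMeasure (d - 1)).restrict (frontier D)

/-- `L²(∂D)`. -/
abbrev L2Boundary {d : ℕ} (D : Set (Eu d)) : Type := Lp ℝ 2 (surfaceMeasure D)

/-- `φ = γ u` for the standard trace operator `γ` on `H¹(D)`, the continuous extension of
`w ↦ w|_{∂D}` from `C^∞(closure D)`. -/
def HasTrace {d : ℕ} (D : Set (Eu d)) (u : Eu d → ℝ) (φ : L2Boundary D) : Prop :=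
  u ∈ H1 D ∧ ∃ w : ℕ → Eu d → ℝ, (∀ k, ContDiff ℝ ∞ (w k)) ∧
    Tendsto (fun k => eLpNorm (w k - u) 2 (volume.restrict D)) atTop (𝓝 0) ∧
    Tendsto (fun k => eLpNorm (weakGrad D (w k - u)) 2 (volume.restrict D)) atTop (𝓝 0) ∧
    Tendsto (fun k => eLpNorm (fun x => w k x - φ x) 2 (surfaceMeasure D)) atTop (𝓝 0)

/-- `u` is the `κ`-harmonic function in `H¹(D)` with trace `φ`. -/
def IsHarmonicExtension {d : ℕ} (D : Set (Eu d)) (κ : Eu d → Matrix (Fin d) (Fin d) ℝ)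
    (φ : L2Boundary D) (u : Eu d → ℝ) : Prop :=
  HasTrace D u φ ∧ ∀ v, IsTestFunction D v → energy D κ u v = 0

open Classical in
/-- The harmonic extension operator `ℋ`, with value `0` where no extension exists. -/
def harmonicExtension {d : ℕ} (D : Set (Eu d)) (κ : Eu d → Matrix (Fin d) (Fin d) ℝ)
    (φ : L2Boundary D) : Eu d → ℝ :=
  if h : ∃ u, IsHarmonicExtension D κ φ u then h.choose else 0

/-- A bilinear form on a function space, given together with its domain. -/
structure FormWithDomain (X : Type) where
  domain : Set X
  form : X → X → ℝ

/-- The trace Dirichlet form on `L²(∂D)`: `ℰ̂(v, w) = ℰ(ℋ v, ℋ w)` with domain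
`𝒟ₑ(ℰ)|_{∂D} ∩ L²(∂D)`. -/
def traceDirichletForm {d : ℕ} (D : Set (Eu d)) (κ : Eu d → Matrix (Fin d) (Fin d) ℝ) :
    FormWithDomain (L2Boundary D) where
  domain := {φ | ∃ u ∈ extendedDomain D κ, HasTrace D u φ}
  form v w := energy D κ (harmonicExtension D κ v) (harmonicExtension D κ w)

/-- The Sobolev–Slobodeckij space `H^{1/2}(∂D)`: the `φ ∈ L²(∂D)` with
`∫∫ |φ(x) - φ(y)|² / |x - y|^d dσ(x) dσ(y) < ∞`. -/
def HHalfBoundary {d : ℕ} (D : Set (Eu d)) : Set (L2Boundary D) :=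
  {φ | ∫⁻ x, ∫⁻ y, ENNReal.ofReal ((φ x - φ y) ^ 2 / dist x y ^ d)
    ∂(surfaceMeasure D) ∂(surfaceMeasure D) < ⊤}

end TraceForm

end

/-! The inclusion of `H1 D` in the extended domain is witnessed by constant sequences. For the
converse, ellipticity turns an energy-Cauchy sequence into one whose gradients are Cauchy in L².
What is missing is L² control of the functions themselves, and this comes from difference quotients.
On an open set whose translates stay in D, the increment v(x + h) - v(x) is bounded in L² by ‖h‖
times the L² norm of the gradient (`lintegral_translate_sub_sq_le`). Fatou's lemma carries this
bound over to v_m - u. On a ball, Egorov's theorem gives a set of positive measure on which v_m - u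
tends to 0 uniformly; averaging over that set yields L² convergence on the ball. Near the boundary,
a translation into the interior reduces to interior balls, and compactness of the closure finishes
(`tendsto_H1_of_ae_tendsto`).

Once the extended domain is `H1 D`, the second claim says that the traces of H¹ functions are
exactly the functions of finite Gagliardo seminorm of order 1/2.

For the extension of a given φ, average it against the kernel |x - y|^(-2d), regularized by ε, and
divide by the average of 1. Lower Ahlfors regularity of the surface measure σ bounds the normalizing
mass below by a multiple of δ^(-(d+1)), where δ is the regularized distance of x to the boundary.
The average reproduces constants, so its gradient only sees the differences φ(y) - φ(z), and its
square is bounded, uniformly in ε, by the double integral of |φ(y) - φ(z)|² max(|x - y|, |x -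
z|)^(-2d) (`kernelAvgGrad_sq_le`). Integrating in x over the whole space turns the weight into a
multiple of |y - z|^(-d), hence into the Gagliardo seminorm (`exists_lintegral_majorant_le`).
Dominated convergence as ε → 0 gives convergence of gradients, the closure argument of the first
part identifies the limit in H¹, and a direct estimate shows that the averages converge to φ in
L²(σ).

For the trace inequality, join two points of a Lipschitz graph by a path that rises vertically to
height |a - b| in graph coordinates, crosses at that height, and descends. Hardy's inequality
controls the vertical pieces; polar coordinates and translation invariance control the horizontal
one (`exists_lintegral_gagliardo_le`). Pairs of points away from the diagonal cost only the boundary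
L² norm. Compactness of ∂D × ∂D globalizes this for smooth functions
(`IsSmoothBoundedDomain.exists_gagliardo_le`), and Fatou's lemma extends it to all traces. -/

noncomputable section

namespace TraceForm

/-! ### Quadratic estimates for Lebesgue integrals -/

section Lebesgue

variable {α : Type*} [MeasurableSpace α] {μ : Measure α}

/-- The Cauchy–Schwarz inequality for the lower Lebesgue integral. -/
lemma sq_lintegral_mul_le {f g : α → ENNReal} (hf : AEMeasurable f μ) (hg : AEMeasurable g μ) :
    (∫⁻ x, f x * g x ∂μ) ^ 2 ≤ (∫⁻ x, f x ^ 2 ∂μ) * ∫⁻ x, g x ^ 2 ∂μ := by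
  have h := ENNReal.lintegral_mul_le_Lp_mul_Lq μ Real.HolderConjugate.two_two hf hg
  simp only [Pi.mul_apply, ENNReal.rpow_two] at h
  calc (∫⁻ x, f x * g x ∂μ) ^ 2
      ≤ ((∫⁻ x, f x ^ 2 ∂μ) ^ (1 / 2 : ℝ) * (∫⁻ x, g x ^ 2 ∂μ) ^ (1 / 2 : ℝ)) ^ 2 := by gcongr
    _ = (∫⁻ x, f x ^ 2 ∂μ) * ∫⁻ x, g x ^ 2 ∂μ := by
      rw [mul_pow, ← ENNReal.rpow_natCast, ← ENNReal.rpow_natCast, ← ENNReal.rpow_mul,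
        ← ENNReal.rpow_mul]
      norm_num

lemma sq_lintegral_le {f : α → ENNReal} (hf : AEMeasurable f μ) :
    (∫⁻ x, f x ∂μ) ^ 2 ≤ μ Set.univ * ∫⁻ x, f x ^ 2 ∂μ := by
  simpa using sq_lintegral_mul_le (μ := μ) (f := fun _ => 1) (g := f) aemeasurable_const hf

lemma eLpNorm_two_sq {E : Type*} [NormedAddCommGroup E] (f : α → E) :
    eLpNorm f 2 μ ^ 2 = ∫⁻ x, ‖f x‖ₑ ^ 2 ∂μ := by
  have h := eLpNorm_nnreal_pow_eq_lintegral (μ := μ) (f := f) (p := 2) two_ne_zero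
  rw [← ENNReal.rpow_natCast]
  simpa using h

lemma tendsto_eLpNorm_two_iff {ι E : Type*} [NormedAddCommGroup E] {l : Filter ι}
    {f : ι → α → E} :
    Tendsto (fun k => eLpNorm (f k) 2 μ) l (𝓝 0) ↔
      Tendsto (fun k => ∫⁻ x, ‖f k x‖ₑ ^ 2 ∂μ) l (𝓝 0) := by
  simp only [← eLpNorm_two_sq]
  constructor
  · intro h
    simpa [Function.comp_def] using ((ENNReal.continuous_pow 2).tendsto 0).comp h
  · intro h
    have := ((ENNReal.continuous_rpow_const (y := (1 / 2 : ℝ))).tendsto 0).comp h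
    refine (this.congr fun k => ?_).trans (by simp)
    rw [Function.comp_apply, ← ENNReal.rpow_natCast, ← ENNReal.rpow_mul]
    norm_num

lemma integrable_mul_of_memLp_two {f g : α → ℝ} (hf : MemLp f 2 μ) (hg : MemLp g 2 μ) :
    Integrable (fun x => f x * g x) μ :=
  hf.integrable_mul hg

/-- The integral against a fixed square integrable function is continuous on `L²`. -/
lemma tendsto_integral_mul_of_tendsto_eLpNorm {f : ℕ → α → ℝ} {f₀ h : α → ℝ}
    (hf : ∀ k, MemLp (f k) 2 μ) (hf₀ : MemLp f₀ 2 μ) (hh : MemLp h 2 μ)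
    (hlim : Tendsto (fun k => eLpNorm (f k - f₀) 2 μ) atTop (𝓝 0)) :
    Tendsto (fun k => ∫ x, f k x * h x ∂μ) atTop (𝓝 (∫ x, f₀ x * h x ∂μ)) := by
  refine tendsto_integral_of_L1' (fun x => f₀ x * h x) (hf₀.integrable_mul hh).1
    (Eventually.of_forall fun k => (hf k).integrable_mul hh) ?_
  have hlim' : Tendsto (fun k => eLpNorm (f k - f₀) 2 μ * eLpNorm h 2 μ) atTop (𝓝 0) := by
    simpa using ENNReal.Tendsto.mul_const hlim (Or.inr hh.eLpNorm_ne_top)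
  refine tendsto_of_tendsto_of_tendsto_of_le_of_le tendsto_const_nhds hlim'
    (fun _ => zero_le) fun k => ?_
  have := eLpNorm_smul_le_mul_eLpNorm (p := 2) (q := 2) (r := 1) (μ := μ) (f := h)
    (φ := f k - f₀) hh.1 ((hf k).sub hf₀).1
  refine le_trans (le_of_eq ?_) this
  congr 1
  ext x
  simp [sub_mul]

end Lebesgue

/-! ### Weak gradients: uniqueness, closedness, ellipticity -/

variable {d : ℕ} {D : Set (Eu d)}

lemma IsTestFunction.memLp {φ : Eu d → ℝ} (h : IsTestFunction D φ) :
    MemLp φ 2 (volume.restrict D) :=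
  h.smooth.continuous.memLp_of_hasCompactSupport h.compact

lemma IsTestFunction.memLp_fderiv {φ : Eu d → ℝ} (h : IsTestFunction D φ) (e : Eu d) :
    MemLp (fun x => fderiv ℝ φ x e) 2 (volume.restrict D) :=
  ((h.smooth.continuous_fderiv (by simp)).clm_apply continuous_const).memLp_of_hasCompactSupport
    (h.compact.fderiv_apply (𝕜 := ℝ) e)

lemma weakGrad_spec {u : Eu d → ℝ} (h : ∃ G, IsWeakGradient D u G) :
    IsWeakGradient D u (weakGrad D u) := by
  rw [weakGrad, dif_pos h]
  exact h.choose_spec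

lemma memLp_inner_left {μ : Measure (Eu d)} {G : Eu d → Eu d} (hG : MemLp G 2 μ) (e : Eu d) :
    MemLp (fun x => inner ℝ (G x) e) 2 μ :=
  hG.inner_const e

/-- This is the fundamental lemma of the calculus of variations, with the vector identity tested
against each fixed direction. It makes the arbitrary choice in `weakGrad` harmless. -/
lemma IsWeakGradient.ae_eq (hD : IsOpen D) {u : Eu d → ℝ} {G G' : Eu d → Eu d}
    (h : IsWeakGradient D u G) (h' : IsWeakGradient D u G') :
    G =ᵐ[volume.restrict D] G' := by
  have hloc : LocallyIntegrable (G - G') (volume.restrict D) :=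
    (h.memLp.sub h'.memLp).locallyIntegrable (by norm_num)
  have key := hD.ae_eq_zero_of_integral_contDiff_smul_eq_zero (μ := volume) (f := G - G')
    (locallyIntegrableOn_of_locallyIntegrable_restrict hloc) ?_
  · filter_upwards [(ae_restrict_iff' hD.measurableSet).2 key] with x hx
    simpa [sub_eq_zero] using hx
  intro φ hφ hc hs
  have htest : IsTestFunction D φ := ⟨hφ, hc, hs⟩
  rw [← setIntegral_eq_integral_of_forall_compl_eq_zero (s := D)]
  swap
  · intro x hx
    simp [image_eq_zero_of_notMem_tsupport fun h => hx (hs h)]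
  have hint : Integrable (fun x => φ x • (G - G') x) (volume.restrict D) :=
    hloc.integrable_smul_left_of_hasCompactSupport hφ.continuous hc
  refine ext_inner_left ℝ fun e => ?_
  rw [← integral_inner hint, inner_zero_right]
  have e1 := h.integral_eq φ htest e
  have e2 := h'.integral_eq φ htest e
  have : ∀ x, inner ℝ e (φ x • (G - G') x)
      = inner ℝ (G x) e * φ x - inner ℝ (G' x) e * φ x := by
    intro x
    rw [inner_smul_right, Pi.sub_apply, inner_sub_right, real_inner_comm, real_inner_comm e (G' x)]
    ring
  simp_rw [this]
  rw [integral_sub (integrable_mul_of_memLp_two (memLp_inner_left h.memLp e) htest.memLp)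
    (integrable_mul_of_memLp_two (memLp_inner_left h'.memLp e) htest.memLp)]
  linarith

lemma weakGrad_ae_eq (hD : IsOpen D) {u : Eu d → ℝ} {G : Eu d → Eu d}
    (h : IsWeakGradient D u G) : weakGrad D u =ᵐ[volume.restrict D] G :=
  (weakGrad_spec ⟨G, h⟩).ae_eq hD h

lemma IsWeakGradient.sub {u v : Eu d → ℝ} {G G' : Eu d → Eu d}
    (hu : MemLp u 2 (volume.restrict D)) (hv : MemLp v 2 (volume.restrict D))
    (h : IsWeakGradient D u G) (h' : IsWeakGradient D v G') :
    IsWeakGradient D (u - v) (G - G') := by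
  refine ⟨h.memLp.sub h'.memLp, fun φ hφ e => ?_⟩
  simp only [Pi.sub_apply, sub_mul, inner_sub_left]
  rw [integral_sub (integrable_mul_of_memLp_two hu (hφ.memLp_fderiv e))
    (integrable_mul_of_memLp_two hv (hφ.memLp_fderiv e)),
    integral_sub (integrable_mul_of_memLp_two (memLp_inner_left h.memLp e) hφ.memLp)
    (integrable_mul_of_memLp_two (memLp_inner_left h'.memLp e) hφ.memLp),
    h.integral_eq φ hφ e, h'.integral_eq φ hφ e]
  ring

lemma weakGrad_sub_ae_eq (hD : IsOpen D) {u v : Eu d → ℝ} (hu : u ∈ H1 D) (hv : v ∈ H1 D) :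
    weakGrad D (u - v) =ᵐ[volume.restrict D] weakGrad D u - weakGrad D v :=
  weakGrad_ae_eq hD ((weakGrad_spec hu.2).sub hu.1 hv.1 (weakGrad_spec hv.2))

lemma sub_mem_H1 {u v : Eu d → ℝ} (hu : u ∈ H1 D) (hv : v ∈ H1 D) : u - v ∈ H1 D :=
  ⟨hu.1.sub hv.1, _, (weakGrad_spec hu.2).sub hu.1 hv.1 (weakGrad_spec hv.2)⟩

lemma memLp_of_continuous {E : Type*} [NormedAddCommGroup E] {p : ENNReal}
    (hD : Bornology.IsBounded D) {f : Eu d → E}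
    (hf : Continuous f) : MemLp f p (volume.restrict D) := by
  have hc : IsCompact (closure D) := hD.isCompact_closure
  obtain ⟨C, hC⟩ := hc.exists_bound_of_continuousOn hf.continuousOn
  have : IsFiniteMeasure (volume.restrict D) := ⟨by simpa using hD.measure_lt_top⟩
  refine MemLp.of_bound hf.aestronglyMeasurable C ?_
  refine ae_restrict_of_ae_restrict_of_subset subset_closure ?_
  exact (ae_restrict_iff' isClosed_closure.measurableSet).2 (Eventually.of_forall hC)

/-- Test functions vanish outside D, so the integration by parts takes place on the whole space and
no boundary term appears. -/
lemma isWeakGradient_gradient (hD : Bornology.IsBounded D) {w : Eu d → ℝ} (hw : ContDiff ℝ 1 w) :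
    IsWeakGradient D w (gradient w) := by
  have hgc : Continuous (gradient w) := by
    exact (InnerProductSpace.toDual ℝ (Eu d)).symm.continuous.comp
      (hw.continuous_fderiv (by simp))
  refine ⟨memLp_of_continuous hD hgc, fun φ hφ e => ?_⟩
  have hsupp : ∀ x ∉ D, φ x = 0 := fun x hx =>
    image_eq_zero_of_notMem_tsupport fun h => hx (hφ.supp h)
  have hsupp' : ∀ x ∉ D, fderiv ℝ φ x = 0 := fun x hx =>
    image_eq_zero_of_notMem_tsupport fun h => hx (hφ.supp (tsupport_fderiv_subset ℝ h))
  rw [setIntegral_eq_integral_of_forall_compl_eq_zero fun x hx => by simp [hsupp' x hx],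
    setIntegral_eq_integral_of_forall_compl_eq_zero fun x hx => by simp [hsupp x hx]]
  have hφd : ContDiff ℝ 1 φ := hφ.smooth.of_le (by simp)
  have hcd : HasCompactSupport fun x => fderiv ℝ φ x e := hφ.compact.fderiv_apply (𝕜 := ℝ) e
  have hφc : Continuous fun x => fderiv ℝ φ x e :=
    (hφd.continuous_fderiv (by simp)).clm_apply continuous_const
  have hwc : Continuous fun x => fderiv ℝ w x e :=
    (hw.continuous_fderiv (by simp)).clm_apply continuous_const
  rw [integral_mul_fderiv_eq_neg_fderiv_mul_of_integrable
    ((hwc.mul hφ.smooth.continuous).integrable_of_hasCompactSupport hφ.compact.mul_left)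
    ((hw.continuous.mul hφc).integrable_of_hasCompactSupport hcd.mul_left)
    ((hw.continuous.mul hφ.smooth.continuous).integrable_of_hasCompactSupport
      hφ.compact.mul_left)
    (fun x _ => (hw.differentiable (by simp)).differentiableAt)
    (fun x _ => (hφd.differentiable (by simp)).differentiableAt)]
  simp [gradient]

lemma mem_H1_of_contDiff (hD : Bornology.IsBounded D) {w : Eu d → ℝ} (hw : ContDiff ℝ 1 w) :
    w ∈ H1 D :=
  ⟨memLp_of_continuous hD hw.continuous, _, isWeakGradient_gradient hD hw⟩

/-- The distributional gradient is a closed operator. -/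
lemma isWeakGradient_of_tendsto {u : Eu d → ℝ} {G : Eu d → Eu d} {v : ℕ → Eu d → ℝ}
    {H : ℕ → Eu d → Eu d} (hv : ∀ k, MemLp (v k) 2 (volume.restrict D))
    (hH : ∀ k, IsWeakGradient D (v k) (H k)) (hu : MemLp u 2 (volume.restrict D))
    (hG : MemLp G 2 (volume.restrict D))
    (hvu : Tendsto (fun k => eLpNorm (v k - u) 2 (volume.restrict D)) atTop (𝓝 0))
    (hHG : Tendsto (fun k => eLpNorm (H k - G) 2 (volume.restrict D)) atTop (𝓝 0)) :
    IsWeakGradient D u G := by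
  refine ⟨hG, fun φ hφ e => ?_⟩
  have h1 := tendsto_integral_mul_of_tendsto_eLpNorm hv hu (hφ.memLp_fderiv e) hvu
  have h2 := tendsto_integral_mul_of_tendsto_eLpNorm
    (fun k => memLp_inner_left (hH k).memLp e) (memLp_inner_left hG e) hφ.memLp ?_
  · refine tendsto_nhds_unique h1 ?_
    simp_rw [fun k => (hH k).integral_eq φ hφ e]
    exact h2.neg
  have hlim : Tendsto (fun k => ENNReal.ofReal ‖e‖ * eLpNorm (H k - G) 2 (volume.restrict D))
      atTop (𝓝 0) := by
    rw [← mul_zero (ENNReal.ofReal ‖e‖)]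
    exact ENNReal.Tendsto.const_mul hHG (Or.inr ENNReal.ofReal_ne_top)
  refine tendsto_of_tendsto_of_tendsto_of_le_of_le tendsto_const_nhds hlim
    (fun _ => zero_le) fun k => ?_
  refine eLpNorm_le_mul_eLpNorm_of_ae_le_mul (Eventually.of_forall fun x => ?_) 2
  simp only [Pi.sub_apply, ← inner_sub_left]
  rw [mul_comm]
  exact norm_inner_le_norm _ _

/-- Ellipticity: the Dirichlet integral is controlled by the energy. -/
lemma exists_lintegral_weakGrad_le_energy {κ : Eu d → Matrix (Fin d) (Fin d) ℝ}
    (hκ : IsConductivity D κ) : ∃ c : ℝ, 0 < c ∧ ∀ v ∈ H1 D,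
      ∫⁻ x in D, ‖weakGrad D v x‖ₑ ^ 2 ≤ ENNReal.ofReal (c * energy D κ v v) := by
  obtain ⟨c, hc, hell⟩ := hκ.elliptic
  refine ⟨c, hc, fun v hv => ?_⟩
  have hG : MemLp (weakGrad D v) 2 (volume.restrict D) := (weakGrad_spec hv.2).memLp
  have hsq : Integrable (fun x => ‖weakGrad D v x‖ ^ 2) (volume.restrict D) :=
    hG.integrable_norm_pow two_ne_zero
  have hcoord : ∀ i, AEStronglyMeasurable (fun x => weakGrad D v x i) (volume.restrict D) :=
    fun i => (EuclideanSpace.proj (𝕜 := ℝ) i).continuous.comp_aestronglyMeasurable hG.1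
  have hb : ∀ᵐ x ∂(volume.restrict D), c⁻¹ * ‖weakGrad D v x‖ ^ 2 ≤
      ∑ i, ∑ j, κ x i j * weakGrad D v x j * weakGrad D v x i ∧
      ∑ i, ∑ j, κ x i j * weakGrad D v x j * weakGrad D v x i ≤ c * ‖weakGrad D v x‖ ^ 2 := by
    filter_upwards [hell] with x hx
    have e : ∑ i, ∑ j, κ x i j * weakGrad D v x j * weakGrad D v x i
        = ∑ i, ∑ j, weakGrad D v x i * κ x i j * weakGrad D v x j :=
      Finset.sum_congr rfl fun i _ => Finset.sum_congr rfl fun j _ => by ring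
    rw [e]
    exact hx _
  -- The upper ellipticity bound gives integrability. Without it the Bochner integral in `energy`
  -- could be the default value 0, and no lower bound would follow.
  have hint : Integrable (fun x => ∑ i, ∑ j, κ x i j * weakGrad D v x j * weakGrad D v x i)
      (volume.restrict D) := by
    refine (hsq.const_mul c).mono' ?_ ?_
    · refine Finset.aestronglyMeasurable_fun_sum _ fun i _ =>
        Finset.aestronglyMeasurable_fun_sum _ fun j _ => ?_
      exact ((hκ.memLp_top i j).1.mul (hcoord j)).mul (hcoord i)
    · filter_upwards [hb] with x hx
      rw [Real.norm_of_nonneg (le_trans (by positivity) hx.1)]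
      exact hx.2
  have hle : ∫ x in D, ‖weakGrad D v x‖ ^ 2 ≤ c * energy D κ v v := by
    rw [energy, ← integral_const_mul]
    refine integral_mono_ae hsq (hint.const_mul c) ?_
    filter_upwards [hb] with x hx
    have := mul_le_mul_of_nonneg_left hx.1 hc.le
    rwa [← mul_assoc, mul_inv_cancel₀ hc.ne', one_mul] at this
  refine le_trans (le_of_eq ?_) (ENNReal.ofReal_le_ofReal hle)
  rw [ofReal_integral_eq_lintegral_ofReal hsq (Eventually.of_forall fun x => by positivity)]
  refine lintegral_congr fun x => ?_
  rw [← ofReal_norm, ENNReal.ofReal_pow (norm_nonneg _)]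

end TraceForm

end

/-! ### Difference quotients of Sobolev functions -/

noncomputable section

namespace TraceForm

variable {d : ℕ} {D : Set (Eu d)}

lemma IsTestFunction.comp_sub {A : Set (Eu d)} {ψ : Eu d → ℝ} (hψ : IsTestFunction A ψ)
    {a : Eu d} (ha : ∀ x ∈ A, x + a ∈ D) : IsTestFunction D fun x => ψ (x - a) := by
  refine ⟨hψ.smooth.comp (contDiff_id.sub contDiff_const),
    hψ.compact.comp_homeomorph (Homeomorph.subRight a), ?_⟩
  have h := tsupport_comp_eq_preimage ψ (Homeomorph.subRight a)
  change tsupport (ψ ∘ Homeomorph.subRight a) ⊆ D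
  rw [h]
  intro x hx
  have := ha _ (hψ.supp hx)
  simpa using this

lemma integrable_comp_add_smul {E : Type*} [NormedAddCommGroup E] {G : Eu d → E}
    (hGm : StronglyMeasurable G) (hGi : Integrable G) (h : Eu d) :
    Integrable (fun p : Eu d × ℝ => G (p.1 + p.2 • h))
      (volume.prod (volume.restrict (Set.Ioc (0 : ℝ) 1))) := by
  have hm : StronglyMeasurable fun p : Eu d × ℝ => G (p.1 + p.2 • h) :=
    hGm.comp_measurable (by fun_prop)
  refine ⟨hm.aestronglyMeasurable, ?_⟩
  rw [HasFiniteIntegral, lintegral_prod_symm _ hm.enorm.aemeasurable]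
  have (s : ℝ) : ∫⁻ x, ‖G (x + s • h)‖ₑ = ∫⁻ x, ‖G x‖ₑ :=
    lintegral_add_right_eq_self (fun x => ‖G x‖ₑ) (s • h)
  simpa [this, hasFiniteIntegral_iff_enorm] using hGi.2

/-- Along a segment in direction `h` that stays in `D`, the increment of a function is the integral
of its distributional derivative. -/
lemma ae_translate_sub_eq_integral {v : Eu d → ℝ} {G : Eu d → Eu d} (hvi : Integrable v)
    (hGm : StronglyMeasurable G) (hGi : Integrable G)
    (hG : ∀ φ : Eu d → ℝ, IsTestFunction D φ → ∀ e : Eu d,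
      ∫ x, v x * fderiv ℝ φ x e = - ∫ x, inner ℝ (G x) e * φ x)
    {A : Set (Eu d)} (hA : IsOpen A) {h : Eu d}
    (hAh : ∀ x ∈ A, ∀ s ∈ Set.Icc (0 : ℝ) 1, x + s • h ∈ D) :
    ∀ᵐ x, x ∈ A → v (x + h) - v x - ∫ s in Set.Ioc (0 : ℝ) 1, inner ℝ (G (x + s • h)) h = 0 := by
  have hpi := integrable_comp_add_smul hGm hGi h
  have hpi' : Integrable (fun p : Eu d × ℝ => inner ℝ (G (p.1 + p.2 • h)) h)
      (volume.prod (volume.restrict (Set.Ioc (0 : ℝ) 1))) := hpi.inner_const h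
  have hvh : Integrable fun x => v (x + h) := hvi.comp_add_right h
  refine hA.ae_eq_zero_of_integral_contDiff_smul_eq_zero (μ := volume)
    (((hvh.sub hvi).sub hpi'.integral_prod_left).locallyIntegrable.locallyIntegrableOn _) ?_
  intro ψ hψ hc hs
  have htest : IsTestFunction A ψ := ⟨hψ, hc, hs⟩
  obtain ⟨C, hC⟩ := hψ.continuous.bounded_above_of_compact_support hc
  have hdc : Continuous (fderiv ℝ ψ) := hψ.continuous_fderiv (by simp)
  obtain ⟨C', hC'⟩ := hdc.bounded_above_of_compact_support (hc.fderiv (𝕜 := ℝ))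
  -- Because v is only integrable, the translation is moved onto the test function, and the pairing
  -- is differentiated in s.
  have hderiv : ∀ s : ℝ, HasDerivAt (fun s : ℝ => ∫ x, v x * ψ (x - s • h))
      (∫ x, v x * (-(fderiv ℝ ψ (x - s • h) h))) s := by
    intro s
    refine (hasDerivAt_integral_of_dominated_loc_of_deriv_le
      (F := fun (s : ℝ) x => v x * ψ (x - s • h))
      (F' := fun (s : ℝ) x => v x * (-(fderiv ℝ ψ (x - s • h) h)))
      (bound := fun x => ‖v x‖ * (C' * ‖h‖))
      univ_mem (Eventually.of_forall fun s => ?_) ?_ ?_ ?_ (hvi.norm.mul_const _) ?_).2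
    · exact hvi.1.mul (by fun_prop : Continuous fun x => ψ (x - s • h)).aestronglyMeasurable
    · exact hvi.mul_bdd (by fun_prop : Continuous fun x => ψ (x - s • h)).aestronglyMeasurable
        (Eventually.of_forall fun x => hC _)
    · exact hvi.1.mul
        (by fun_prop : Continuous fun x => -(fderiv ℝ ψ (x - s • h) h)).aestronglyMeasurable
    · refine Eventually.of_forall fun x t _ => ?_
      rw [norm_mul, norm_neg]
      gcongr
      exact (ContinuousLinearMap.le_opNorm _ _).trans (by gcongr; exact hC' _)
    · refine Eventually.of_forall fun x t _ => ?_
      have h1 : HasDerivAt (fun t : ℝ => x - t • h) (-h) t := by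
        simpa using ((hasDerivAt_id t).smul_const h).const_sub x
      have h2 := ((hψ.differentiable (by simp)).differentiableAt (x := x - t • h)).hasFDerivAt
      have := h2.comp_hasDerivAt t h1
      simpa using this.const_mul (v x)
  have hcont : Continuous fun s : ℝ => ∫ x, v x * (-(fderiv ℝ ψ (x - s • h) h)) := by
    refine continuous_of_dominated (bound := fun x => ‖v x‖ * (C' * ‖h‖)) (fun s => ?_)
      (fun s => Eventually.of_forall fun x => ?_) (hvi.norm.mul_const _)
      (Eventually.of_forall fun x => ?_)
    · exact hvi.1.mul
        (by fun_prop : Continuous fun x => -(fderiv ℝ ψ (x - s • h) h)).aestronglyMeasurable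
    · rw [norm_mul, norm_neg]
      gcongr
      exact (ContinuousLinearMap.le_opNorm _ _).trans (by gcongr; exact hC' _)
    · fun_prop
  -- The translate of ψ by s • h is still supported in D, as A + s • h lies in D. The weak
  -- derivative identity therefore applies, and a change of variables returns the shift to G.
  have hval : ∀ s ∈ Set.Ioc (0 : ℝ) 1, ∫ x, v x * (-(fderiv ℝ ψ (x - s • h) h))
      = ∫ x, ψ x * inner ℝ (G (x + s • h)) h := by
    intro s hs'
    have ht := htest.comp_sub (D := D) (a := s • h)
      fun x hx => hAh x hx s ⟨hs'.1.le, hs'.2⟩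
    have e1 := hG _ ht h
    have e2 : ∀ x, fderiv ℝ (fun x => ψ (x - s • h)) x = fderiv ℝ ψ (x - s • h) := fun x =>
      by
      simpa [sub_eq_add_neg] using fderiv_comp_add_right (f := ψ) (x := x) (-(s • h))
    simp only [e2] at e1
    simp only [mul_neg, integral_neg, e1, neg_neg]
    rw [← integral_add_right_eq_self _ (s • h)]
    refine integral_congr_ae (Eventually.of_forall fun x => ?_)
    simp [mul_comm]
  have hftc := intervalIntegral.integral_eq_sub_of_hasDerivAt (a := (0 : ℝ)) (b := 1)
    (fun s _ => hderiv s) (hcont.intervalIntegrable _ _)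
  rw [intervalIntegral.integral_of_le zero_le_one, setIntegral_congr_fun measurableSet_Ioc hval]
    at hftc
  have hswap : ∫ s in Set.Ioc (0 : ℝ) 1, ∫ x, ψ x * inner ℝ (G (x + s • h)) h
      = ∫ x, ψ x * ∫ s in Set.Ioc (0 : ℝ) 1, inner ℝ (G (x + s • h)) h := by
    simp_rw [← integral_const_mul]
    refine (integral_integral_swap (f := fun x s => ψ x * inner ℝ (G (x + s • h)) h) ?_).symm
    exact hpi'.bdd_mul (hψ.continuous.comp continuous_fst).aestronglyMeasurable
      (Eventually.of_forall fun x => hC _)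
  have hb : ∀ {f : Eu d → ℝ}, Integrable f → Integrable fun x => ψ x * f x := fun hf =>
    hf.bdd_mul hψ.continuous.aestronglyMeasurable (Eventually.of_forall fun x => hC _)
  have e0 : ∫ x, v x * ψ (x - (1 : ℝ) • h) = ∫ x, ψ x * v (x + h) := by
    rw [← integral_add_right_eq_self _ h]
    refine integral_congr_ae (Eventually.of_forall fun x => ?_)
    simp [mul_comm]
  simp only [smul_eq_mul, mul_sub]
  have h3 : Integrable fun x => ψ x * ∫ s in Set.Ioc (0 : ℝ) 1, inner ℝ (G (x + s • h)) h :=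
    hb hpi'.integral_prod_left
  have h4 : Integrable fun x => ψ x * v (x + h) - ψ x * v x := (hb hvh).sub (hb hvi)
  rw [integral_sub h4 h3, integral_sub (hb hvh) (hb hvi), ← hswap, hftc, e0]
  simp [mul_comm]

lemma ae_restrict_comp_add {A : Set (Eu d)} (hA : MeasurableSet A) {h : Eu d} (hAh : ∀ x ∈ A, x + h ∈ D)
    {P : Eu d → Prop} (hP : ∀ᵐ x ∂(volume.restrict D), P x) (hD : MeasurableSet D) :
    ∀ᵐ x ∂(volume.restrict A), P (x + h) := by
  rw [ae_restrict_iff' hD] at hP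
  rw [ae_restrict_iff' hA]
  have := (measurePreserving_add_right (volume : Measure (Eu d)) h).quasiMeasurePreserving.ae hP
  filter_upwards [this] with x hx hxA using hx (hAh x hxA)

/-- The difference quotients of an `H¹` function are controlled by its Dirichlet integral. -/
lemma lintegral_translate_sub_sq_le (hD : IsOpen D) (hDf : volume D ≠ ⊤) {v : Eu d → ℝ}
    {G : Eu d → Eu d} (hv : MemLp v 2 (volume.restrict D)) (hG : IsWeakGradient D v G)
    {A : Set (Eu d)} (hA : IsOpen A) {h : Eu d}
    (hAh : ∀ x ∈ A, ∀ s ∈ Set.Icc (0 : ℝ) 1, x + s • h ∈ D) :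
    ∫⁻ x in A, ‖v (x + h) - v x‖ₑ ^ 2 ≤ ‖h‖ₑ ^ 2 * ∫⁻ x in D, ‖G x‖ₑ ^ 2 := by
  have : IsFiniteMeasure (volume.restrict D) := ⟨by simpa using hDf.lt_top⟩
  have hAD : A ⊆ D := fun x hx => by simpa using hAh x hx 0 (by simp)
  have hAD' : ∀ x ∈ A, x + h ∈ D := fun x hx => by simpa using hAh x hx 1 (by simp)
  -- Strongly measurable representatives extended by zero live on the whole space, where translation
  -- invariance is available. The identity is only used on segments inside D, so the jump across the
  -- boundary plays no role.
  set v' : Eu d → ℝ := D.indicator (hv.1.mk v) with hv'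
  set G' : Eu d → Eu d := D.indicator (hG.memLp.1.mk G) with hG'
  have hvv : ∀ᵐ x ∂(volume.restrict D), v' x = v x := by
    filter_upwards [hv.1.ae_eq_mk, ae_restrict_mem hD.measurableSet] with x hx hxD
    simp [hv', hxD, hx]
  have hGG : ∀ᵐ x ∂(volume.restrict D), G' x = G x := by
    filter_upwards [hG.memLp.1.ae_eq_mk, ae_restrict_mem hD.measurableSet] with x hx hxD
    simp [hG', hxD, hx]
  have hGm : StronglyMeasurable G' :=
    hG.memLp.1.stronglyMeasurable_mk.indicator hD.measurableSet
  have hvi : Integrable v' :=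
    (integrable_indicator_iff hD.measurableSet).2
      ((hv.integrable one_le_two).congr hv.1.ae_eq_mk)
  have hGi : Integrable G' :=
    (integrable_indicator_iff hD.measurableSet).2
      ((hG.memLp.integrable one_le_two).congr hG.memLp.1.ae_eq_mk)
  have key := ae_translate_sub_eq_integral (D := D) hvi hGm hGi ?_ hA hAh
  swap
  · intro φ hφ e
    have h1 := hG.integral_eq φ hφ e
    have e1 : ∫ x in D, v x * fderiv ℝ φ x e = ∫ x, v' x * fderiv ℝ φ x e := by
      rw [← setIntegral_eq_integral_of_forall_compl_eq_zero (s := D)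
        (f := fun x => v' x * fderiv ℝ φ x e) fun x hx => by simp [hv', hx]]
      refine integral_congr_ae ?_
      filter_upwards [hvv] with x hx
      rw [hx]
    have e2 : ∫ x in D, inner ℝ (G x) e * φ x = ∫ x, inner ℝ (G' x) e * φ x := by
      rw [← setIntegral_eq_integral_of_forall_compl_eq_zero (s := D)
        (f := fun x => inner ℝ (G' x) e * φ x) fun x hx => by simp [hG', hx]]
      refine integral_congr_ae ?_
      filter_upwards [hGG] with x hx
      rw [hx]
    rw [← e1, ← e2, h1]
  have hmeas : StronglyMeasurable fun p : Eu d × ℝ => G' (p.1 + p.2 • h) :=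
    hGm.comp_measurable (by fun_prop)
  calc ∫⁻ x in A, ‖v (x + h) - v x‖ₑ ^ 2
      ≤ ∫⁻ x in A, ‖h‖ₑ ^ 2 * ∫⁻ s in Set.Ioc (0 : ℝ) 1, ‖G' (x + s • h)‖ₑ ^ 2 := by
        refine lintegral_mono_ae ?_
        filter_upwards [(ae_restrict_iff' hA.measurableSet).2 key,
          ae_restrict_of_ae_restrict_of_subset hAD hvv,
          ae_restrict_comp_add hA.measurableSet hAD' hvv hD.measurableSet] with x hx h1 h2
        rw [h1, h2, sub_eq_zero] at hx
        rw [hx]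
        have hle : ‖∫ s in Set.Ioc (0 : ℝ) 1, inner ℝ (G' (x + s • h)) h‖ₑ ≤
            ‖h‖ₑ * ∫⁻ s in Set.Ioc (0 : ℝ) 1, ‖G' (x + s • h)‖ₑ := by
          refine (enorm_integral_le_lintegral_enorm _).trans ?_
          rw [← lintegral_const_mul' _ _ enorm_ne_top]
          refine lintegral_mono fun s => ?_
          rw [mul_comm, ← ofReal_norm, ← ofReal_norm, ← ofReal_norm,
            ← ENNReal.ofReal_mul (norm_nonneg _)]
          exact ENNReal.ofReal_le_ofReal (norm_inner_le_norm _ _)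
        refine (pow_le_pow_left' hle 2).trans ?_
        rw [mul_pow]
        gcongr
        refine (sq_lintegral_le ?_).trans (by simp)
        exact (hmeas.comp_measurable measurable_prodMk_left).enorm.aemeasurable
    _ ≤ ‖h‖ₑ ^ 2 * ∫⁻ x in D, ‖G x‖ₑ ^ 2 := by
        rw [lintegral_const_mul' _ _ (by finiteness)]
        refine mul_le_mul_right ?_ _
        calc ∫⁻ x in A, ∫⁻ s in Set.Ioc (0 : ℝ) 1, ‖G' (x + s • h)‖ₑ ^ 2
            ≤ ∫⁻ x, ∫⁻ s in Set.Ioc (0 : ℝ) 1, ‖G' (x + s • h)‖ₑ ^ 2 :=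
              lintegral_mono' Measure.restrict_le_self le_rfl
          _ = ∫⁻ s in Set.Ioc (0 : ℝ) 1, ∫⁻ x, ‖G' (x + s • h)‖ₑ ^ 2 :=
              lintegral_lintegral_swap (hmeas.enorm.pow_const 2).aemeasurable
          _ = ∫⁻ x, ‖G' x‖ₑ ^ 2 := by
              have (s : ℝ) : ∫⁻ x, ‖G' (x + s • h)‖ₑ ^ 2 = ∫⁻ x, ‖G' x‖ₑ ^ 2 :=
                lintegral_add_right_eq_self (fun x => ‖G' x‖ₑ ^ 2) (s • h)
              simp [this]
          _ = ∫⁻ x in D, ‖G x‖ₑ ^ 2 := by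
              rw [← lintegral_indicator hD.measurableSet]
              have : ∀ᵐ x, x ∈ D → G' x = G x := (ae_restrict_iff' hD.measurableSet).1 hGG
              refine lintegral_congr_ae ?_
              filter_upwards [this] with x hx
              by_cases hxD : x ∈ D
              · simp [hxD, hx hxD]
              · simp [hG', hxD]

end TraceForm

end

/-! ### From almost everywhere to L² convergence on a ball -/

noncomputable section

namespace TraceForm

variable {d : ℕ} {D : Set (Eu d)}

lemma add_sq_le_two_mul (a b : ENNReal) : (a + b) ^ 2 ≤ 2 * (a ^ 2 + b ^ 2) := by
  have h := ENNReal.rpow_add_le_mul_rpow_add_rpow a b (p := 2) one_le_two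
  norm_num at h
  exact h

lemma enorm_sq_le_two_mul {E : Type*} [NormedAddCommGroup E] (a b : E) :
    ‖a‖ₑ ^ 2 ≤ 2 * (‖a - b‖ₑ ^ 2 + ‖b‖ₑ ^ 2) := by
  have h : ‖a‖ₑ ≤ ‖a - b‖ₑ + ‖b‖ₑ := by simpa using enorm_add_le (a - b) b
  exact (pow_le_pow_left' h 2).trans (add_sq_le_two_mul _ _)

/-- Fatou's lemma for almost everywhere convergent sequences with bounded integrals. -/
lemma lintegral_le_of_ae_tendsto {α : Type*} [MeasurableSpace α] {μ : Measure α}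
    {F : ℕ → α → ENNReal} {f : α → ENNReal} {C : ENNReal} (hF : ∀ n, AEMeasurable (F n) μ)
    (hlim : ∀ᵐ x ∂μ, Tendsto (fun n => F n x) atTop (𝓝 (f x)))
    (hC : ∀ᶠ n in atTop, ∫⁻ x, F n x ∂μ ≤ C) : ∫⁻ x, f x ∂μ ≤ C := by
  calc ∫⁻ x, f x ∂μ = ∫⁻ x, liminf (fun n => F n x) atTop ∂μ :=
        lintegral_congr_ae (hlim.mono fun x hx => hx.liminf_eq.symm)
    _ ≤ liminf (fun n => ∫⁻ x, F n x ∂μ) atTop := lintegral_liminf_le' hF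
    _ ≤ C := by
        refine (liminf_le_liminf hC).trans ?_
        simp

/-- Substitute x = y + h: two points of a ball of radius s differ by a vector of norm less than 2s.
-/
lemma lintegral_lintegral_ball_le {f : Eu d → ℝ} (hf : StronglyMeasurable f) (x₀ : Eu d) (s : ℝ) :
    ∫⁻ y in Metric.ball x₀ s, ∫⁻ x in Metric.ball x₀ s, ‖f x - f y‖ₑ ^ 2 ≤
      ∫⁻ h in Metric.ball 0 (2 * s), ∫⁻ x in Metric.ball x₀ s, ‖f (x + h) - f x‖ₑ ^ 2 := by
  set B := Metric.ball x₀ s with hB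
  have hBm : MeasurableSet B := Metric.isOpen_ball.measurableSet
  have hm : Measurable fun p : Eu d × Eu d => ‖f (p.1 + p.2) - f p.1‖ₑ ^ 2 :=
    (((hf.comp_measurable (measurable_fst.add measurable_snd)).sub
      (hf.comp_measurable measurable_fst)).enorm).pow_const 2
  calc ∫⁻ y in B, ∫⁻ x in B, ‖f x - f y‖ₑ ^ 2
      ≤ ∫⁻ y in B, ∫⁻ h in Metric.ball 0 (2 * s), ‖f (y + h) - f y‖ₑ ^ 2 := by
        refine setLIntegral_mono' hBm fun y hy => ?_
        rw [← lintegral_indicator hBm, ← lintegral_indicator Metric.isOpen_ball.measurableSet,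
          ← lintegral_add_left_eq_self _ y]
        refine lintegral_mono fun h => ?_
        by_cases hh : y + h ∈ B
        · rw [Set.indicator_of_mem hh, Set.indicator_of_mem]
          rw [hB, Metric.mem_ball, dist_eq_norm] at hh hy
          rw [mem_ball_zero_iff]
          calc ‖h‖ = ‖(y + h - x₀) - (y - x₀)‖ := by congr 1; abel
            _ ≤ ‖y + h - x₀‖ + ‖y - x₀‖ := norm_sub_le _ _
            _ < 2 * s := by linarith
        · simp [Set.indicator_of_notMem hh]
    _ = _ := lintegral_lintegral_swap hm.aemeasurable

/-- A sequence that tends to zero almost everywhere on a ball and whose increments tend to zero in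
quadratic mean tends to zero in `L²` of the ball. -/
lemma tendsto_lintegral_sq_of_translate {f : ℕ → Eu d → ℝ} (hf : ∀ m, StronglyMeasurable (f m))
    {x₀ : Eu d} {s : ℝ} (hs : 0 < s) {δ : ℕ → ENNReal} (hδ : Tendsto δ atTop (𝓝 0))
    (hlim : ∀ᵐ x ∂(volume.restrict (Metric.ball x₀ s)), Tendsto (fun m => f m x) atTop (𝓝 0))
    (hb : ∀ m, ∀ h ∈ Metric.ball (0 : Eu d) (2 * s),
      ∫⁻ x in Metric.ball x₀ s, ‖f m (x + h) - f m x‖ₑ ^ 2 ≤ δ m) :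
    Tendsto (fun m => ∫⁻ x in Metric.ball x₀ s, ‖f m x‖ₑ ^ 2) atTop (𝓝 0) := by
  set B := Metric.ball x₀ s with hB
  have hBm : MeasurableSet B := Metric.isOpen_ball.measurableSet
  have hBtop : volume B ≠ ⊤ := measure_ball_lt_top.ne
  have hBpos : 0 < volume B := Metric.measure_ball_pos _ _ hs
  have hBr : 0 < (volume B).toReal := ENNReal.toReal_pos hBpos.ne' hBtop
  -- Egorov's theorem with an exceptional set of at most half the volume of B, so that the remaining
  -- set E has positive measure.
  obtain ⟨t, htB, htm, htv, htu⟩ := tendstoUniformlyOn_of_ae_tendsto (μ := volume) (s := B)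
    (g := fun _ => (0 : ℝ)) hf stronglyMeasurable_zero hBm hBtop
    ((ae_restrict_iff' hBm).1 hlim) (half_pos hBr)
  set E := B \ t with hE
  have hEm : MeasurableSet E := hBm.diff htm
  have hEB : E ⊆ B := Set.sdiff_subset
  have hEtop : volume E ≠ ⊤ := (measure_mono hEB).trans_lt hBtop.lt_top |>.ne
  have hE0 : volume E ≠ 0 := by
    intro h0
    have h1 : volume B ≤ volume E + volume t := by
      calc volume B ≤ volume (E ∪ t) := measure_mono fun x hx => by
            by_cases h : x ∈ t <;> simp [hE, h, hx]
        _ ≤ _ := measure_union_le _ _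
    rw [h0, zero_add] at h1
    have h2 := h1.trans htv
    rw [ENNReal.le_ofReal_iff_toReal_le hBtop (by positivity)] at h2
    linarith
  have hsup : Tendsto (fun m => ∫⁻ y in E, ‖f m y‖ₑ ^ 2) atTop (𝓝 0) := by
    rw [ENNReal.tendsto_nhds_zero]
    intro ε hε
    have hq : Tendsto (fun r : ℝ => ENNReal.ofReal r ^ 2 * volume E) (𝓝[>] 0) (𝓝 0) := by
      have : Continuous fun r : ℝ => ENNReal.ofReal r ^ 2 * volume E :=
        (ENNReal.continuous_mul_const hEtop).comp
          ((ENNReal.continuous_pow 2).comp ENNReal.continuous_ofReal)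
      simpa using (this.tendsto 0).mono_left nhdsWithin_le_nhds
    obtain ⟨r, hr, hr0⟩ := ((hq.eventually (ge_mem_nhds hε)).and self_mem_nhdsWithin).exists
    filter_upwards [Metric.tendstoUniformlyOn_iff.1 htu r hr0] with m hm
    refine le_trans ?_ hr
    rw [← setLIntegral_const]
    refine setLIntegral_mono measurable_const fun x hx => ?_
    gcongr
    rw [← ofReal_norm]
    refine ENNReal.ofReal_le_ofReal ?_
    have := hm x hx
    rw [dist_comm, dist_zero_right] at this
    exact this.le
  set V := volume (Metric.ball (0 : Eu d) (2 * s)) with hV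
  have hVtop : V ≠ ⊤ := measure_ball_lt_top.ne
  -- A Poincaré-type inequality: average |f(x)|² ≤ 2(|f(x) - f(y)|² + |f(y)|²) over y in E, where f
  -- is uniformly small.
  have hle : ∀ m, ∫⁻ x in B, ‖f m x‖ₑ ^ 2 ≤
      (volume E)⁻¹ * (2 * (V * δ m + volume B * ∫⁻ y in E, ‖f m y‖ₑ ^ 2)) := by
    intro m
    rw [← ENNReal.mul_le_iff_le_inv hE0 hEtop]
    have hm1 : Measurable fun x => ‖f m x‖ₑ ^ 2 := (hf m).enorm.pow_const 2
    have hm2 : Measurable fun p : Eu d × Eu d => ‖f m p.2 - f m p.1‖ₑ ^ 2 :=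
      (((hf m).comp_measurable measurable_snd).sub
        ((hf m).comp_measurable measurable_fst)).enorm.pow_const 2
    calc volume E * ∫⁻ x in B, ‖f m x‖ₑ ^ 2
        = ∫⁻ y in E, ∫⁻ x in B, ‖f m x‖ₑ ^ 2 := by
          rw [setLIntegral_const, mul_comm]
      _ ≤ ∫⁻ y in E, 2 * ((∫⁻ x in B, ‖f m x - f m y‖ₑ ^ 2) + volume B * ‖f m y‖ₑ ^ 2) := by
          refine lintegral_mono fun y => ?_
          calc ∫⁻ x in B, ‖f m x‖ₑ ^ 2
              ≤ ∫⁻ x in B, 2 * (‖f m x - f m y‖ₑ ^ 2 + ‖f m y‖ₑ ^ 2) :=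
                lintegral_mono fun x => enorm_sq_le_two_mul _ _
            _ = _ := by
                rw [lintegral_const_mul' _ _ (by norm_num),
                  lintegral_add_right _ measurable_const, setLIntegral_const, mul_comm (volume B)]
      _ = 2 * ((∫⁻ y in E, ∫⁻ x in B, ‖f m x - f m y‖ₑ ^ 2)
            + volume B * ∫⁻ y in E, ‖f m y‖ₑ ^ 2) := by
          rw [lintegral_const_mul' _ _ (by norm_num), lintegral_add_right _ (hm1.const_mul _),
            lintegral_const_mul _ hm1]
      _ ≤ 2 * (V * δ m + volume B * ∫⁻ y in E, ‖f m y‖ₑ ^ 2) := by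
          refine mul_le_mul_right (add_le_add_left ?_ _) _
          calc ∫⁻ y in E, ∫⁻ x in B, ‖f m x - f m y‖ₑ ^ 2
              ≤ ∫⁻ y in B, ∫⁻ x in B, ‖f m x - f m y‖ₑ ^ 2 :=
                lintegral_mono' (Measure.restrict_mono hEB le_rfl) le_rfl
            _ ≤ _ := lintegral_lintegral_ball_le (hf m) x₀ s
            _ ≤ ∫⁻ h in Metric.ball 0 (2 * s), δ m :=
                setLIntegral_mono measurable_const fun h hh => hb m h hh
            _ = V * δ m := by rw [setLIntegral_const, mul_comm]
  refine tendsto_of_tendsto_of_tendsto_of_le_of_le tendsto_const_nhds ?_ (fun _ => zero_le) hle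
  have h1 := ENNReal.Tendsto.const_mul hδ (Or.inr hVtop)
  have h2 := ENNReal.Tendsto.const_mul hsup (Or.inr hBtop)
  have h3 := ENNReal.Tendsto.const_mul (ENNReal.Tendsto.const_mul (h1.add h2)
    (Or.inr (by norm_num : (2 : ENNReal) ≠ ⊤))) (Or.inr (ENNReal.inv_ne_top.2 hE0))
  simpa using h3

end TraceForm

end

/-! ### Boundary charts and L² convergence on the whole domain -/

noncomputable section

namespace TraceForm

variable {d : ℕ} {D : Set (Eu d)}

/-- The unit vector that a rigid motion onto `ℝ^(d-1) × ℝ` sends to the vertical direction. -/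
def up (T : Eu d ≃ᵃⁱ[ℝ] WithLp 2 (Eu (d - 1) × ℝ)) : Eu d :=
  T.linearIsometryEquiv.symm (WithLp.toLp 2 (0, 1))

section Chart

variable (T : Eu d ≃ᵃⁱ[ℝ] WithLp 2 (Eu (d - 1) × ℝ))

lemma norm_up : ‖up T‖ = 1 := by
  rw [up, LinearIsometryEquiv.norm_map, WithLp.prod_norm_eq_of_L2]
  simp

lemma map_add_smul_up (y : Eu d) (t : ℝ) :
    T (y + t • up T) = T y + WithLp.toLp 2 (0, t) := by
  rw [add_comm y, ← vadd_eq_add, T.map_vadd, map_smul, up, LinearIsometryEquiv.apply_symm_apply,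
    vadd_eq_add, add_comm, ← WithLp.toLp_smul]
  simp

@[simp] lemma fst_map_add_smul_up (y : Eu d) (t : ℝ) : (T (y + t • up T)).fst = (T y).fst := by
  rw [map_add_smul_up]; simp

@[simp] lemma snd_map_add_smul_up (y : Eu d) (t : ℝ) :
    (T (y + t • up T)).snd = (T y).snd + t := by
  rw [map_add_smul_up]; simp

variable {T} {g : Eu (d - 1) → ℝ} {x : Eu d} {r : ℝ}

/-- Strictly below the graph a neighbourhood misses D; strictly above, the point lies in the open
set D; a point on the graph is a limit of points of D directly above it. -/
lemma mem_frontier_iff_graph (hD : IsOpen D) (hg : Continuous g)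
    (h : ∀ y ∈ Metric.ball x r, (y ∈ D ↔ g (T y).fst < (T y).snd)) {y : Eu d}
    (hy : y ∈ Metric.ball x r) : y ∈ frontier D ↔ (T y).snd = g (T y).fst := by
  have hcont : Continuous fun z => (T z).snd - g (T z).fst :=
    ((WithLp.prod_continuous_ofLp 2 _ _).snd.comp T.continuous).sub
      (hg.comp ((WithLp.prod_continuous_ofLp 2 _ _).fst.comp T.continuous))
  have hball : Metric.ball x r ∈ 𝓝 y := Metric.isOpen_ball.mem_nhds hy
  rw [hD.frontier_eq, Set.mem_sdiff]
  constructor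
  · rintro ⟨hcl, hn⟩
    rw [h y hy, not_lt] at hn
    refine le_antisymm hn ?_
    by_contra! hlt
    have hev : ∀ᶠ z in 𝓝 y, (T z).snd - g (T z).fst < 0 :=
      hcont.continuousAt.eventually_lt continuousAt_const (by linarith)
    obtain ⟨z, ⟨hz1, hz2⟩, hzD⟩ := mem_closure_iff_nhds.1 hcl _ (Filter.inter_mem hev hball)
    have := (h z hz2).1 hzD
    simp only [Set.mem_ofPred_eq] at hz1
    linarith
  · intro he
    refine ⟨?_, fun hyD => ((h y hy).1 hyD).ne' he⟩
    rw [mem_closure_iff_nhds]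
    intro U hU
    have hc : Continuous fun t : ℝ => y + t • up T := by fun_prop
    have h0 : Tendsto (fun t : ℝ => y + t • up T) (𝓝[>] 0) (𝓝 y) := by
      simpa using (hc.tendsto 0).mono_left nhdsWithin_le_nhds
    obtain ⟨t, ⟨ht1, ht2⟩, ht0⟩ :=
      ((h0.eventually (Filter.inter_mem hU hball)).and self_mem_nhdsWithin).exists
    refine ⟨_, ht1, (h _ ht2).2 ?_⟩
    simp only [fst_map_add_smul_up, snd_map_add_smul_up]
    have : (0 : ℝ) < t := ht0
    linarith

end Chart

/-- Moving up in the chart never leaves the part above the graph. A fixed upward shift thus carries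
the part of D near x into an interior ball, where estimates are already available. -/
lemma IsSmoothBoundedDomain.exists_inward (hD : IsSmoothBoundedDomain D) {x : Eu d}
    (hx : x ∈ frontier D) : ∃ s : ℝ, 0 < s ∧ ∃ h : Eu d, Metric.ball (x + h) (3 * s) ⊆ D ∧
      ∀ y ∈ Metric.ball x s ∩ D, ∀ θ ∈ Set.Icc (0 : ℝ) 1, y + θ • h ∈ D := by
  obtain ⟨r, hr, T, g, hg, hch⟩ := hD.smooth_boundary x hx
  have hgr := (mem_frontier_iff_graph hD.isOpen hg.continuous hch (Metric.mem_ball_self hr)).1 hx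
  have hnear : ∀ y ∈ Metric.ball x (r / 2), ∀ t ∈ Set.Icc (0 : ℝ) (r / 2),
      y + t • up T ∈ Metric.ball x r := by
    intro y hy t ht
    rw [Metric.mem_ball, dist_eq_norm] at hy ⊢
    calc ‖y + t • up T - x‖ = ‖(y - x) + t • up T‖ := by congr 1; abel
      _ ≤ ‖y - x‖ + ‖t • up T‖ := norm_add_le _ _
      _ < r := by rw [norm_smul, norm_up, Real.norm_of_nonneg ht.1]; linarith [ht.2]
  have hxh : x + (r / 2) • up T ∈ D := by
    rw [hch _ (hnear x (Metric.mem_ball_self (by positivity)) _ ⟨by positivity, le_rfl⟩)]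
    simp only [fst_map_add_smul_up, snd_map_add_smul_up]
    linarith
  obtain ⟨ρ, hρ, hρD⟩ := Metric.isOpen_iff.1 hD.isOpen _ hxh
  -- The bound ρ / 3 fits the tripled ball into D; the bound r / 2, together with the shift of
  -- length r / 2, keeps the segments inside the chart.
  refine ⟨min (ρ / 3) (r / 2), by positivity, (r / 2) • up T,
    (Metric.ball_subset_ball ?_).trans hρD, ?_⟩
  · linarith [min_le_left (ρ / 3) (r / 2)]
  · rintro y ⟨hy, hyD⟩ θ hθ
    have hy' : y ∈ Metric.ball x (r / 2) := Metric.ball_subset_ball (min_le_right _ _) hy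
    have h1 : 0 ≤ θ * (r / 2) := mul_nonneg hθ.1 (by positivity)
    rw [smul_smul, hch _ (hnear y hy' _ ⟨h1, by nlinarith [hθ.2]⟩)]
    simp only [fst_map_add_smul_up, snd_map_add_smul_up]
    have := (hch y (Metric.ball_subset_ball (by linarith) hy')).1 hyD
    linarith

/-- A sequence that tends to zero almost everywhere and whose increments along segments in `D` tend
to zero in quadratic mean tends to zero in `L²(D)`. -/
lemma tendsto_lintegral_sq_domain (hD : IsSmoothBoundedDomain D) {f : ℕ → Eu d → ℝ}
    (hf : ∀ m, StronglyMeasurable (f m)) {δ : ℕ → ENNReal} (hδ : Tendsto δ atTop (𝓝 0))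
    (hlim : ∀ᵐ x ∂(volume.restrict D), Tendsto (fun m => f m x) atTop (𝓝 0))
    (hb : ∀ m, ∀ A : Set (Eu d), IsOpen A → ∀ h : Eu d,
      (∀ x ∈ A, ∀ s ∈ Set.Icc (0 : ℝ) 1, x + s • h ∈ D) →
      ∫⁻ x in A, ‖f m (x + h) - f m x‖ₑ ^ 2 ≤ ‖h‖ₑ ^ 2 * δ m) :
    Tendsto (fun m => ∫⁻ x in D, ‖f m x‖ₑ ^ 2) atTop (𝓝 0) := by
  -- The factor 3 leaves room for a point at distance less than s from the centre to be moved by an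
  -- increment of length less than 2s.
  have hball : ∀ x : Eu d, ∀ s : ℝ, 0 < s → Metric.ball x (3 * s) ⊆ D →
      Tendsto (fun m => ∫⁻ x in Metric.ball x s, ‖f m x‖ₑ ^ 2) atTop (𝓝 0) := by
    intro x s hs hsub
    refine tendsto_lintegral_sq_of_translate hf hs (δ := fun m => ENNReal.ofReal (2 * s) ^ 2 * δ m)
      ?_ ?_ ?_
    · simpa using ENNReal.Tendsto.const_mul hδ (Or.inr (by finiteness))
    · exact ae_restrict_of_ae_restrict_of_subset
        ((Metric.ball_subset_ball (by linarith)).trans hsub) hlim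
    · intro m h hh
      rw [mem_ball_zero_iff] at hh
      refine (hb m _ Metric.isOpen_ball h ?_).trans ?_
      · intro y hy θ hθ
        refine hsub ?_
        rw [Metric.mem_ball, dist_eq_norm] at hy ⊢
        calc ‖y + θ • h - x‖ = ‖(y - x) + θ • h‖ := by congr 1; abel
          _ ≤ ‖y - x‖ + ‖θ • h‖ := norm_add_le _ _
          _ < 3 * s := by
            rw [norm_smul, Real.norm_of_nonneg hθ.1]
            nlinarith [hθ.2, norm_nonneg h]
      · gcongr
        rw [← ofReal_norm]
        exact ENNReal.ofReal_le_ofReal hh.le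
  have hK : IsCompact (closure D) := hD.isBounded.isCompact_closure
  have key := hK.induction_on
    (p := fun S => Tendsto (fun m => ∫⁻ x in S ∩ D, ‖f m x‖ₑ ^ 2) atTop (𝓝 0))
    (by simp) (fun S S' hS h => ?_) (fun S S' h h' => ?_) (fun x hx => ?_)
  · rwa [Set.inter_eq_right.2 subset_closure] at key
  · exact tendsto_of_tendsto_of_tendsto_of_le_of_le tendsto_const_nhds h (fun _ => zero_le)
      fun m => lintegral_mono' (Measure.restrict_mono (Set.inter_subset_inter_left _ hS) le_rfl)
        le_rfl
  · refine tendsto_of_tendsto_of_tendsto_of_le_of_le tendsto_const_nhds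
      (by simpa using h.add h') (fun _ => zero_le) fun m => ?_
    rw [Set.union_inter_distrib_right]
    exact lintegral_union_le _ _ _
  by_cases hxD : x ∈ D
  · obtain ⟨ρ, hρ, hρD⟩ := Metric.isOpen_iff.1 hD.isOpen _ hxD
    refine ⟨Metric.ball x (ρ / 3), mem_nhdsWithin_of_mem_nhds (Metric.ball_mem_nhds _ (by positivity)),
      ?_⟩
    refine tendsto_of_tendsto_of_tendsto_of_le_of_le tendsto_const_nhds
      (hball x (ρ / 3) (by positivity) (by rwa [mul_div_cancel₀ _ (by norm_num)]))
      (fun _ => zero_le)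
      fun m => lintegral_mono' (Measure.restrict_mono Set.inter_subset_left le_rfl) le_rfl
  · obtain ⟨s, hs, h, hsub, hseg⟩ := hD.exists_inward (x := x)
      (by rw [hD.isOpen.frontier_eq]; exact ⟨hx, hxD⟩)
    refine ⟨Metric.ball x s, mem_nhdsWithin_of_mem_nhds (Metric.ball_mem_nhds _ hs), ?_⟩
    set A := Metric.ball x s ∩ D with hA
    -- Compare f(y) with f(y + h): the difference is controlled by `hb`, and y + h runs through an
    -- interior ball.
    have hle : ∀ m, ∫⁻ y in A, ‖f m y‖ₑ ^ 2 ≤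
        2 * (‖h‖ₑ ^ 2 * δ m + ∫⁻ y in Metric.ball (x + h) s, ‖f m y‖ₑ ^ 2) := by
      intro m
      have hm1 : Measurable fun x => ‖f m x‖ₑ ^ 2 := (hf m).enorm.pow_const 2
      have hm2 : Measurable fun x => ‖f m (x + h)‖ₑ ^ 2 := hm1.comp (measurable_add_const h)
      calc ∫⁻ y in A, ‖f m y‖ₑ ^ 2
          ≤ ∫⁻ y in A, 2 * (‖f m (y + h) - f m y‖ₑ ^ 2 + ‖f m (y + h)‖ₑ ^ 2) := by
            refine lintegral_mono fun y => ?_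
            rw [← enorm_neg (f m (y + h) - f m y), neg_sub]
            exact enorm_sq_le_two_mul _ _
        _ = 2 * ((∫⁻ y in A, ‖f m (y + h) - f m y‖ₑ ^ 2) + ∫⁻ y in A, ‖f m (y + h)‖ₑ ^ 2) := by
            rw [lintegral_const_mul' _ _ (by norm_num), lintegral_add_right _ hm2]
        _ ≤ _ := by
            refine mul_le_mul_right (add_le_add
              (hb m A (Metric.isOpen_ball.inter hD.isOpen) h hseg) ?_) _
            calc ∫⁻ y in A, ‖f m (y + h)‖ₑ ^ 2
                ≤ ∫⁻ y in Metric.ball x s, ‖f m (y + h)‖ₑ ^ 2 :=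
                  lintegral_mono' (Measure.restrict_mono Set.inter_subset_left le_rfl) le_rfl
              _ = ∫⁻ y in Metric.ball (x + h) s, ‖f m y‖ₑ ^ 2 := by
                  rw [← lintegral_indicator Metric.isOpen_ball.measurableSet,
                    ← lintegral_indicator Metric.isOpen_ball.measurableSet,
                    ← lintegral_add_right_eq_self
                      ((Metric.ball (x + h) s).indicator fun y => ‖f m y‖ₑ ^ 2) h]
                  refine lintegral_congr fun y => ?_
                  simp only [Set.indicator, Metric.mem_ball, dist_add_right]
    refine tendsto_of_tendsto_of_tendsto_of_le_of_le tendsto_const_nhds ?_ (fun _ => zero_le) hle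
    have h1 := ENNReal.Tendsto.const_mul (a := ‖h‖ₑ ^ 2) hδ (Or.inr (by finiteness))
    have h3 := ENNReal.Tendsto.const_mul (h1.add (hball (x + h) s hs hsub))
      (Or.inr (by norm_num : (2 : ENNReal) ≠ ⊤))
    simpa using h3

end TraceForm

end

/-! ### The extended Dirichlet space -/

noncomputable section

namespace TraceForm

variable {d : ℕ} {D : Set (Eu d)}

lemma energy_self_zero (hD : IsOpen D) (κ : Eu d → Matrix (Fin d) (Fin d) ℝ) :
    energy D κ 0 0 = 0 := by
  have h0 : IsWeakGradient D (0 : Eu d → ℝ) (0 : Eu d → Eu d) :=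
    ⟨MemLp.zero, fun φ _ e => by simp⟩
  rw [energy, integral_eq_zero_of_ae]
  filter_upwards [weakGrad_ae_eq hD h0] with x hx
  simp [hx]

lemma H1_subset_extendedDomain (hD : IsOpen D) (κ : Eu d → Matrix (Fin d) (Fin d) ℝ) :
    H1 D ⊆ extendedDomain D κ := by
  intro u hu
  refine ⟨fun _ => u, fun _ => hu, fun ε hε => ⟨0, fun m _ n _ => ?_⟩,
    Eventually.of_forall fun x => tendsto_const_nhds⟩
  rw [sub_self, energy_self_zero hD]
  exact hε

lemma exists_tendsto_eLpNorm_of_cauchy {α E : Type*} [MeasurableSpace α] {μ : Measure α}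
    [NormedAddCommGroup E] [CompleteSpace E] {f : ℕ → α → E} (hf : ∀ k, MemLp (f k) 2 μ)
    (hc : ∀ ε : ENNReal, 0 < ε → ∃ N, ∀ m ≥ N, ∀ n ≥ N, eLpNorm (f m - f n) 2 μ < ε) :
    ∃ g, MemLp g 2 μ ∧ Tendsto (fun k => eLpNorm (f k - g) 2 μ) atTop (𝓝 0) := by
  have hcs : CauchySeq fun k => (hf k).toLp (f k) := by
    rw [EMetric.cauchySeq_iff]
    intro ε hε
    obtain ⟨N, hN⟩ := hc ε hε
    refine ⟨N, fun m hm n hn => ?_⟩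
    rw [Lp.edist_toLp_toLp]
    exact hN m hm n hn
  obtain ⟨g, hg⟩ := cauchySeq_tendsto_of_complete hcs
  refine ⟨g, Lp.memLp g, ?_⟩
  rw [tendsto_iff_edist_tendsto_0] at hg
  refine hg.congr fun k => ?_
  rw [Lp.edist_def]
  refine eLpNorm_congr_ae ?_
  filter_upwards [(hf k).coeFn_toLp] with x hx
  simp [hx]

/-- If a sequence in `H¹(D)` converges almost everywhere and its gradients are Cauchy in `L²`, then
the limit lies in `H¹(D)` and the convergence holds in `H¹(D)`. -/
lemma tendsto_H1_of_ae_tendsto (hD : IsSmoothBoundedDomain D) {v : ℕ → Eu d → ℝ} {u : Eu d → ℝ}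
    (hv : ∀ k, v k ∈ H1 D)
    (hcau' : ∀ ε : ENNReal, 0 < ε → ∃ N, ∀ m ≥ N, ∀ n ≥ N,
      ∫⁻ x in D, ‖weakGrad D (v m - v n) x‖ₑ ^ 2 ≤ ε)
    (hlim : ∀ᵐ x ∂(volume.restrict D), Tendsto (fun k => v k x) atTop (𝓝 (u x))) :
    u ∈ H1 D ∧ Tendsto (fun k => eLpNorm (v k - u) 2 (volume.restrict D)) atTop (𝓝 0) ∧
      Tendsto (fun k => eLpNorm (weakGrad D (v k - u)) 2 (volume.restrict D)) atTop (𝓝 0) := by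
  have hDm : MeasurableSet D := hD.isOpen.measurableSet
  have hDf : volume D ≠ ⊤ := hD.isBounded.measure_lt_top.ne
  have hum : AEStronglyMeasurable u (volume.restrict D) :=
    aestronglyMeasurable_of_tendsto_ae atTop (fun k => (hv k).1.1) hlim
  have hgm : ∀ m, AEStronglyMeasurable (v m - u) (volume.restrict D) :=
    fun m => (hv m).1.1.sub hum
  set f : ℕ → Eu d → ℝ := fun m => (hgm m).mk (v m - u) with hf
  have hfe : ∀ m, ∀ᵐ x ∂(volume.restrict D), f m x = v m x - u x :=
    fun m => (hgm m).ae_eq_mk.symm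
  -- The supremum over all later indices bounds every n ≥ m at once, so the bound survives the
  -- passage n → ∞ in Fatou's lemma.
  set δ : ℕ → ENNReal := fun m =>
    ⨆ n ≥ m, ∫⁻ x in D, ‖weakGrad D (v m - v n) x‖ₑ ^ 2 with hδ
  have hδ0 : Tendsto δ atTop (𝓝 0) := by
    rw [ENNReal.tendsto_nhds_zero]
    intro ε hε
    obtain ⟨N, hN⟩ := hcau' ε hε
    filter_upwards [eventually_ge_atTop N] with m hm
    exact iSup₂_le fun n hn => hN m hm n (hm.trans hn)
  have hL2 : Tendsto (fun m => ∫⁻ x in D, ‖f m x‖ₑ ^ 2) atTop (𝓝 0) := by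
    refine tendsto_lintegral_sq_domain hD (fun m => (hgm m).stronglyMeasurable_mk) hδ0 ?_ ?_
    · filter_upwards [hlim, ae_all_iff.2 hfe] with x hx hxf
      simp only [hxf]
      simpa using hx.sub_const (u x)
    · intro m A hA h hseg
      have hAD : A ⊆ D := fun x hx => by simpa using hseg x hx 0 (by simp)
      have hAD' : ∀ x ∈ A, x + h ∈ D := fun x hx => by simpa using hseg x hx 1 (by simp)
      have htr : ∀ k, AEStronglyMeasurable (fun x => v k (x + h)) (volume.restrict A) := by
        intro k
        refine ⟨fun x => (hv k).1.1.mk (v k) (x + h),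
          (hv k).1.1.stronglyMeasurable_mk.comp_measurable (measurable_add_const h), ?_⟩
        exact ae_restrict_comp_add hA.measurableSet hAD' (hv k).1.1.ae_eq_mk hDm
      have hself : ∀ k, AEStronglyMeasurable (v k) (volume.restrict A) := fun k =>
        (hv k).1.1.mono_measure (Measure.restrict_mono hAD le_rfl)
      -- Fatou in n transfers the increment bound from v m - v n to v m - u, although u is not yet
      -- known to be weakly differentiable or square integrable.
      refine lintegral_le_of_ae_tendsto
        (F := fun n x => ‖(v m - v n) (x + h) - (v m - v n) x‖ₑ ^ 2) (fun n => ?_) ?_ ?_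
      · exact ((((htr m).sub (htr n)).sub ((hself m).sub (hself n))).enorm).pow_const 2
      · filter_upwards [ae_restrict_of_ae_restrict_of_subset hAD hlim,
          ae_restrict_comp_add hA.measurableSet hAD' hlim hDm,
          ae_restrict_of_ae_restrict_of_subset hAD (hfe m),
          ae_restrict_comp_add hA.measurableSet hAD' (hfe m) hDm] with x h1 h2 h3 h4
        rw [h3, h4]
        have := ((h2.const_sub (v m (x + h))).sub (h1.const_sub (v m x))).enorm
        exact ((ENNReal.continuous_pow 2).tendsto _).comp this
      · filter_upwards [eventually_ge_atTop m] with n hn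
        refine (lintegral_translate_sub_sq_le hD.isOpen hDf ((hv m).1.sub (hv n).1)
          (weakGrad_spec (sub_mem_H1 (hv m) (hv n)).2) hA hseg).trans ?_
        gcongr
        exact le_iSup₂ (f := fun n _ => ∫⁻ x in D, ‖weakGrad D (v m - v n) x‖ₑ ^ 2) n hn
  have hconv : Tendsto (fun m => eLpNorm (v m - u) 2 (volume.restrict D)) atTop (𝓝 0) := by
    rw [tendsto_eLpNorm_two_iff]
    refine hL2.congr fun m => lintegral_congr_ae ?_
    filter_upwards [hfe m] with x hx
    simp [hx]
  have hu : MemLp u 2 (volume.restrict D) := by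
    obtain ⟨m, hm⟩ := (hconv.eventually (gt_mem_nhds ENNReal.zero_lt_top)).exists
    have : MemLp (v m - u) 2 (volume.restrict D) := ⟨hgm m, hm⟩
    simpa using (hv m).1.sub this
  obtain ⟨G, hG, hGl⟩ := exists_tendsto_eLpNorm_of_cauchy
    (fun k => (weakGrad_spec (hv k).2).memLp) fun ε hε => by
      obtain ⟨η, hη, hηε⟩ := ENNReal.lt_iff_exists_nnreal_btwn.1 hε
      obtain ⟨N, hN⟩ := hcau' ((η : ENNReal) ^ 2) (by positivity)
      refine ⟨N, fun m hm n hn => lt_of_le_of_lt ?_ hηε⟩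
      have h1 := hN m hm n hn
      rw [← eLpNorm_two_sq, eLpNorm_congr_ae (weakGrad_sub_ae_eq hD.isOpen (hv m) (hv n))] at h1
      exact (ENNReal.pow_le_pow_left_iff two_ne_zero).1 h1
  have hGu : IsWeakGradient D u G := isWeakGradient_of_tendsto (fun k => (hv k).1)
    (fun k => weakGrad_spec (hv k).2) hu hG hconv hGl
  have huH : u ∈ H1 D := ⟨hu, G, hGu⟩
  refine ⟨huH, hconv, hGl.congr fun k => eLpNorm_congr_ae ?_⟩
  filter_upwards [weakGrad_sub_ae_eq hD.isOpen (hv k) huH, weakGrad_ae_eq hD.isOpen hGu]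
    with x h1 h2
  simp [h1, h2]

/-- Ellipticity makes the gradients Cauchy in L²; almost everywhere convergence then replaces any L²
hypothesis on the functions. -/
lemma extendedDomain_subset_H1 (hD : IsSmoothBoundedDomain D)
    {κ : Eu d → Matrix (Fin d) (Fin d) ℝ} (hκ : IsConductivity D κ) :
    extendedDomain D κ ⊆ H1 D := by
  rintro u ⟨v, hv, hcau, hlim⟩
  obtain ⟨c, hc, hce⟩ := exists_lintegral_weakGrad_le_energy hκ
  have hcau' : ∀ ε : ENNReal, 0 < ε → ∃ N, ∀ m ≥ N, ∀ n ≥ N,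
      ∫⁻ x in D, ‖weakGrad D (v m - v n) x‖ₑ ^ 2 ≤ ε := by
    intro ε hε
    obtain ⟨η, hη, hηε⟩ := ENNReal.lt_iff_exists_nnreal_btwn.1 hε
    have hη0 : (0 : ℝ) < η := by exact_mod_cast hη
    obtain ⟨N, hN⟩ := hcau (η / c) (by positivity)
    refine ⟨N, fun m hm n hn => (hce _ (sub_mem_H1 (hv m) (hv n))).trans ?_⟩
    refine le_trans ?_ hηε.le
    rw [ENNReal.ofReal_le_iff_le_toReal ENNReal.coe_ne_top, ENNReal.coe_toReal]
    have := (hN m hm n hn).le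
    rwa [le_div_iff₀' hc] at this
  exact (tendsto_H1_of_ae_tendsto hD hv hcau' hlim).1

end TraceForm

end

/-! ### Surface measure in Lipschitz graph boxes -/

noncomputable section

namespace TraceForm

variable {d : ℕ} {D : Set (Eu d)}

lemma euclideanHausdorffMeasure_image_le {X Y : Type*} [MetricSpace X] [MeasurableSpace X]
    [BorelSpace X] [MetricSpace Y] [MeasurableSpace Y] [BorelSpace Y] {K : NNReal} {f : X → Y}
    {s : Set X} (hf : LipschitzOnWith K f s) (n : ℕ) :
    Measure.euclideanHausdorffMeasure n (f '' s) ≤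
      (K : ENNReal) ^ n * Measure.euclideanHausdorffMeasure n s := by
  have h := hf.hausdorffMeasure_image_le (d := n) (Nat.cast_nonneg n)
  rw [ENNReal.rpow_natCast] at h
  simp only [Measure.euclideanHausdorffMeasure_def, Measure.smul_apply, ENNReal.smul_def,
    smul_eq_mul]
  rw [mul_left_comm]
  gcongr

section WithLpProd

variable {E : Type*} [NormedAddCommGroup E]

lemma dist_le_dist_fst_add_dist_snd (p q : WithLp 2 (E × ℝ)) :
    dist p q ≤ dist p.fst q.fst + dist p.snd q.snd := by
  rw [WithLp.prod_dist_eq_of_L2]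
  refine Real.sqrt_le_iff.2 ⟨by positivity, ?_⟩
  nlinarith [mul_nonneg (dist_nonneg (x := p.fst) (y := q.fst))
    (dist_nonneg (x := p.snd) (y := q.snd))]

lemma dist_fst_le (p q : WithLp 2 (E × ℝ)) : dist p.fst q.fst ≤ dist p q := by
  rw [WithLp.prod_dist_eq_of_L2]
  exact Real.le_sqrt_of_sq_le (by nlinarith [sq_nonneg (dist p.snd q.snd)])

end WithLpProd

/-- The point of `ℝ^d` at height `t` above the point over `a` of the graph of `g`. -/
def graphPoint (T : Eu d ≃ᵃⁱ[ℝ] WithLp 2 (Eu (d - 1) × ℝ)) (g : Eu (d - 1) → ℝ)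
    (a : Eu (d - 1)) (t : ℝ) : Eu d :=
  T.symm (WithLp.toLp 2 (a, g a + t))

section GraphPoint

variable {T : Eu d ≃ᵃⁱ[ℝ] WithLp 2 (Eu (d - 1) × ℝ)} {g : Eu (d - 1) → ℝ}

@[simp] lemma fst_map_graphPoint (a : Eu (d - 1)) (t : ℝ) :
    (T (graphPoint T g a t)).fst = a := by simp [graphPoint]

@[simp] lemma snd_map_graphPoint (a : Eu (d - 1)) (t : ℝ) :
    (T (graphPoint T g a t)).snd = g a + t := by simp [graphPoint]

lemma dist_graphPoint_le (a b : Eu (d - 1)) (s t : ℝ) :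
    dist (graphPoint T g a s) (graphPoint T g b t) ≤ dist a b + dist (g a + s) (g b + t) := by
  rw [graphPoint, graphPoint, T.symm.dist_map]
  exact dist_le_dist_fst_add_dist_snd _ _

lemma dist_le_dist_graphPoint (a b : Eu (d - 1)) (s t : ℝ) :
    dist a b ≤ dist (graphPoint T g a s) (graphPoint T g b t) := by
  rw [graphPoint, graphPoint, T.symm.dist_map]
  exact dist_fst_le (WithLp.toLp 2 (a, g a + s)) (WithLp.toLp 2 (b, g b + t))

lemma continuous_graphPoint (hg : Continuous g) :
    Continuous fun p : Eu (d - 1) × ℝ => graphPoint T g p.1 p.2 :=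
  T.symm.continuous.comp ((WithLp.prod_continuous_toLp 2 _ _).comp (by fun_prop))

lemma continuous_graphPoint_left (hg : Continuous g) (t : ℝ) :
    Continuous fun a => graphPoint T g a t :=
  (continuous_graphPoint hg).comp (continuous_id.prodMk continuous_const)

lemma lipschitzOnWith_graphPoint {L : NNReal} {B : Set (Eu (d - 1))} (hL : LipschitzOnWith L g B)
    (t : ℝ) : LipschitzOnWith (1 + L) (fun a => graphPoint T g a t) B := by
  refine LipschitzOnWith.of_dist_le_mul fun a ha b hb => ?_
  refine (dist_graphPoint_le a b t t).trans ?_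
  rw [dist_add_right]
  have := hL.dist_le_mul a ha b hb
  push_cast
  linarith

end GraphPoint

/-- A box around a boundary point in which the domain is the part above a Lipschitz graph. -/
structure IsGraphBox (D : Set (Eu d)) (x : Eu d) (R : ℝ)
    (T : Eu d ≃ᵃⁱ[ℝ] WithLp 2 (Eu (d - 1) × ℝ)) (g : Eu (d - 1) → ℝ) (L : NNReal) : Prop where
  pos : 0 < R
  contDiff : ContDiff ℝ ∞ g
  lipschitz : LipschitzOnWith L g (Metric.ball (T x).fst R)
  mem_domain : ∀ a ∈ Metric.ball (T x).fst R, ∀ t ∈ Set.Ioo 0 (2 * R), graphPoint T g a t ∈ D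
  mem_frontier : ∀ a ∈ Metric.ball (T x).fst R, graphPoint T g a 0 ∈ frontier D
  graphPoint_eq : ∀ y ∈ Metric.ball x R ∩ frontier D, graphPoint T g (T y).fst 0 = y

lemma IsSmoothBoundedDomain.exists_isGraphBox (hD : IsSmoothBoundedDomain D) {x : Eu d}
    (hx : x ∈ frontier D) : ∃ R T g L, IsGraphBox D x R T g L := by
  obtain ⟨r, hr, T, g, hg, hch⟩ := hD.smooth_boundary x hx
  have hgr := (mem_frontier_iff_graph hD.isOpen hg.continuous hch (Metric.mem_ball_self hr)).1 hx
  obtain ⟨L, hL⟩ : ∃ L : NNReal, LipschitzOnWith L g (Metric.closedBall (T x).fst r) := by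
    obtain ⟨C, hC⟩ := (isCompact_closedBall (T x).fst r).exists_bound_of_continuousOn
      (hg.continuous_fderiv (by simp)).continuousOn
    refine ⟨C.toNNReal, (convex_closedBall _ _).lipschitzOnWith_of_nnnorm_fderiv_le
      (fun a _ => (hg.differentiable (by simp)).differentiableAt) fun a ha => ?_⟩
    rw [← NNReal.coe_le_coe, coe_nnnorm]
    exact (hC a ha).trans (Real.le_coe_toNNReal C)
  -- A point over the base ball at height t < 2R above the graph is within R + L R + 2R = (L + 3) R
  -- < r of x, hence in the chart ball.
  set R := r / (L + 4) with hR
  have hL0 : (0 : ℝ) ≤ L := L.coe_nonneg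
  have hRpos : 0 < R := by positivity
  have hRr : (L + 4) * R = r := by rw [hR]; field_simp
  have hRle : R ≤ r := by nlinarith
  have hLR : LipschitzOnWith L g (Metric.ball (T x).fst R) :=
    hL.mono (Metric.ball_subset_closedBall.trans (Metric.closedBall_subset_closedBall hRle))
  have hxg : graphPoint T g (T x).fst 0 = x := by
    rw [graphPoint, add_zero, ← hgr]
    exact T.symm_apply_apply x
  have hin : ∀ a ∈ Metric.ball (T x).fst R, ∀ t ∈ Set.Ico 0 (2 * R),
      graphPoint T g a t ∈ Metric.ball x r := by
    intro a ha t ht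
    have h1 := dist_graphPoint_le (T := T) (g := g) a (T x).fst t 0
    rw [hxg] at h1
    have h2 := hLR.dist_le_mul a ha _ (Metric.mem_ball_self hRpos)
    have h3 : dist (g a + t) (g (T x).fst + 0) ≤ dist (g a) (g (T x).fst) + t := by
      refine (dist_add_add_le _ _ _ _).trans ?_
      rw [dist_zero_right, Real.norm_of_nonneg ht.1]
    rw [Metric.mem_ball] at ha ⊢
    have h4 : (L : ℝ) * dist a (T x).fst ≤ L * R := by gcongr
    nlinarith [ht.2]
  refine ⟨R, T, g, L, hRpos, hg, hLR, fun a ha t ht => ?_, fun a ha => ?_, fun y hy => ?_⟩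
  · rw [hch _ (hin a ha t ⟨ht.1.le, ht.2⟩)]
    simpa using ht.1
  · rw [mem_frontier_iff_graph hD.isOpen hg.continuous hch (hin a ha 0 ⟨le_rfl, by positivity⟩)]
    simp
  · have := (mem_frontier_iff_graph hD.isOpen hg.continuous hch
      (Metric.ball_subset_ball hRle hy.1)).1 hy.2
    rw [graphPoint, add_zero, ← this]
    exact T.symm_apply_apply y

namespace IsGraphBox

variable {x : Eu d} {R : ℝ} {T : Eu d ≃ᵃⁱ[ℝ] WithLp 2 (Eu (d - 1) × ℝ)} {g : Eu (d - 1) → ℝ}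
  {L : NNReal}

lemma fst_mem_ball {y : Eu d} {ρ : ℝ} (hy : y ∈ Metric.ball x ρ) :
    (T y).fst ∈ Metric.ball (T x).fst ρ := by
  rw [Metric.mem_ball] at hy ⊢
  exact (dist_fst_le _ _).trans_lt (by rwa [T.dist_map])

/-- In a graph box the surface measure is dominated by Lebesgue measure on the base. -/
lemma surfaceMeasure_restrict_le (h : IsGraphBox D x R T g L) :
    (surfaceMeasure D).restrict (Metric.ball x R) ≤ (((1 + L : NNReal) : ENNReal) ^ (d - 1)) •
      (volume.restrict (Metric.ball (T x).fst R)).map fun a => graphPoint T g a 0 := by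
  have hcont : Continuous fun a => graphPoint T g a 0 :=
    continuous_graphPoint_left h.contDiff.continuous 0
  refine Measure.le_iff.2 fun s hs => ?_
  rw [Measure.restrict_apply hs, surfaceMeasure,
    Measure.restrict_apply (hs.inter Metric.isOpen_ball.measurableSet), Measure.smul_apply,
    smul_eq_mul, Measure.map_apply hcont.measurable hs,
    Measure.restrict_apply (hcont.measurable hs),
    ← EuclideanSpace.euclideanHausdorffMeasure_eq_volume]
  have hlip := (lipschitzOnWith_graphPoint (T := T) h.lipschitz 0).mono
    (s := (fun a => graphPoint T g a 0) ⁻¹' s ∩ Metric.ball (T x).fst R) Set.inter_subset_right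
  refine le_trans (measure_mono ?_) (euclideanHausdorffMeasure_image_le hlip (d - 1))
  rintro y ⟨⟨hys, hyb⟩, hyf⟩
  have he := h.graphPoint_eq y ⟨hyb, hyf⟩
  exact ⟨(T y).fst, ⟨by simpa [he] using hys, fst_mem_ball hyb⟩, he⟩

lemma surfaceMeasure_ball_lt_top (h : IsGraphBox D x R T g L) :
    surfaceMeasure D (Metric.ball x R) < ⊤ := by
  have h1 := h.surfaceMeasure_restrict_le Set.univ
  rw [Measure.restrict_apply_univ, Measure.smul_apply, smul_eq_mul,
    Measure.map_apply (continuous_graphPoint_left h.contDiff.continuous 0).measurable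
      MeasurableSet.univ, Set.preimage_univ,
    Measure.restrict_apply_univ] at h1
  refine h1.trans_lt (ENNReal.mul_lt_top (by finiteness) measure_ball_lt_top)

/-- The projection to the base is 1-Lipschitz, so it does not increase Hausdorff measure. Since the
graph map is (1 + L)-Lipschitz, the image of the boundary patch contains a base ball of radius ρ /
(1 + L). -/
lemma le_surfaceMeasure_ball (h : IsGraphBox D x R T g L) {p : Eu d}
    (hp : p ∈ Metric.ball x (R / 2) ∩ frontier D) {ρ : ℝ} (hρ : 0 < ρ) (hρR : ρ ≤ R / 2) :
    ENNReal.ofReal ((ρ / (1 + L)) ^ (d - 1)) * volume (Metric.ball (0 : Eu (d - 1)) 1) ≤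
      surfaceMeasure D (Metric.ball p ρ) := by
  have hL0 : (0 : ℝ) ≤ L := L.coe_nonneg
  have h1L : (0 : ℝ) < 1 + L := by positivity
  set a := (T p).fst with ha
  have hpos : 0 < ρ / (1 + L) := by positivity
  have hle : ρ / (1 + L) ≤ ρ := div_le_self hρ.le (by linarith)
  have hav := Measure.addHaar_ball_of_pos (volume : Measure (Eu (d - 1))) a hpos
  rw [finrank_euclideanSpace_fin] at hav
  have haR : a ∈ Metric.ball (T x).fst (R / 2) := fst_mem_ball hp.1
  have hpe : graphPoint T g a 0 = p :=
    h.graphPoint_eq p ⟨Metric.ball_subset_ball (by linarith [h.pos]) hp.1, hp.2⟩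
  have hsub : Metric.ball a (ρ / (1 + L)) ⊆
      (fun y => (T y).fst) '' (Metric.ball p ρ ∩ frontier D) := by
    intro b hb
    have hbR : b ∈ Metric.ball (T x).fst R := by
      rw [Metric.mem_ball] at hb haR ⊢
      linarith [dist_triangle b a (T x).fst]
    have haR' : a ∈ Metric.ball (T x).fst R :=
      Metric.ball_subset_ball (by linarith [h.pos]) haR
    refine ⟨graphPoint T g b 0, ⟨?_, h.mem_frontier b hbR⟩, by simp⟩
    have := (lipschitzOnWith_graphPoint (T := T) h.lipschitz 0).dist_le_mul b hbR a haR'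
    rw [hpe] at this
    rw [Metric.mem_ball] at hb ⊢
    rw [lt_div_iff₀ h1L] at hb
    push_cast at this
    linarith
  have hlip : LipschitzOnWith 1 (fun y => (T y).fst) (Metric.ball p ρ ∩ frontier D) := by
    refine LipschitzOnWith.of_dist_le_mul fun y _ z _ => ?_
    rw [NNReal.coe_one, one_mul, ← T.dist_map y z]
    exact dist_fst_le _ _
  rw [← hav, surfaceMeasure, Measure.restrict_apply Metric.isOpen_ball.measurableSet,
    ← EuclideanSpace.euclideanHausdorffMeasure_eq_volume]
  refine (measure_mono hsub).trans ((euclideanHausdorffMeasure_image_le hlip (d - 1)).trans ?_)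
  simp

end IsGraphBox

lemma IsSmoothBoundedDomain.isCompact_frontier (hD : IsSmoothBoundedDomain D) :
    IsCompact (frontier D) :=
  hD.isBounded.isCompact_closure.of_isClosed_subset isClosed_frontier frontier_subset_closure

lemma surfaceMeasure_compl_frontier : surfaceMeasure D (frontier D)ᶜ = 0 := by
  rw [surfaceMeasure, Measure.restrict_apply isClosed_frontier.measurableSet.compl]
  simp

lemma ae_mem_frontier : ∀ᵐ x ∂(surfaceMeasure D), x ∈ frontier D :=
  ae_restrict_mem isClosed_frontier.measurableSet

lemma IsSmoothBoundedDomain.isFiniteMeasure (hD : IsSmoothBoundedDomain D) :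
    IsFiniteMeasure (surfaceMeasure D) := by
  have h : surfaceMeasure D (frontier D) < ⊤ :=
    hD.isCompact_frontier.measure_lt_top_of_nhdsWithin fun x hx => by
      obtain ⟨R, T, g, L, hbox⟩ := hD.exists_isGraphBox hx
      exact ⟨Metric.ball x R, mem_nhdsWithin_of_mem_nhds (Metric.ball_mem_nhds _ hbox.pos),
        hbox.surfaceMeasure_ball_lt_top⟩
  refine ⟨?_⟩
  rw [← measure_add_measure_compl isClosed_frontier.measurableSet, surfaceMeasure_compl_frontier,
    add_zero]
  exact h

/-- Lower Ahlfors regularity of the surface measure. -/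
lemma IsSmoothBoundedDomain.exists_le_surfaceMeasure_ball (hD : IsSmoothBoundedDomain D)
    {M : ℝ} (hM : 0 < M) : ∃ c : ℝ, 0 < c ∧ ∀ p ∈ frontier D, ∀ ρ : ℝ, 0 < ρ → ρ ≤ M →
      ENNReal.ofReal (c * ρ ^ (d - 1)) ≤ surfaceMeasure D (Metric.ball p ρ) := by
  have key : ∃ c : ℝ, 0 < c ∧ ∃ r₀ : ℝ, 0 < r₀ ∧ ∀ p ∈ frontier D ∩ frontier D, ∀ ρ : ℝ, 0 < ρ →
      ρ ≤ r₀ → ENNReal.ofReal (c * ρ ^ (d - 1)) ≤ surfaceMeasure D (Metric.ball p ρ) := by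
    refine hD.isCompact_frontier.induction_on
      (p := fun S => ∃ c : ℝ, 0 < c ∧ ∃ r₀ : ℝ, 0 < r₀ ∧ ∀ p ∈ S ∩ frontier D, ∀ ρ : ℝ, 0 < ρ →
        ρ ≤ r₀ → ENNReal.ofReal (c * ρ ^ (d - 1)) ≤ surfaceMeasure D (Metric.ball p ρ))
      ⟨1, one_pos, 1, one_pos, by simp⟩ ?_ ?_ ?_
    · rintro S S' hS ⟨c, hc, r₀, hr₀, h⟩
      exact ⟨c, hc, r₀, hr₀, fun p hp => h p ⟨hS hp.1, hp.2⟩⟩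
    · rintro S S' ⟨c, hc, r₀, hr₀, h⟩ ⟨c', hc', r₀', hr₀', h'⟩
      refine ⟨min c c', lt_min hc hc', min r₀ r₀', lt_min hr₀ hr₀', ?_⟩
      rintro p ⟨hp | hp, hpf⟩ ρ hρ hρr
      · refine le_trans (ENNReal.ofReal_le_ofReal ?_) (h p ⟨hp, hpf⟩ ρ hρ
          (hρr.trans (min_le_left _ _)))
        gcongr
        exact min_le_left _ _
      · refine le_trans (ENNReal.ofReal_le_ofReal ?_) (h' p ⟨hp, hpf⟩ ρ hρ
          (hρr.trans (min_le_right _ _)))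
        gcongr
        exact min_le_right _ _
    · intro x hx
      obtain ⟨R, T, g, L, hbox⟩ := hD.exists_isGraphBox hx
      have hL0 : (0 : ℝ) ≤ L := L.coe_nonneg
      have hV : 0 < (volume (Metric.ball (0 : Eu (d - 1)) 1)).toReal :=
        ENNReal.toReal_pos (Metric.measure_ball_pos _ _ one_pos).ne' measure_ball_lt_top.ne
      refine ⟨Metric.ball x (R / 2), mem_nhdsWithin_of_mem_nhds
        (Metric.ball_mem_nhds _ (half_pos hbox.pos)),
        (1 / (1 + (L : ℝ))) ^ (d - 1) * (volume (Metric.ball (0 : Eu (d - 1)) 1)).toReal,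
        by positivity, R / 2, half_pos hbox.pos, fun p hp ρ hρ hρR => ?_⟩
      refine le_trans (le_of_eq ?_) (hbox.le_surfaceMeasure_ball hp hρ hρR)
      rw [← ENNReal.ofReal_toReal (a := volume (Metric.ball (0 : Eu (d - 1)) 1))
        measure_ball_lt_top.ne, ← ENNReal.ofReal_mul (by positivity),
        ENNReal.toReal_ofReal hV.le]
      congr 1
      rw [div_pow, div_pow]
      ring
  obtain ⟨c, hc, r₀, hr₀, h⟩ := key
  -- For r₀ < ρ ≤ M the bound at radius r₀ suffices once the constant is lowered: (min r₀ M / M) ρ ≤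
  -- r₀.
  have hq : 0 < min r₀ M / M := by positivity
  have hq1 : (min r₀ M / M) ^ (d - 1) ≤ 1 :=
    pow_le_one₀ hq.le ((div_le_one hM).2 (min_le_right _ _))
  refine ⟨c * (min r₀ M / M) ^ (d - 1), by positivity, fun p hp ρ hρ hρM => ?_⟩
  rcases le_or_gt ρ r₀ with hle | hlt
  · refine le_trans (ENNReal.ofReal_le_ofReal ?_) (h p ⟨hp, hp⟩ ρ hρ hle)
    gcongr
    exact mul_le_of_le_one_right hc.le hq1
  · refine le_trans (ENNReal.ofReal_le_ofReal ?_) ((h p ⟨hp, hp⟩ r₀ hr₀ le_rfl).trans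
      (measure_mono (Metric.ball_subset_ball hlt.le)))
    rw [mul_assoc, ← mul_pow]
    gcongr
    calc min r₀ M / M * ρ ≤ min r₀ M / M * M := by gcongr
      _ = min r₀ M := div_mul_cancel₀ _ hM.ne'
      _ ≤ r₀ := min_le_left _ _

end TraceForm

end

/-! ### Regularized kernel averages -/

noncomputable section

namespace TraceForm

variable {d : ℕ} {D : Set (Eu d)}

/-- The regularized power kernel `(|x - y|² + ε²)^(-d)`. -/
def kernel (ε : ℝ) (x y : Eu d) : ℝ := ((‖x - y‖ ^ 2 + ε ^ 2) ^ d)⁻¹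

/-- The gradient of the regularized power kernel in the first variable. -/
def kernelGrad (ε : ℝ) (x y : Eu d) : Eu d :=
  (-(2 * d * ((‖x - y‖ ^ 2 + ε ^ 2) ^ (d + 1))⁻¹)) • (x - y)

section Kernel

variable {ε δ : ℝ} {x y : Eu d}

lemma kernel_nonneg : 0 ≤ kernel ε x y := by unfold kernel; positivity

lemma kernel_le (hδ : 0 < δ) (h : δ ^ 2 ≤ ‖x - y‖ ^ 2 + ε ^ 2) :
    kernel ε x y ≤ ((δ ^ 2) ^ d)⁻¹ := by
  unfold kernel
  gcongr

/-- One derivative costs a factor 1/δ: with q = |x - y|² + ε² ≥ δ², one has 2 |x - y| δ ≤ |x - y|² +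
δ² ≤ 2q. -/
lemma norm_kernelGrad_le (hδ : 0 < δ) (h : δ ^ 2 ≤ ‖x - y‖ ^ 2 + ε ^ 2) :
    ‖kernelGrad ε x y‖ ≤ 2 * d / δ * kernel ε x y := by
  set q := ‖x - y‖ ^ 2 + ε ^ 2 with hq
  have hq0 : 0 < q := lt_of_lt_of_le (by positivity) h
  have h1 : ‖x - y‖ * δ ≤ q := by nlinarith [sq_nonneg (‖x - y‖ - δ), sq_nonneg ε]
  rw [kernelGrad, norm_smul, norm_neg, Real.norm_of_nonneg (by positivity), kernel, ← hq,
    pow_succ, mul_inv]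
  have h2 : q⁻¹ * ‖x - y‖ ≤ 1 / δ := by
    rw [le_div_iff₀ hδ, mul_assoc, inv_mul_le_iff₀ hq0, mul_one]
    exact h1
  calc 2 * ↑d * ((q ^ d)⁻¹ * q⁻¹) * ‖x - y‖ = 2 * d * (q ^ d)⁻¹ * (q⁻¹ * ‖x - y‖) := by ring
    _ ≤ 2 * d * (q ^ d)⁻¹ * (1 / δ) := by gcongr
    _ = 2 * d / δ * (q ^ d)⁻¹ := by ring

lemma hasGradientAt_kernel (h : 0 < ‖x - y‖ ^ 2 + ε ^ 2) :
    HasGradientAt (fun x => kernel ε x y) (kernelGrad ε x y) x := by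
  rw [hasGradientAt_iff_hasFDerivAt]
  have h1 : HasFDerivAt (fun x : Eu d => ‖x - y‖ ^ 2) (2 • (innerSL ℝ (x - y))) x := by
    simpa using ((hasFDerivAt_id x).sub_const y).norm_sq
  have h2 : HasDerivAt (fun t : ℝ => ((t + ε ^ 2) ^ d)⁻¹)
      (-(d * ((‖x - y‖ ^ 2 + ε ^ 2) ^ (d + 1))⁻¹)) (‖x - y‖ ^ 2) := by
    have := (((hasDerivAt_id (‖x - y‖ ^ 2)).add_const (ε ^ 2)).pow d).inv
      (by simpa using (pow_pos h d).ne')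
    refine HasDerivAt.congr_deriv this ?_
    change -(d * (‖x - y‖ ^ 2 + ε ^ 2) ^ (d - 1) * 1) / ((‖x - y‖ ^ 2 + ε ^ 2) ^ d) ^ 2 = _
    -- The power rule produces the truncated exponent `d - 1`, so d = 0 is treated apart.
    rcases d with _ | n
    · simp
    · simp only [Nat.add_sub_cancel]
      field_simp
      ring
  have h3 := h2.comp_hasFDerivAt x h1
  refine h3.congr_fderiv ?_
  ext z
  simp [kernelGrad]
  ring

lemma measurable_kernel : Measurable fun p : Eu d × Eu d => kernel ε p.1 p.2 := by
  unfold kernel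
  fun_prop

lemma measurable_kernelGrad : Measurable fun p : Eu d × Eu d => kernelGrad ε p.1 p.2 := by
  unfold kernelGrad
  fun_prop

end Kernel

/-- The integral of `φ` against the kernel. -/
def kernelInt (σ : Measure (Eu d)) (φ : Eu d → ℝ) (ε : ℝ) (x : Eu d) : ℝ :=
  ∫ y, φ y * kernel ε x y ∂σ

/-- The integral of `φ` against the gradient of the kernel. -/
def kernelIntGrad (σ : Measure (Eu d)) (φ : Eu d → ℝ) (ε : ℝ) (x : Eu d) : Eu d :=
  ∫ y, φ y • kernelGrad ε x y ∂σ

/-- The kernel average of `φ`. -/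
def kernelAvg (σ : Measure (Eu d)) (φ : Eu d → ℝ) (ε : ℝ) (x : Eu d) : ℝ :=
  kernelInt σ φ ε x / kernelInt σ 1 ε x

/-- The gradient of the kernel average of `φ`. -/
def kernelAvgGrad (σ : Measure (Eu d)) (φ : Eu d → ℝ) (ε : ℝ) (x : Eu d) : Eu d :=
  (kernelInt σ 1 ε x)⁻¹ •
    (kernelIntGrad σ φ ε x - kernelAvg σ φ ε x • kernelIntGrad σ 1 ε x)

section KernelInt

variable {σ : Measure (Eu d)} {φ : Eu d → ℝ} {ε δ : ℝ} {x : Eu d}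

/-- The lower bound through δ covers two regimes together: any x with ε > 0 and δ = ε, and ε = 0
with x at distance at least δ from σ-almost every y. -/
lemma integrable_mul_kernel (hφ : Integrable φ σ) (hδ : 0 < δ)
    (h : ∀ᵐ y ∂σ, δ ^ 2 ≤ ‖x - y‖ ^ 2 + ε ^ 2) :
    Integrable (fun y => φ y * kernel ε x y) σ := by
  refine hφ.mul_bdd (c := ((δ ^ 2) ^ d)⁻¹)
    (measurable_kernel.comp measurable_prodMk_left).aestronglyMeasurable ?_
  filter_upwards [h] with y hy
  rw [Real.norm_of_nonneg kernel_nonneg]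
  exact kernel_le hδ hy

lemma integrable_smul_kernelGrad (hφ : Integrable φ σ) (hδ : 0 < δ)
    (h : ∀ᵐ y ∂σ, δ ^ 2 ≤ ‖x - y‖ ^ 2 + ε ^ 2) :
    Integrable (fun y => φ y • kernelGrad ε x y) σ := by
  refine hφ.smul_bdd (2 * d / δ * ((δ ^ 2) ^ d)⁻¹)
    (measurable_kernelGrad.comp measurable_prodMk_left).aestronglyMeasurable ?_
  filter_upwards [h] with y hy
  refine (norm_kernelGrad_le hδ hy).trans ?_
  gcongr
  exact kernel_le hδ hy

lemma hasGradientAt_kernelInt (hφ : Integrable φ σ) (hε : 0 < ε) (x : Eu d) :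
    HasGradientAt (kernelInt σ φ ε) (kernelIntGrad σ φ ε x) x := by
  have hq : ∀ x y : Eu d, ε ^ 2 ≤ ‖x - y‖ ^ 2 + ε ^ 2 := fun x y => by
    linarith [sq_nonneg ‖x - y‖]
  rw [hasGradientAt_iff_hasFDerivAt]
  have hI := hasFDerivAt_integral_of_dominated_of_fderiv_le (𝕜 := ℝ) (μ := σ) (x₀ := x)
    (F := fun x y => φ y * kernel ε x y)
    (F' := fun x y => InnerProductSpace.toDual ℝ (Eu d) (φ y • kernelGrad ε x y))
    (bound := fun y => ‖φ y‖ * (2 * d / ε * ((ε ^ 2) ^ d)⁻¹)) univ_mem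
    (Eventually.of_forall fun x => (integrable_mul_kernel hφ hε
      (Eventually.of_forall (hq x))).1)
    (integrable_mul_kernel hφ hε (Eventually.of_forall (hq x)))
    ((InnerProductSpace.toDual ℝ (Eu d)).continuous.comp_aestronglyMeasurable
      (integrable_smul_kernelGrad hφ hε (Eventually.of_forall (hq x))).1)
    (Eventually.of_forall fun y x _ => ?_) (hφ.norm.mul_const _)
    (Eventually.of_forall fun y x _ => ?_)
  · refine hI.congr_fderiv ?_
    exact (InnerProductSpace.toDual ℝ (Eu d)).toContinuousLinearEquiv.toContinuousLinearMap
      |>.integral_comp_comm (integrable_smul_kernelGrad hφ hε (Eventually.of_forall (hq x)))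
  · rw [LinearIsometryEquiv.norm_map, norm_smul]
    gcongr
    refine (norm_kernelGrad_le hε (hq x y)).trans ?_
    gcongr
    exact kernel_le hε (hq x y)
  · have := (hasGradientAt_kernel (lt_of_lt_of_le (by positivity) (hq x y))).hasFDerivAt
    rw [map_smul]
    exact this.const_mul (φ y)

/-- Near a given point this is the convolution of φ σ with a smooth kernel of compact support,
because K is bounded and cutting the kernel off at large distances changes nothing. -/
lemma contDiff_kernelInt {K : Set (Eu d)} (hK : Bornology.IsBounded K) (hσ : ∀ᵐ y ∂σ, y ∈ K)
    (hφ : Integrable φ σ) (hε : 0 < ε) : ContDiff ℝ ∞ (kernelInt σ φ ε) := by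
  obtain ⟨M, hM⟩ := hK.exists_norm_le
  rw [contDiff_iff_contDiffAt]
  intro x
  -- The inner radius exceeds ‖z - y‖ for all z in the unit ball around x and all y in K, so the
  -- cutoff is 1 wherever it is used.
  let χ : ContDiffBump (0 : Eu d) :=
    ⟨‖x‖ + 1 + |M| + 1, ‖x‖ + 1 + |M| + 2, by positivity, by linarith⟩
  set k : Eu d → ℝ := fun z => χ z * kernel ε z 0 with hk
  have hkc : ContDiff ℝ ∞ k := by
    refine χ.contDiff.mul ?_
    unfold kernel
    refine ContDiff.inv (((contDiff_id.sub contDiff_const).norm_sq ℝ).add contDiff_const |>.pow d)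
      fun z => by positivity
  have hks : HasCompactSupport k := χ.hasCompactSupport.mul_right
  have hconv := hks.contDiff_convolution_right (n := ⊤) (ContinuousLinearMap.lsmul ℝ ℝ)
    hφ.locallyIntegrable hkc
  refine (hconv.contDiffAt (x := x)).congr_of_eventuallyEq ?_
  filter_upwards [Metric.ball_mem_nhds x one_pos] with z hz
  rw [kernelInt, convolution]
  refine integral_congr_ae ?_
  filter_upwards [hσ] with y hy
  have hone : χ (z - y) = 1 := by
    refine χ.one_of_mem_closedBall ?_
    rw [mem_closedBall_zero_iff]
    rw [mem_ball_iff_norm] at hz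
    have h1 : ‖z - y‖ ≤ ‖z - x‖ + ‖x‖ + ‖y‖ := by
      calc ‖z - y‖ = ‖(z - x) + x - y‖ := by congr 1; abel
        _ ≤ ‖(z - x) + x‖ + ‖y‖ := norm_sub_le _ _
        _ ≤ _ := by gcongr; exact norm_add_le _ _
    change ‖z - y‖ ≤ ‖x‖ + 1 + |M| + 1
    linarith [hM y hy, le_abs_self M]
  simp [hk, hone, kernel]

lemma kernelInt_one_pos [IsFiniteMeasure σ] [NeZero σ] (hδ : 0 < δ)
    (h : ∀ᵐ y ∂σ, δ ^ 2 ≤ ‖x - y‖ ^ 2 + ε ^ 2) : 0 < kernelInt σ 1 ε x := by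
  have hi := integrable_mul_kernel (φ := 1) (σ := σ) (integrable_const 1) hδ h
  rw [kernelInt, integral_pos_iff_support_of_nonneg_ae
    (Eventually.of_forall fun y => by simpa using kernel_nonneg) hi]
  rw [pos_iff_ne_zero]
  intro h0
  have h1 : ∀ᵐ y ∂σ, ¬ (1 * kernel ε x y ≠ 0) := by
    simpa [Function.support, ae_iff] using h0
  have : ∀ᵐ y ∂σ, False := by
    filter_upwards [h1, h] with y hy hy'
    refine hy ?_
    have : 0 < ‖x - y‖ ^ 2 + ε ^ 2 := lt_of_lt_of_le (by positivity) hy'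
    unfold kernel
    positivity
  simp at this
  exact NeZero.ne σ this

lemma hasGradientAt_kernelAvg [IsFiniteMeasure σ] [NeZero σ] (hφ : Integrable φ σ) (hε : 0 < ε)
    (x : Eu d) : HasGradientAt (kernelAvg σ φ ε) (kernelAvgGrad σ φ ε x) x := by
  have hZ : 0 < kernelInt σ 1 ε x := kernelInt_one_pos hε
    (Eventually.of_forall fun y => by linarith [sq_nonneg ‖x - y‖])
  have h1 := (hasGradientAt_kernelInt hφ hε x).hasFDerivAt
  have h2 := (hasGradientAt_kernelInt (φ := 1) (integrable_const (μ := σ) 1) hε x).hasFDerivAt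
  rw [hasGradientAt_iff_hasFDerivAt]
  have h3 := h1.mul ((hasDerivAt_inv hZ.ne').comp_hasFDerivAt x h2)
  refine (h3.congr_fderiv ?_).congr_of_eventuallyEq (Eventually.of_forall fun z => ?_)
  · ext z
    simp [kernelAvgGrad, kernelAvg]
    field_simp
    ring
  · simp [kernelAvg, div_eq_mul_inv]

lemma contDiff_kernelAvg [IsFiniteMeasure σ] [NeZero σ] {K : Set (Eu d)}
    (hK : Bornology.IsBounded K) (hσ : ∀ᵐ y ∂σ, y ∈ K)
    (hφ : Integrable φ σ) (hε : 0 < ε) : ContDiff ℝ ∞ (kernelAvg σ φ ε) :=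
  (contDiff_kernelInt hK hσ hφ hε).div
    (contDiff_kernelInt hK hσ (φ := 1) (integrable_const 1) hε) fun x =>
    (kernelInt_one_pos hε (Eventually.of_forall fun y => by linarith [sq_nonneg ‖x - y‖])).ne'

end KernelInt

end TraceForm

end

/-! ### Gradient bounds for kernel averages, uniform in the regularization -/

noncomputable section

namespace TraceForm

variable {d : ℕ} {D : Set (Eu d)}

/-- Weighted Cauchy–Schwarz inequality for vector valued integrals. -/
lemma enorm_integral_smul_sq_le {α E : Type*} [MeasurableSpace α] {μ : Measure α}
    [NormedAddCommGroup E] [NormedSpace ℝ E] {f : α → ℝ} {b : α → E} {κ : α → ENNReal}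
    {A : ENNReal} (hA : A ≠ ⊤) (hf : AEMeasurable f μ) (hκ : AEMeasurable κ μ)
    (hb : ∀ᵐ y ∂μ, ‖b y‖ₑ ≤ A * κ y) :
    ‖∫ y, f y • b y ∂μ‖ₑ ^ 2 ≤ A ^ 2 * ((∫⁻ y, κ y ∂μ) * ∫⁻ y, ‖f y‖ₑ ^ 2 * κ y ∂μ) := by
  have hs : ∀ y, κ y ^ (1 / 2 : ℝ) * κ y ^ (1 / 2 : ℝ) = κ y := fun y => by
    rw [← ENNReal.rpow_add_of_nonneg _ _ (by norm_num) (by norm_num)]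
    norm_num
  have h1 : ‖∫ y, f y • b y ∂μ‖ₑ ≤
      A * ∫⁻ y, κ y ^ (1 / 2 : ℝ) * (‖f y‖ₑ * κ y ^ (1 / 2 : ℝ)) ∂μ := by
    refine (enorm_integral_le_lintegral_enorm _).trans ?_
    rw [← lintegral_const_mul' _ _ hA]
    refine lintegral_mono_ae ?_
    filter_upwards [hb] with y hy
    rw [enorm_smul]
    calc ‖f y‖ₑ * ‖b y‖ₑ ≤ ‖f y‖ₑ * (A * κ y) := by gcongr
      _ = A * (‖f y‖ₑ * (κ y ^ (1 / 2 : ℝ) * κ y ^ (1 / 2 : ℝ))) := by rw [hs]; ring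
      _ = _ := by ring
  have hκ' : AEMeasurable (fun y => κ y ^ (1 / 2 : ℝ)) μ := hκ.pow_const _
  have h2 := sq_lintegral_mul_le hκ' (hf.enorm.mul hκ')
  refine (pow_le_pow_left' h1 2).trans ?_
  rw [mul_pow]
  refine mul_le_mul_right (h2.trans (le_of_eq ?_)) _
  simp only [Pi.mul_apply, mul_pow]
  simp only [pow_two (κ _ ^ (1 / 2 : ℝ)), hs]

section KernelEstimates

variable {σ : Measure (Eu d)} [IsFiniteMeasure σ] {φ : Eu d → ℝ} {ε δ : ℝ} {x : Eu d}

lemma lintegral_kernel (hδ : 0 < δ) (h : ∀ᵐ y ∂σ, δ ^ 2 ≤ ‖x - y‖ ^ 2 + ε ^ 2) :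
    ∫⁻ y, ENNReal.ofReal (kernel ε x y) ∂σ = ENNReal.ofReal (kernelInt σ 1 ε x) := by
  have hi := integrable_mul_kernel (φ := 1) (σ := σ) (integrable_const 1) hδ h
  simp only [Pi.one_apply, one_mul] at hi
  simp only [kernelInt, Pi.one_apply, one_mul]
  rw [ofReal_integral_eq_lintegral_ofReal hi (Eventually.of_forall fun y => kernel_nonneg)]

lemma measurable_ofReal_kernel : Measurable fun y => ENNReal.ofReal (kernel ε x y) :=
  (measurable_kernel.comp measurable_prodMk_left).ennreal_ofReal

/-- Jensen's inequality: c minus the average of φ is the weighted average of c - φ. -/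
lemma kernelInt_mul_sub_kernelAvg_sq_le [NeZero σ] (hφ : Integrable φ σ) (hδ : 0 < δ)
    (h : ∀ᵐ y ∂σ, δ ^ 2 ≤ ‖x - y‖ ^ 2 + ε ^ 2) (c : ℝ) :
    ENNReal.ofReal (kernelInt σ 1 ε x) * ‖c - kernelAvg σ φ ε x‖ₑ ^ 2 ≤
      ∫⁻ z, ‖c - φ z‖ₑ ^ 2 * ENNReal.ofReal (kernel ε x z) ∂σ := by
  have hZ := kernelInt_one_pos (σ := σ) hδ h
  set Z := kernelInt σ 1 ε x with hZdef
  have hi := integrable_mul_kernel hφ hδ h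
  have hi1 := integrable_mul_kernel (φ := 1) (σ := σ) (integrable_const 1) hδ h
  have he : ∫ z, (c - φ z) • kernel ε x z ∂σ = Z * (c - kernelAvg σ φ ε x) := by
    simp only [smul_eq_mul, sub_mul]
    simp only [Pi.one_apply, one_mul] at hi1
    rw [integral_sub (hi1.const_mul c) hi, integral_const_mul, mul_sub, kernelAvg,
      mul_div_cancel₀ _ hZ.ne', hZdef, kernelInt, kernelInt]
    simp [mul_comm]
  have hcs := enorm_integral_smul_sq_le (μ := σ) (f := fun z => c - φ z) (A := 1)
    (b := fun z => kernel ε x z) ENNReal.one_ne_top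
    (aemeasurable_const.sub hφ.1.aemeasurable) measurable_ofReal_kernel.aemeasurable
    (Eventually.of_forall fun z => by
      rw [one_mul, ← ofReal_norm, Real.norm_of_nonneg kernel_nonneg])
  rw [he, lintegral_kernel hδ h, one_pow, one_mul, enorm_mul, mul_pow,
    Real.enorm_of_nonneg hZ.le, pow_two, mul_assoc] at hcs
  exact (ENNReal.mul_le_mul_iff_right (ENNReal.ofReal_pos.2 hZ).ne' ENNReal.ofReal_ne_top).1 hcs

/-- Normalization reproduces constants, so the total mass times the gradient equals the integral of
(φ(y) - m) against the kernel gradient, with m the average at x. Cauchy–Schwarz and then Jensen for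
φ(y) - m leave only differences of φ. -/
lemma kernelInt_sq_mul_kernelAvgGrad_sq_le [NeZero σ] (hφ : Integrable φ σ) (hδ : 0 < δ)
    (h : ∀ᵐ y ∂σ, δ ^ 2 ≤ ‖x - y‖ ^ 2 + ε ^ 2) :
    ENNReal.ofReal (kernelInt σ 1 ε x) ^ 2 * ‖kernelAvgGrad σ φ ε x‖ₑ ^ 2 ≤
      ENNReal.ofReal (2 * d / δ) ^ 2 * ∫⁻ y, ∫⁻ z, ‖φ y - φ z‖ₑ ^ 2 *
        (ENNReal.ofReal (kernel ε x y) * ENNReal.ofReal (kernel ε x z)) ∂σ ∂σ := by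
  have hZ := kernelInt_one_pos (σ := σ) hδ h
  have hgi := integrable_smul_kernelGrad hφ hδ h
  have hgi1 := integrable_smul_kernelGrad (φ := 1) (σ := σ) (integrable_const 1) hδ h
  simp only [Pi.one_apply, one_smul] at hgi1
  set m := kernelAvg σ φ ε x with hm
  have he : ∫ y, (φ y - m) • kernelGrad ε x y ∂σ =
      kernelInt σ 1 ε x • kernelAvgGrad σ φ ε x := by
    simp only [sub_smul]
    have h2 : ∫ y, m • kernelGrad ε x y ∂σ = m • kernelIntGrad σ 1 ε x := by
      rw [integral_smul, kernelIntGrad]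
      simp
    have h3 : Integrable (fun y => m • kernelGrad ε x y) σ := hgi1.smul m
    rw [integral_sub hgi h3, h2, kernelAvgGrad, smul_smul, mul_inv_cancel₀ hZ.ne',
      one_smul]
    rfl
  have hcs := enorm_integral_smul_sq_le (μ := σ) (f := fun y => φ y - m)
    (A := ENNReal.ofReal (2 * d / δ)) (b := fun y => kernelGrad ε x y) ENNReal.ofReal_ne_top
    (hφ.1.aemeasurable.sub_const m) measurable_ofReal_kernel.aemeasurable
    (by
      filter_upwards [h] with y hy
      rw [← ofReal_norm, ← ENNReal.ofReal_mul (by positivity)]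
      exact ENNReal.ofReal_le_ofReal (norm_kernelGrad_le hδ hy))
  rw [he, lintegral_kernel hδ h, enorm_smul, mul_pow, Real.enorm_of_nonneg hZ.le] at hcs
  refine hcs.trans (mul_le_mul_right ?_ _)
  rw [← lintegral_const_mul' _ _ ENNReal.ofReal_ne_top]
  refine lintegral_mono fun y => ?_
  calc ENNReal.ofReal (kernelInt σ 1 ε x) * (‖φ y - m‖ₑ ^ 2 * ENNReal.ofReal (kernel ε x y))
      = (ENNReal.ofReal (kernelInt σ 1 ε x) * ‖φ y - m‖ₑ ^ 2) *
          ENNReal.ofReal (kernel ε x y) := by ring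
    _ ≤ (∫⁻ z, ‖φ y - φ z‖ₑ ^ 2 * ENNReal.ofReal (kernel ε x z) ∂σ) *
          ENNReal.ofReal (kernel ε x y) := by
        gcongr
        exact kernelInt_mul_sub_kernelAvg_sq_le hφ hδ h (φ y)
    _ = _ := by
        rw [← lintegral_mul_const' _ _ ENNReal.ofReal_ne_top]
        refine lintegral_congr fun z => ?_
        ring

/-- On the ball of radius δ around p one has |x - y| ≤ 2δ and |ε| ≤ δ, so the kernel is at least
(5δ²)^(-d). The powers cancel: δ^(d+1) δ^(-2d) δ^(d-1) = 1. -/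
lemma le_pow_mul_kernelInt (hd : 1 ≤ d) (hδ : 0 < δ) (hε : |ε| ≤ δ)
    (h : ∀ᵐ y ∂σ, δ ^ 2 ≤ ‖x - y‖ ^ 2 + ε ^ 2)
    {p : Eu d} (hp : ‖x - p‖ ≤ δ) {c : ℝ}
    (hσ : ENNReal.ofReal (c * δ ^ (d - 1)) ≤ σ (Metric.ball p δ)) :
    ENNReal.ofReal (c / 5 ^ d) ≤
      ENNReal.ofReal (δ ^ (d + 1)) * ENNReal.ofReal (kernelInt σ 1 ε x) := by
  rw [← lintegral_kernel hδ h]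
  calc ENNReal.ofReal (c / 5 ^ d)
      = ENNReal.ofReal (δ ^ (d + 1)) * (ENNReal.ofReal (((5 * δ ^ 2) ^ d)⁻¹) *
          ENNReal.ofReal (c * δ ^ (d - 1))) := by
        rw [← ENNReal.ofReal_mul (by positivity), ← ENNReal.ofReal_mul (by positivity)]
        congr 1
        obtain ⟨n, rfl⟩ : ∃ n, d = n + 1 := ⟨d - 1, by omega⟩
        simp only [Nat.add_sub_cancel]
        field_simp
        ring
    _ ≤ ENNReal.ofReal (δ ^ (d + 1)) * (ENNReal.ofReal (((5 * δ ^ 2) ^ d)⁻¹) *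
          σ (Metric.ball p δ)) := by gcongr
    _ ≤ _ := by
        gcongr
        rw [← setLIntegral_const]
        refine (lintegral_mono_ae ?_).trans (lintegral_mono' Measure.restrict_le_self le_rfl)
        filter_upwards [ae_restrict_mem Metric.isOpen_ball.measurableSet, ae_restrict_of_ae h]
          with y hy hyδ
        refine ENNReal.ofReal_le_ofReal ?_
        have hq : 0 < ‖x - y‖ ^ 2 + ε ^ 2 := lt_of_lt_of_le (by positivity) hyδ
        unfold kernel
        gcongr
        rw [mem_ball_iff_norm'] at hy
        have h1 : ‖x - y‖ ≤ 2 * δ := by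
          calc ‖x - y‖ = ‖(x - p) + (p - y)‖ := by congr 1; abel
            _ ≤ ‖x - p‖ + ‖p - y‖ := norm_add_le _ _
            _ ≤ 2 * δ := by linarith
        have h2 : ε ^ 2 ≤ δ ^ 2 := sq_le_sq.2 (by rwa [abs_of_pos hδ])
        nlinarith [norm_nonneg (x - y)]

/-- The `ε`-independent majorant of the kernels. -/
def majorant (x y z : Eu d) : ENNReal :=
  ENNReal.ofReal ((max ‖x - y‖ ‖x - z‖ ^ (2 * d))⁻¹)

/-- The kernel at the nearer point is at most δ^(-2d), which the prefactor absorbs; the kernel at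
the farther point is at most its unregularized value. -/
lemma pow_mul_kernel_mul_kernel_le {y z : Eu d} (hδ : 0 < δ)
    (hy : δ ^ 2 ≤ ‖x - y‖ ^ 2 + ε ^ 2) (hz : δ ^ 2 ≤ ‖x - z‖ ^ 2 + ε ^ 2)
    (hy0 : 0 < ‖x - y‖) (hz0 : 0 < ‖x - z‖) :
    δ ^ (2 * d) * (kernel ε x y * kernel ε x z) ≤ (max ‖x - y‖ ‖x - z‖ ^ (2 * d))⁻¹ := by
  have key : ∀ {y z : Eu d}, δ ^ 2 ≤ ‖x - y‖ ^ 2 + ε ^ 2 → 0 < ‖x - z‖ →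
      δ ^ (2 * d) * (kernel ε x y * kernel ε x z) ≤ (‖x - z‖ ^ (2 * d))⁻¹ := by
    intro y z hy hz0
    have h1 : δ ^ (2 * d) * kernel ε x y ≤ 1 := by
      rw [pow_mul]
      calc (δ ^ 2) ^ d * kernel ε x y ≤ (δ ^ 2) ^ d * ((δ ^ 2) ^ d)⁻¹ := by
            gcongr
            exact kernel_le hδ hy
        _ = 1 := mul_inv_cancel₀ (by positivity)
    have h2 : kernel ε x z ≤ (‖x - z‖ ^ (2 * d))⁻¹ := by
      rw [pow_mul]
      exact kernel_le hz0 (by linarith [sq_nonneg ε])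
    calc δ ^ (2 * d) * (kernel ε x y * kernel ε x z)
        = (δ ^ (2 * d) * kernel ε x y) * kernel ε x z := by ring
      _ ≤ 1 * (‖x - z‖ ^ (2 * d))⁻¹ := by
          gcongr
          exact kernel_nonneg
      _ = _ := one_mul _
  rcases le_total ‖x - y‖ ‖x - z‖ with hle | hle
  · rw [max_eq_right hle]
    exact key hy hz0
  · rw [max_eq_left hle, mul_comm (kernel ε x y)]
    exact key hz hy0

/-- The gradient of the kernel average is bounded independently of the regularization. -/
lemma kernelAvgGrad_sq_le [NeZero σ] (hd : 1 ≤ d) (hφ : Integrable φ σ) (hδ : 0 < δ)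
    (hε : |ε| ≤ δ) (h : ∀ᵐ y ∂σ, δ ^ 2 ≤ ‖x - y‖ ^ 2 + ε ^ 2) (h0 : ∀ᵐ y ∂σ, 0 < ‖x - y‖)
    {p : Eu d} (hp : ‖x - p‖ ≤ δ) {c : ℝ}
    (hσ : ENNReal.ofReal (c * δ ^ (d - 1)) ≤ σ (Metric.ball p δ)) :
    ENNReal.ofReal (c / 5 ^ d) ^ 2 * ‖kernelAvgGrad σ φ ε x‖ₑ ^ 2 ≤
      ENNReal.ofReal (2 * d) ^ 2 * ∫⁻ y, ∫⁻ z, ‖φ y - φ z‖ₑ ^ 2 * majorant x y z ∂σ ∂σ := by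
  have h1 := le_pow_mul_kernelInt hd hδ hε h hp hσ
  have h2 := kernelInt_sq_mul_kernelAvgGrad_sq_le hφ hδ h
  calc ENNReal.ofReal (c / 5 ^ d) ^ 2 * ‖kernelAvgGrad σ φ ε x‖ₑ ^ 2
      ≤ (ENNReal.ofReal (δ ^ (d + 1)) * ENNReal.ofReal (kernelInt σ 1 ε x)) ^ 2 *
          ‖kernelAvgGrad σ φ ε x‖ₑ ^ 2 := by gcongr
    _ = ENNReal.ofReal (δ ^ (d + 1)) ^ 2 * (ENNReal.ofReal (kernelInt σ 1 ε x) ^ 2 *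
          ‖kernelAvgGrad σ φ ε x‖ₑ ^ 2) := by ring
    _ ≤ ENNReal.ofReal (δ ^ (d + 1)) ^ 2 * (ENNReal.ofReal (2 * d / δ) ^ 2 *
          ∫⁻ y, ∫⁻ z, ‖φ y - φ z‖ₑ ^ 2 *
            (ENNReal.ofReal (kernel ε x y) * ENNReal.ofReal (kernel ε x z)) ∂σ ∂σ) := by gcongr
    -- The mass bound and the derivative cost combine to δ^(2(d+1)) δ^(-2) = δ^(2d), exactly the
    -- power that one of the two kernels absorbs.
    _ = ENNReal.ofReal (2 * d) ^ 2 * (ENNReal.ofReal (δ ^ (2 * d)) *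
          ∫⁻ y, ∫⁻ z, ‖φ y - φ z‖ₑ ^ 2 *
            (ENNReal.ofReal (kernel ε x y) * ENNReal.ofReal (kernel ε x z)) ∂σ ∂σ) := by
        rw [← mul_assoc, ← mul_assoc, ← ENNReal.ofReal_pow (by positivity),
          ← ENNReal.ofReal_pow (by positivity), ← ENNReal.ofReal_pow (by positivity),
          ← ENNReal.ofReal_mul (by positivity), ← ENNReal.ofReal_mul (by positivity)]
        congr 2
        field_simp
        ring
    _ ≤ _ := by
        gcongr
        rw [← lintegral_const_mul' _ _ ENNReal.ofReal_ne_top]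
        refine lintegral_mono_ae ?_
        filter_upwards [h, h0] with y hy hy0
        rw [← lintegral_const_mul' _ _ ENNReal.ofReal_ne_top]
        refine lintegral_mono_ae ?_
        filter_upwards [h, h0] with z hz hz0
        rw [mul_left_comm]
        gcongr
        rw [← ENNReal.ofReal_mul kernel_nonneg, ← ENNReal.ofReal_mul (by positivity)]
        exact ENNReal.ofReal_le_ofReal (pow_mul_kernel_mul_kernel_le hδ hy hz hy0 hz0)

end KernelEstimates

lemma measurable_majorant {α : Type*} [MeasurableSpace α] {f g h : α → Eu d} (hf : Measurable f)
    (hg : Measurable g) (hh : Measurable h) :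
    Measurable fun q => majorant (f q) (g q) (h q) := by
  unfold majorant
  fun_prop

/-- With ρ = |y - z| / 2 the triangle inequality gives max(|x - y|, |x - z|) ≥ (ρ + |x - y|) / 2.
Rescaling by ρ leaves ρ^(d - 2d) times an integral that converges because 2d > d. The constant 8^d
collects 4^d from the halved maximum and 2^d from the definition of ρ. -/
lemma exists_lintegral_majorant_le (hd : 1 ≤ d) : ∃ C : ENNReal, C ≠ ⊤ ∧ ∀ y z : Eu d, y ≠ z →
    ∫⁻ x, majorant x y z ≤ C * ENNReal.ofReal ((dist y z ^ d)⁻¹) := by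
  have hfin : (Module.finrank ℝ (Eu d) : ℝ) < (2 * d : ℕ) := by
    rw [finrank_euclideanSpace_fin]
    exact_mod_cast (by omega)
  have hint : Integrable fun x : Eu d => ((1 + ‖x‖) ^ (2 * d))⁻¹ := by
    refine (integrable_one_add_norm (μ := (volume : Measure (Eu d))) hfin).congr
      (Eventually.of_forall fun x => ?_)
    simp only
    rw [Real.rpow_neg (by positivity), Real.rpow_natCast]
  set I := ∫ x : Eu d, ((1 + ‖x‖) ^ (2 * d))⁻¹ with hI
  have hI0 : 0 ≤ I := integral_nonneg fun x => by positivity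
  refine ⟨ENNReal.ofReal (8 ^ d * I), ENNReal.ofReal_ne_top, fun y z hyz => ?_⟩
  obtain ⟨ρ, hρ⟩ : ∃ ρ, ρ = dist y z / 2 := ⟨_, rfl⟩
  have hρ0 : 0 < ρ := by
    rw [hρ]
    have := dist_pos.2 hyz
    positivity
  have hpt : ∀ x : Eu d, (max ‖x - y‖ ‖x - z‖ ^ (2 * d))⁻¹ ≤
      4 ^ d * (ρ ^ (2 * d))⁻¹ * ((1 + ‖ρ⁻¹ • (x - y)‖) ^ (2 * d))⁻¹ := by
    intro x
    have h1 : 2 * ρ ≤ ‖x - y‖ + ‖x - z‖ := by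
      rw [hρ, dist_eq_norm]
      calc 2 * (‖y - z‖ / 2) = ‖(x - z) - (x - y)‖ := by
            rw [mul_div_cancel₀ _ two_ne_zero]; congr 1; abel
        _ ≤ ‖x - z‖ + ‖x - y‖ := norm_sub_le _ _
        _ = _ := add_comm _ _
    have h2 : (ρ + ‖x - y‖) / 2 ≤ max ‖x - y‖ ‖x - z‖ := by
      linarith [le_max_left ‖x - y‖ ‖x - z‖, le_max_right ‖x - y‖ ‖x - z‖]
    have h3 : 1 + ‖ρ⁻¹ • (x - y)‖ = (ρ + ‖x - y‖) / ρ := by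
      rw [norm_smul, norm_inv, Real.norm_of_nonneg hρ0.le]
      field_simp
    calc (max ‖x - y‖ ‖x - z‖ ^ (2 * d))⁻¹ ≤ (((ρ + ‖x - y‖) / 2) ^ (2 * d))⁻¹ := by
          gcongr
      _ = _ := by
          have h4 : (4 : ℝ) ^ d = 2 ^ (2 * d) := by rw [pow_mul]; norm_num
          have h5 : 0 < ρ + ‖x - y‖ := by positivity
          rw [h3, div_pow, div_pow, h4]
          field_simp
  calc ∫⁻ x, majorant x y z
      ≤ ∫⁻ x, ENNReal.ofReal (4 ^ d * (ρ ^ (2 * d))⁻¹ * ((1 + ‖ρ⁻¹ • (x - y)‖) ^ (2 * d))⁻¹) :=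
        lintegral_mono fun x => ENNReal.ofReal_le_ofReal (hpt x)
    _ = ∫⁻ x : Eu d, ENNReal.ofReal (4 ^ d * (ρ ^ (2 * d))⁻¹ * ((1 + ‖ρ⁻¹ • x‖) ^ (2 * d))⁻¹) :=
        lintegral_sub_right_eq_self (fun x : Eu d =>
          ENNReal.ofReal (4 ^ d * (ρ ^ (2 * d))⁻¹ * ((1 + ‖ρ⁻¹ • x‖) ^ (2 * d))⁻¹)) y
    _ = ENNReal.ofReal (4 ^ d * (ρ ^ (2 * d))⁻¹ * (ρ ^ d * I)) := by
        have hc := (hint.comp_smul (R := ρ⁻¹) (inv_ne_zero hρ0.ne')).const_mul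
          (4 ^ d * (ρ ^ (2 * d))⁻¹)
        rw [← ofReal_integral_eq_lintegral_ofReal hc
          (Eventually.of_forall fun x => by positivity), integral_const_mul,
          Measure.integral_comp_smul volume (fun x : Eu d => ((1 + ‖x‖) ^ (2 * d))⁻¹) ρ⁻¹]
        rw [finrank_euclideanSpace_fin, inv_pow, inv_inv, abs_of_pos (by positivity), smul_eq_mul]
    _ = _ := by
        rw [← ENNReal.ofReal_mul (by positivity)]
        congr 1
        have h8 : (8 : ℝ) ^ d = 4 ^ d * 2 ^ d := by rw [← mul_pow]; norm_num
        have hdρ : dist y z = 2 * ρ := by rw [hρ]; ring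
        rw [hdρ, h8, mul_pow, two_mul d, pow_add]
        field_simp

end TraceForm

end

/-! ### Extension of H^{1/2} boundary data to H¹ -/

noncomputable section

namespace TraceForm

variable {d : ℕ} {D : Set (Eu d)}

/-- The squared Gagliardo seminorm of order `1/2` with respect to a measure of dimension `d - 1`. -/
def gagliardo (σ : Measure (Eu d)) (φ : Eu d → ℝ) : ENNReal :=
  ∫⁻ x, ∫⁻ y, ‖φ x - φ y‖ₑ ^ 2 * ENNReal.ofReal ((dist x y ^ d)⁻¹) ∂σ ∂σ

lemma ofReal_sq_div_eq (a b : ℝ) :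
    ENNReal.ofReal (a ^ 2 / b) = ‖a‖ₑ ^ 2 * ENNReal.ofReal b⁻¹ := by
  rw [div_eq_mul_inv, ENNReal.ofReal_mul (sq_nonneg a), ← ofReal_norm,
    ← ENNReal.ofReal_pow (norm_nonneg _), Real.norm_eq_abs, sq_abs]

lemma mem_HHalfBoundary_iff {φ : L2Boundary D} :
    φ ∈ HHalfBoundary D ↔ gagliardo (surfaceMeasure D) φ < ⊤ := by
  simp only [HHalfBoundary, gagliardo, Set.mem_ofPred_eq, ofReal_sq_div_eq]

section Convergence

variable {σ : Measure (Eu d)} {φ : Eu d → ℝ} {x : Eu d} {r : ℝ} {e : ℕ → ℝ}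

lemma tendsto_kernelInt (hφ : Integrable φ σ) (hr : 0 < r) (h : ∀ᵐ y ∂σ, r ≤ ‖x - y‖)
    (he : Tendsto e atTop (𝓝 0)) :
    Tendsto (fun k => kernelInt σ φ (e k) x) atTop (𝓝 (kernelInt σ φ 0 x)) := by
  have hq : ∀ ε : ℝ, ∀ᵐ y ∂σ, r ^ 2 ≤ ‖x - y‖ ^ 2 + ε ^ 2 := fun ε => by
    filter_upwards [h] with y hy
    nlinarith [sq_nonneg ε]
  refine tendsto_integral_of_dominated_convergence (fun y => ‖φ y‖ * ((r ^ 2) ^ d)⁻¹)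
    (fun k => (integrable_mul_kernel hφ hr (hq _)).1) (hφ.norm.mul_const _) (fun k => ?_) ?_
  · filter_upwards [hq (e k)] with y hy
    rw [norm_mul, Real.norm_of_nonneg kernel_nonneg]
    gcongr
    exact kernel_le hr hy
  · filter_upwards [hq 0] with y hy
    have : ContinuousAt (fun ε : ℝ => φ y * kernel ε x y) 0 := by
      unfold kernel
      refine continuousAt_const.mul (ContinuousAt.inv₀ (by fun_prop) ?_)
      have : 0 < ‖x - y‖ ^ 2 + (0 : ℝ) ^ 2 := lt_of_lt_of_le (by positivity) hy
      positivity
    exact this.tendsto.comp he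

lemma tendsto_kernelIntGrad (hφ : Integrable φ σ) (hr : 0 < r) (h : ∀ᵐ y ∂σ, r ≤ ‖x - y‖)
    (he : Tendsto e atTop (𝓝 0)) :
    Tendsto (fun k => kernelIntGrad σ φ (e k) x) atTop (𝓝 (kernelIntGrad σ φ 0 x)) := by
  have hq : ∀ ε : ℝ, ∀ᵐ y ∂σ, r ^ 2 ≤ ‖x - y‖ ^ 2 + ε ^ 2 := fun ε => by
    filter_upwards [h] with y hy
    nlinarith [sq_nonneg ε]
  refine tendsto_integral_of_dominated_convergence
    (fun y => ‖φ y‖ * (2 * d / r * ((r ^ 2) ^ d)⁻¹))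
    (fun k => (integrable_smul_kernelGrad hφ hr (hq _)).1) (hφ.norm.mul_const _) (fun k => ?_) ?_
  · filter_upwards [hq (e k)] with y hy
    rw [norm_smul]
    gcongr
    refine (norm_kernelGrad_le hr hy).trans ?_
    gcongr
    exact kernel_le hr hy
  · filter_upwards [hq 0] with y hy
    have : ContinuousAt (fun ε : ℝ => φ y • kernelGrad ε x y) 0 := by
      have h0 : 0 < ‖x - y‖ ^ 2 + (0 : ℝ) ^ 2 := lt_of_lt_of_le (by positivity) hy
      have hi : ContinuousAt (fun ε : ℝ => ((‖x - y‖ ^ 2 + ε ^ 2) ^ (d + 1))⁻¹) 0 :=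
        ContinuousAt.inv₀ (by fun_prop) (by positivity)
      unfold kernelGrad
      fun_prop
    exact this.tendsto.comp he

variable [IsFiniteMeasure σ] [NeZero σ]

lemma tendsto_kernelAvg (hφ : Integrable φ σ) (hr : 0 < r) (h : ∀ᵐ y ∂σ, r ≤ ‖x - y‖)
    (he : Tendsto e atTop (𝓝 0)) :
    Tendsto (fun k => kernelAvg σ φ (e k) x) atTop (𝓝 (kernelAvg σ φ 0 x)) := by
  have hZ : 0 < kernelInt σ 1 0 x := kernelInt_one_pos hr (by
    filter_upwards [h] with y hy
    nlinarith)
  exact (tendsto_kernelInt hφ hr h he).div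
    (tendsto_kernelInt (φ := 1) (integrable_const 1) hr h he) hZ.ne'

lemma tendsto_kernelAvgGrad (hφ : Integrable φ σ) (hr : 0 < r) (h : ∀ᵐ y ∂σ, r ≤ ‖x - y‖)
    (he : Tendsto e atTop (𝓝 0)) :
    Tendsto (fun k => kernelAvgGrad σ φ (e k) x) atTop (𝓝 (kernelAvgGrad σ φ 0 x)) := by
  have hZ : 0 < kernelInt σ 1 0 x := kernelInt_one_pos hr (by
    filter_upwards [h] with y hy
    nlinarith)
  exact ((tendsto_kernelInt (φ := 1) (integrable_const 1) hr h he).inv₀ hZ.ne').smul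
    ((tendsto_kernelIntGrad hφ hr h he).sub ((tendsto_kernelAvg hφ hr h he).smul
      (tendsto_kernelIntGrad (φ := 1) (integrable_const 1) hr h he)))

/-- On the boundary the kernel averages approximate `φ` at a rate given by the seminorm. -/
lemma lintegral_kernelAvg_sub_sq_le (hd : 1 ≤ d) (hφ : Integrable φ σ) {K : Set (Eu d)}
    (hσK : ∀ᵐ y ∂σ, y ∈ K) {c ε : ℝ} (hε : 0 < ε)
    (hσ : ∀ p ∈ K, ENNReal.ofReal (c * ε ^ (d - 1)) ≤ σ (Metric.ball p ε)) :
    ENNReal.ofReal (c / 5 ^ d) * ∫⁻ x, ‖kernelAvg σ φ ε x - φ x‖ₑ ^ 2 ∂σ ≤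
      ENNReal.ofReal ε * gagliardo σ φ := by
  rw [gagliardo, ← lintegral_const_mul' _ _ ENNReal.ofReal_ne_top,
    ← lintegral_const_mul' _ _ ENNReal.ofReal_ne_top]
  refine lintegral_mono_ae ?_
  filter_upwards [hσK] with x hx
  have hq : ∀ y : Eu d, ε ^ 2 ≤ ‖x - y‖ ^ 2 + ε ^ 2 := fun y => by linarith [sq_nonneg ‖x - y‖]
  have h1 := le_pow_mul_kernelInt hd hε (abs_of_pos hε).le (Eventually.of_forall hq)
    (p := x) (by simpa using hε.le) (hσ x hx)
  have h2 := kernelInt_mul_sub_kernelAvg_sq_le hφ hε (Eventually.of_forall hq) (φ x)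
  rw [← enorm_neg, neg_sub]
  calc ENNReal.ofReal (c / 5 ^ d) * ‖φ x - kernelAvg σ φ ε x‖ₑ ^ 2
      ≤ (ENNReal.ofReal (ε ^ (d + 1)) * ENNReal.ofReal (kernelInt σ 1 ε x)) *
          ‖φ x - kernelAvg σ φ ε x‖ₑ ^ 2 := by gcongr
    _ = ENNReal.ofReal (ε ^ (d + 1)) * (ENNReal.ofReal (kernelInt σ 1 ε x) *
          ‖φ x - kernelAvg σ φ ε x‖ₑ ^ 2) := by ring
    _ ≤ ENNReal.ofReal (ε ^ (d + 1)) *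
          ∫⁻ z, ‖φ x - φ z‖ₑ ^ 2 * ENNReal.ofReal (kernel ε x z) ∂σ := by gcongr
    _ = ENNReal.ofReal ε * ∫⁻ z, ENNReal.ofReal (ε ^ d) *
          (‖φ x - φ z‖ₑ ^ 2 * ENNReal.ofReal (kernel ε x z)) ∂σ := by
        rw [lintegral_const_mul' _ _ ENNReal.ofReal_ne_top, ← mul_assoc,
          ← ENNReal.ofReal_mul hε.le, pow_succ']
    _ ≤ _ := by
        refine mul_le_mul_right (lintegral_mono fun z => ?_) _
        rcases eq_or_ne x z with rfl | hxz
        · simp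
        rw [mul_left_comm]
        gcongr
        rw [← ENNReal.ofReal_mul (by positivity)]
        refine ENNReal.ofReal_le_ofReal ?_
        have hpos : 0 < ‖x - z‖ := norm_pos_iff.2 (sub_ne_zero.2 hxz)
        rw [kernel, dist_eq_norm, ← div_eq_mul_inv, div_le_iff₀ (by positivity), ← inv_pow,
          ← mul_pow]
        gcongr
        -- The pointwise bound ε^d kernel ≤ |x - z|^(-d) is the d-th power of ε |x - z| ≤ |x - z|² +
        -- ε².
        rw [inv_mul_eq_div, le_div_iff₀ hpos]
        nlinarith [sq_nonneg (ε - ‖x - z‖), sq_nonneg ε, sq_nonneg ‖x - z‖]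

end Convergence

lemma IsSmoothBoundedDomain.frontier_nonempty (hD : IsSmoothBoundedDomain D) (hd : 1 ≤ d) :
    (frontier D).Nonempty := by
  have : Nonempty (Fin d) := ⟨⟨0, hd⟩⟩
  rw [nonempty_frontier_iff]
  refine ⟨hD.isConnected.nonempty, fun h => ?_⟩
  exact NormedSpace.unbounded_univ ℝ (Eu d) (h ▸ hD.isBounded)

/-- By Tonelli the integration in x is done first; it turns the majorant into a multiple of the
Gagliardo weight. The diagonal y = z contributes nothing, since the difference of φ vanishes there.
-/
lemma lintegral_lintegral_majorant_lt_top {σ : Measure (Eu d)} [SFinite σ] {φ : Eu d → ℝ}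
    (hd : 1 ≤ d) (hm : Measurable φ) (hφ : gagliardo σ φ < ⊤) :
    ∫⁻ x, ∫⁻ y, ∫⁻ z, ‖φ y - φ z‖ₑ ^ 2 * majorant x y z ∂σ ∂σ < ⊤ := by
  obtain ⟨C, hC, hle⟩ := exists_lintegral_majorant_le hd
  have hm0 {α : Type _} [MeasurableSpace α] {f g h : α → Eu d} (hf : Measurable f)
      (hg : Measurable g) (hh : Measurable h) :
      Measurable fun q => ‖φ (g q) - φ (h q)‖ₑ ^ 2 * majorant (f q) (g q) (h q) :=
    (((hm.comp hg).sub (hm.comp hh)).enorm.pow_const 2).mul (measurable_majorant hf hg hh)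
  have hm2 : Measurable fun q : Eu d × Eu d =>
      ∫⁻ z, ‖φ q.2 - φ z‖ₑ ^ 2 * majorant q.1 q.2 z ∂σ :=
    Measurable.lintegral_prod_right' (f := fun q : (Eu d × Eu d) × Eu d =>
      ‖φ q.1.2 - φ q.2‖ₑ ^ 2 * majorant q.1.1 q.1.2 q.2)
      (hm0 measurable_fst.fst measurable_fst.snd measurable_snd)
  rw [lintegral_lintegral_swap hm2.aemeasurable]
  refine lt_of_le_of_lt ?_ (ENNReal.mul_lt_top hC.lt_top hφ)
  rw [gagliardo, ← lintegral_const_mul' _ _ hC]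
  refine lintegral_mono fun y => ?_
  have hm3 : Measurable fun q : Eu d × Eu d => ‖φ y - φ q.2‖ₑ ^ 2 * majorant q.1 y q.2 :=
    hm0 measurable_fst measurable_const measurable_snd
  rw [lintegral_lintegral_swap hm3.aemeasurable, ← lintegral_const_mul' _ _ hC]
  refine lintegral_mono fun z => ?_
  rcases eq_or_ne y z with rfl | hyz
  · simp
  rw [lintegral_const_mul' _ _ (by finiteness), mul_left_comm]
  gcongr
  exact hle y z hyz

/-- Every function in `H^{1/2}(∂D)` is the trace of a function in `H¹(D)`. -/
theorem exists_hasTrace_of_mem_HHalfBoundary (hd : 1 ≤ d) (hD : IsSmoothBoundedDomain D)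
    {φ : L2Boundary D} (hφ : φ ∈ HHalfBoundary D) : ∃ u, HasTrace D u φ := by
  rw [mem_HHalfBoundary_iff] at hφ
  set σ := surfaceMeasure D with hσdef
  have : IsFiniteMeasure σ := hD.isFiniteMeasure
  obtain ⟨p₀, hp₀⟩ := hD.frontier_nonempty hd
  obtain ⟨M, hM⟩ := (hD.isBounded.subset_closedBall p₀)
  -- Radii up to |M| + 1 suffice: distances to the boundary are at most |M| and the regularization
  -- is at most 1.
  have hreg := hD.exists_le_surfaceMeasure_ball (M := |M| + 1) (by positivity)
  obtain ⟨c, hc, hreg⟩ := hreg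
  have : NeZero σ := ⟨fun h0 => by
    have := hreg p₀ hp₀ 1 one_pos (by linarith [abs_nonneg M])
    rw [← hσdef, h0] at this
    simp at this
    linarith⟩
  have hφi : Integrable φ σ := (Lp.memLp φ).integrable one_le_two
  have hφm : Measurable φ := (Lp.stronglyMeasurable φ).measurable
  have hK : IsCompact (frontier D) := hD.isCompact_frontier
  have hσK : ∀ᵐ y ∂σ, y ∈ frontier D := ae_mem_frontier
  set e : ℕ → ℝ := fun k => 1 / ((k : ℝ) + 1) with he
  have he0 : ∀ k, 0 < e k := fun k => by positivity
  have he1 : ∀ k, e k ≤ 1 := fun k => by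
    rw [he]
    exact (div_le_one (by positivity)).2 (by linarith [Nat.cast_nonneg (α := ℝ) k])
  have hel : Tendsto e atTop (𝓝 0) := tendsto_one_div_add_atTop_nhds_zero_nat
  have hdist : ∀ x ∈ D, 0 < Metric.infDist x (frontier D) ∧
      ∀ᵐ y ∂σ, Metric.infDist x (frontier D) ≤ ‖x - y‖ := by
    intro x hx
    have hxf : x ∉ frontier D := fun h => by
      rw [hD.isOpen.frontier_eq] at h
      exact h.2 hx
    refine ⟨(isClosed_frontier.notMem_iff_infDist_pos ⟨p₀, hp₀⟩).1 hxf, ?_⟩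
    filter_upwards [hσK] with y hy
    rw [← dist_eq_norm]
    exact Metric.infDist_le_dist_of_mem hy
  set F : Eu d → ENNReal := fun x => (ENNReal.ofReal (c / 5 ^ d) ^ 2)⁻¹ *
    (ENNReal.ofReal (2 * d) ^ 2 * ∫⁻ y, ∫⁻ z, ‖φ y - φ z‖ₑ ^ 2 * majorant x y z ∂σ ∂σ) with hF
  have hc5 : ENNReal.ofReal (c / 5 ^ d) ≠ 0 := (ENNReal.ofReal_pos.2 (by positivity)).ne'
  -- The function F bounds both the squared regularized gradient and its squared limit, so 4F
  -- dominates the square of their difference.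
  have hFint : ∫⁻ x in D, 4 * F x ≠ ⊤ := by
    refine ne_of_lt (lt_of_le_of_lt (lintegral_mono' Measure.restrict_le_self le_rfl) ?_)
    have hinv : (ENNReal.ofReal (c / 5 ^ d) ^ 2)⁻¹ ≠ ⊤ :=
      ENNReal.inv_ne_top.2 (pow_ne_zero 2 hc5)
    rw [lintegral_const_mul' _ _ (by norm_num), lintegral_const_mul' _ _ hinv,
      lintegral_const_mul' _ _ (by finiteness)]
    exact ENNReal.mul_lt_top (by norm_num) (ENNReal.mul_lt_top hinv.lt_top
      (ENNReal.mul_lt_top (by finiteness) (lintegral_lintegral_majorant_lt_top hd hφm hφ)))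
  -- The case ε = 0 is included in order to bound the limit field as well.
  have hgrad : ∀ x ∈ D, ∀ ε : ℝ, 0 ≤ ε → ε ≤ 1 → ‖kernelAvgGrad σ φ ε x‖ₑ ^ 2 ≤ F x := by
    intro x hx ε hε hε1
    obtain ⟨hr, hry⟩ := hdist x hx
    set r := Metric.infDist x (frontier D) with hrdef
    obtain ⟨p, hp, hpr⟩ := hK.exists_infDist_eq_dist ⟨p₀, hp₀⟩ x
    have hrM : r ≤ |M| := by
      refine (Metric.infDist_le_dist_of_mem hp₀).trans ?_
      have := hM hx
      rw [Metric.mem_closedBall] at this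
      exact this.trans (le_abs_self M)
    -- The regularized distance to the boundary: it dominates both ε and the distance r to the
    -- nearest boundary point p, and δ² bounds |x - y|² + ε² from below for almost every y.
    set δ := √(r ^ 2 + ε ^ 2) with hδdef
    have hδ2 : δ ^ 2 = r ^ 2 + ε ^ 2 := Real.sq_sqrt (by positivity)
    have hδ : 0 < δ := Real.sqrt_pos.2 (by positivity)
    have hδM : δ ≤ |M| + 1 := by
      refine Real.sqrt_le_iff.2 ⟨by positivity, ?_⟩
      nlinarith [abs_nonneg M]
    rw [hF, ← ENNReal.mul_le_iff_le_inv (pow_ne_zero 2 hc5) (by finiteness)]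
    refine kernelAvgGrad_sq_le hd hφi hδ ?_ ?_ ?_ (p := p) ?_ (hreg p hp δ hδ hδM)
    · exact Real.abs_le_sqrt (by linarith [sq_nonneg r])
    · filter_upwards [hry] with y hy
      rw [hδ2]
      gcongr
    · filter_upwards [hry] with y hy using lt_of_lt_of_le hr hy
    · rw [← dist_eq_norm, ← hpr]
      exact Real.le_sqrt_of_sq_le (by linarith [sq_nonneg ε])
  set w : ℕ → Eu d → ℝ := fun k => kernelAvg σ φ (e k) with hw
  have hwc : ∀ k, ContDiff ℝ ∞ (w k) := fun k =>
    contDiff_kernelAvg hK.isBounded hσK hφi (he0 k)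
  have hwc1 : ∀ k, ContDiff ℝ 1 (w k) := fun k => (hwc k).of_le (by simp)
  have hwg : ∀ k, gradient (w k) = kernelAvgGrad σ φ (e k) := fun k =>
    funext fun x => (hasGradientAt_kernelAvg hφi (he0 k) x).gradient
  have hwH : ∀ k, w k ∈ H1 D := fun k => mem_H1_of_contDiff hD.isBounded (hwc1 k)
  set V : Eu d → Eu d := kernelAvgGrad σ φ 0 with hV
  have hgm : ∀ k, AEStronglyMeasurable (gradient (w k)) (volume.restrict D) := fun k =>
    (isWeakGradient_gradient hD.isBounded (hwc1 k)).memLp.1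
  have hVlim : ∀ᵐ x ∂(volume.restrict D), Tendsto (fun k => gradient (w k) x) atTop (𝓝 (V x)) := by
    filter_upwards [ae_restrict_mem hD.isOpen.measurableSet] with x hx
    simp only [hwg]
    exact tendsto_kernelAvgGrad hφi (hdist x hx).1 (hdist x hx).2 hel
  have hVm : AEStronglyMeasurable V (volume.restrict D) :=
    aestronglyMeasurable_of_tendsto_ae atTop hgm hVlim
  have hgV : Tendsto (fun k => ∫⁻ x in D, ‖gradient (w k) x - V x‖ₑ ^ 2) atTop (𝓝 0) := by
    have := tendsto_lintegral_of_dominated_convergence' (μ := volume.restrict D)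
      (F := fun k x => ‖gradient (w k) x - V x‖ₑ ^ 2) (f := fun _ => 0) (fun x => 4 * F x)
      (fun k => ((hgm k).sub hVm).enorm.pow_const 2) (fun k => ?_) hFint ?_
    · simpa using this
    · filter_upwards [ae_restrict_mem hD.isOpen.measurableSet] with x hx
      have h1 := hgrad x hx (e k) (he0 k).le (he1 k)
      have h2 := hgrad x hx 0 le_rfl zero_le_one
      rw [← hwg] at h1
      calc ‖gradient (w k) x - V x‖ₑ ^ 2
          ≤ 2 * (‖gradient (w k) x - V x - -V x‖ₑ ^ 2 + ‖-V x‖ₑ ^ 2) := enorm_sq_le_two_mul _ _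
        _ ≤ 2 * (F x + F x) := by
            rw [sub_neg_eq_add, sub_add_cancel, enorm_neg]
            gcongr
        _ = 4 * F x := by ring
    · filter_upwards [hVlim] with x hx
      have h1 := (hx.sub_const (V x)).enorm
      rw [sub_self, enorm_zero] at h1
      simpa [Function.comp_def] using ((ENNReal.continuous_pow 2).tendsto 0).comp h1
  have hcau : ∀ ε : ENNReal, 0 < ε → ∃ N, ∀ m ≥ N, ∀ n ≥ N,
      ∫⁻ x in D, ‖weakGrad D (w m - w n) x‖ₑ ^ 2 ≤ ε := by
    intro ε hε
    have hε4 : 0 < ε / 4 := ENNReal.div_pos hε.ne' (by norm_num)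
    obtain ⟨N, hN⟩ := eventually_atTop.1 (ENNReal.tendsto_nhds_zero.1 hgV (ε / 4) hε4)
    refine ⟨N, fun m hm n hn => ?_⟩
    calc ∫⁻ x in D, ‖weakGrad D (w m - w n) x‖ₑ ^ 2
        ≤ ∫⁻ x in D, 2 * (‖gradient (w m) x - V x‖ₑ ^ 2 + ‖gradient (w n) x - V x‖ₑ ^ 2) := by
          refine lintegral_mono_ae ?_
          filter_upwards [weakGrad_ae_eq hD.isOpen ((isWeakGradient_gradient hD.isBounded
            (hwc1 m)).sub (hwH m).1 (hwH n).1 (isWeakGradient_gradient hD.isBounded (hwc1 n)))]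
            with x hx
          rw [hx]
          have := enorm_sq_le_two_mul (gradient (w m) x - gradient (w n) x)
            (V x - gradient (w n) x)
          rwa [sub_sub_sub_cancel_right, ← enorm_neg (V x - _), neg_sub] at this
      _ = 2 * ((∫⁻ x in D, ‖gradient (w m) x - V x‖ₑ ^ 2) +
            ∫⁻ x in D, ‖gradient (w n) x - V x‖ₑ ^ 2) := by
          have hmm : AEMeasurable (fun x => ‖gradient (w m) x - V x‖ₑ ^ 2) (volume.restrict D) :=
            ((hgm m).sub hVm).enorm.pow_const 2
          rw [lintegral_const_mul' _ _ (by norm_num), lintegral_add_left' hmm]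
      _ ≤ 2 * (ε / 4 + ε / 4) := by
          gcongr
          · exact hN m hm
          · exact hN n hn
      _ = ε := by
          rw [← two_mul, ← mul_assoc, show (2 : ENNReal) * 2 = 4 by norm_num]
          exact ENNReal.mul_div_cancel (by norm_num) (by norm_num)
  obtain ⟨huH, h1, h2⟩ := tendsto_H1_of_ae_tendsto hD hwH hcau (u := kernelAvg σ φ 0) (by
    filter_upwards [ae_restrict_mem hD.isOpen.measurableSet] with x hx
    exact tendsto_kernelAvg hφi (hdist x hx).1 (hdist x hx).2 hel)
  refine ⟨_, huH, w, hwc, h1, h2, ?_⟩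
  rw [tendsto_eLpNorm_two_iff]
  have hlim : Tendsto (fun k => (ENNReal.ofReal (c / 5 ^ d))⁻¹ *
      (ENNReal.ofReal (e k) * gagliardo σ φ)) atTop (𝓝 0) := by
    have h3 : Tendsto (fun k => ENNReal.ofReal (e k)) atTop (𝓝 0) := by
      simpa using ENNReal.tendsto_ofReal hel
    simpa using ENNReal.Tendsto.const_mul (ENNReal.Tendsto.mul_const h3 (Or.inr hφ.ne))
      (Or.inr (ENNReal.inv_ne_top.2 hc5))
  refine tendsto_of_tendsto_of_tendsto_of_le_of_le tendsto_const_nhds hlim (fun _ => zero_le)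
    fun k => ?_
  change ∫⁻ x, ‖w k x - φ x‖ₑ ^ 2 ∂σ ≤ (ENNReal.ofReal (c / 5 ^ d))⁻¹ *
    (ENNReal.ofReal (e k) * gagliardo σ φ)
  rw [← ENNReal.mul_le_iff_le_inv hc5 ENNReal.ofReal_ne_top]
  exact lintegral_kernelAvg_sub_sq_le hd hφi hσK (he0 k) fun p hp =>
    hreg p hp (e k) (he0 k) ((he1 k).trans (by linarith [abs_nonneg M]))

end TraceForm

end

/-! ### Polar coordinates and Hardy's inequality -/

noncomputable section

namespace TraceForm

/-- Integration in polar coordinates. -/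
lemma lintegral_fun_norm {E : Type*} [NormedAddCommGroup E] [NormedSpace ℝ E] [MeasurableSpace E]
    [BorelSpace E] [FiniteDimensional ℝ E] [Nontrivial E] (μ : Measure E) [μ.IsAddHaarMeasure]
    {h : ℝ → ENNReal} (hh : Measurable h) :
    ∫⁻ x, h ‖x‖ ∂μ = μ.toSphere Set.univ *
      ∫⁻ s in Set.Ioi (0 : ℝ), ENNReal.ofReal (s ^ (Module.finrank ℝ E - 1)) * h s := by
  calc ∫⁻ x, h ‖x‖ ∂μ = ∫⁻ x : ({(0)}ᶜ : Set E), h ‖x.1‖ ∂(μ.comap (↑)) := by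
        rw [lintegral_subtype_comap (measurableSet_singleton _).compl fun x : E => h ‖x‖,
          restrict_compl_singleton]
    _ = ∫⁻ x, h x.2.1 ∂μ.toSphere.prod (.volumeIoiPow (Module.finrank ℝ E - 1)) := by
        have := μ.measurePreserving_homeomorphUnitSphereProd.lintegral_comp
          (f := fun x => h x.2.1) (hh.comp (measurable_subtype_coe.comp measurable_snd))
        simpa using this
    _ = μ.toSphere Set.univ *
          ∫⁻ s : Set.Ioi (0 : ℝ), h s ∂(.volumeIoiPow (Module.finrank ℝ E - 1)) := by
        have hm : Measurable fun x : Metric.sphere (0 : E) 1 × Set.Ioi (0 : ℝ) => h x.2.1 :=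
          hh.comp (measurable_subtype_coe.comp measurable_snd)
        rw [lintegral_prod _ hm.aemeasurable, mul_comm]
        simp only [lintegral_const]
    _ = _ := by
        have hm : Measurable fun s : Set.Ioi (0 : ℝ) =>
            ENNReal.ofReal (s.1 ^ (Module.finrank ℝ E - 1)) :=
          (measurable_subtype_coe.pow_const _).ennreal_ofReal
        have hh' : Measurable fun s : Set.Ioi (0 : ℝ) => h s := hh.comp measurable_subtype_coe
        rw [Measure.volumeIoiPow, lintegral_withDensity_eq_lintegral_mul _ hm hh']
        simp only [Pi.mul_apply]
        rw [lintegral_subtype_comap measurableSet_Ioi fun s : ℝ =>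
          ENNReal.ofReal (s ^ (Module.finrank ℝ E - 1)) * h s]

/-- The weight cancels the Jacobian of polar coordinates, so C is the total mass of the sphere. -/
lemma exists_lintegral_norm_inv_pow {n : ℕ} (hn : 1 ≤ n) : ∃ C : ENNReal, C ≠ ⊤ ∧
    ∀ H : ℝ → ENNReal, Measurable H →
      ∫⁻ z : Eu n, ENNReal.ofReal ((‖z‖ ^ (n - 1))⁻¹) * H ‖z‖ = C * ∫⁻ s in Set.Ioi (0 : ℝ), H s := by
  have : Nonempty (Fin n) := ⟨⟨0, hn⟩⟩
  refine ⟨(volume : Measure (Eu n)).toSphere Set.univ, measure_ne_top _ _, fun H hH => ?_⟩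
  have hm : Measurable fun s : ℝ => ENNReal.ofReal ((s ^ (n - 1))⁻¹) * H s := by fun_prop
  rw [lintegral_fun_norm volume hm, finrank_euclideanSpace_fin]
  congr 1
  refine setLIntegral_congr_fun measurableSet_Ioi fun s hs => ?_
  have hs0 : (0 : ℝ) < s := hs
  rw [← mul_assoc, ← ENNReal.ofReal_mul (by positivity), mul_inv_cancel₀ (by positivity),
    ENNReal.ofReal_one, one_mul]

lemma lintegral_Ioc_rpow_neg_half {s : ℝ} (hs : 0 < s) :
    ∫⁻ t in Set.Ioc 0 s, ENNReal.ofReal (t ^ (-(1 / 2) : ℝ)) =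
      ENNReal.ofReal (2 * s ^ (1 / 2 : ℝ)) := by
  have hi : IntervalIntegrable (fun t : ℝ => t ^ (-(1 / 2) : ℝ)) volume 0 s :=
    intervalIntegral.intervalIntegrable_rpow' (by norm_num)
  rw [← ofReal_integral_eq_lintegral_ofReal hi.1
    ((ae_restrict_mem measurableSet_Ioc).mono fun t ht => Real.rpow_nonneg ht.1.le _),
    ← intervalIntegral.integral_of_le hs.le, integral_rpow (Or.inl (by norm_num))]
  congr 1
  rw [Real.zero_rpow (by norm_num)]
  norm_num
  ring

lemma lintegral_Ici_rpow_neg {t : ℝ} (ht : 0 < t) :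
    ∫⁻ s in Set.Ici t, ENNReal.ofReal (s ^ (-(3 / 2) : ℝ)) =
      ENNReal.ofReal (2 * t ^ (-(1 / 2) : ℝ)) := by
  have hi : IntegrableOn (fun s : ℝ => s ^ (-(3 / 2) : ℝ)) (Set.Ioi t) :=
    integrableOn_Ioi_rpow_of_lt (by norm_num) ht
  rw [setLIntegral_congr Ioi_ae_eq_Ici.symm, ← ofReal_integral_eq_lintegral_ofReal hi
    ((ae_restrict_mem measurableSet_Ioi).mono fun s hs =>
      Real.rpow_nonneg (ht.trans hs).le _), integral_Ioi_rpow_of_lt (by norm_num) ht]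
  congr 1
  norm_num
  ring

/-- Hardy's inequality. -/
lemma lintegral_hardy {f : ℝ → ENNReal} (hf : Measurable f) :
    ∫⁻ s in Set.Ioi (0 : ℝ), ENNReal.ofReal ((s ^ 2)⁻¹) * (∫⁻ t in Set.Ioc 0 s, f t) ^ 2 ≤
      4 * ∫⁻ t in Set.Ioi (0 : ℝ), f t ^ 2 := by
  have hr : ∀ r : ℝ, Measurable fun t : ℝ => ENNReal.ofReal (t ^ r) := fun r => by fun_prop
  have hcs : ∀ s ∈ Set.Ioi (0 : ℝ), ENNReal.ofReal ((s ^ 2)⁻¹) * (∫⁻ t in Set.Ioc 0 s, f t) ^ 2 ≤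
      2 * ∫⁻ t in Set.Ioi (0 : ℝ), ENNReal.ofReal (s ^ (-(3 / 2) : ℝ)) *
        ((Set.Ici t).indicator 1 s * (ENNReal.ofReal (t ^ (1 / 2 : ℝ)) * f t ^ 2)) := by
    intro s hs
    have hs0 : (0 : ℝ) < s := hs
    -- Schur test: Cauchy–Schwarz with the weights t^(∓1/4). The first factor integrates to 2
    -- s^(1/2), and after Tonelli the remaining s-integral is 2 t^(-1/2); their constants give the
    -- 4.
    have h1 : ∫⁻ t in Set.Ioc 0 s, f t = ∫⁻ t in Set.Ioc 0 s,
        ENNReal.ofReal (t ^ (-(1 / 4) : ℝ)) * (ENNReal.ofReal (t ^ (1 / 4 : ℝ)) * f t) := by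
      refine setLIntegral_congr_fun measurableSet_Ioc fun t ht => ?_
      rw [← mul_assoc, ← ENNReal.ofReal_mul (Real.rpow_nonneg ht.1.le _), ← Real.rpow_add ht.1]
      norm_num
    have h2 := sq_lintegral_mul_le (μ := volume.restrict (Set.Ioc 0 s))
      (hr (-(1 / 4))).aemeasurable ((hr (1 / 4)).mul hf).aemeasurable
    have h3 : ∫⁻ t in Set.Ioc 0 s, ENNReal.ofReal (t ^ (-(1 / 4) : ℝ)) ^ 2 =
        ENNReal.ofReal (2 * s ^ (1 / 2 : ℝ)) := by
      rw [← lintegral_Ioc_rpow_neg_half hs0]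
      refine setLIntegral_congr_fun measurableSet_Ioc fun t ht => ?_
      rw [← ENNReal.ofReal_pow (Real.rpow_nonneg ht.1.le _), ← Real.rpow_natCast,
        ← Real.rpow_mul ht.1.le]
      norm_num
    have h4 : ∫⁻ t in Set.Ioc 0 s, (ENNReal.ofReal (t ^ (1 / 4 : ℝ)) * f t) ^ 2 =
        ∫⁻ t in Set.Ioi (0 : ℝ),
          (Set.Ici t).indicator 1 s * (ENNReal.ofReal (t ^ (1 / 2 : ℝ)) * f t ^ 2) := by
      rw [← lintegral_indicator measurableSet_Ioc, ← lintegral_indicator measurableSet_Ioi]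
      refine lintegral_congr fun t => ?_
      by_cases ht : 0 < t
      · by_cases hts : t ≤ s
        · rw [Set.indicator_of_mem (show t ∈ Set.Ioc 0 s from ⟨ht, hts⟩),
            Set.indicator_of_mem (show t ∈ Set.Ioi (0 : ℝ) from ht),
            Set.indicator_of_mem (show s ∈ Set.Ici t from hts), Pi.one_apply, one_mul, mul_pow,
            ← ENNReal.ofReal_pow (Real.rpow_nonneg ht.le _), ← Real.rpow_natCast,
            ← Real.rpow_mul ht.le]
          norm_num
        · rw [Set.indicator_of_notMem (fun h => hts h.2),
            Set.indicator_of_mem (show t ∈ Set.Ioi (0 : ℝ) from ht),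
            Set.indicator_of_notMem (show s ∉ Set.Ici t from hts), zero_mul]
      · simp [ht]
    rw [h1]
    refine (mul_le_mul_right h2 _).trans ?_
    simp only [Pi.mul_apply]
    rw [h3, h4, lintegral_const_mul' _ _ ENNReal.ofReal_ne_top, ← mul_assoc, ← mul_assoc]
    refine le_of_eq ?_
    congr 1
    rw [← ENNReal.ofReal_mul (by positivity), show (2 : ENNReal) = ENNReal.ofReal 2 by simp,
      ← ENNReal.ofReal_mul (by norm_num)]
    congr 1
    rw [← Real.rpow_natCast s 2, ← Real.rpow_neg hs0.le, mul_left_comm, ← Real.rpow_add hs0]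
    norm_num
  have hmeas : Measurable fun p : ℝ × ℝ => ENNReal.ofReal (p.1 ^ (-(3 / 2) : ℝ)) *
      ((Set.Ici p.2).indicator 1 p.1 * (ENNReal.ofReal (p.2 ^ (1 / 2 : ℝ)) * f p.2 ^ 2)) := by
    have hind : Measurable fun p : ℝ × ℝ => (Set.Ici p.2).indicator (1 : ℝ → ENNReal) p.1 := by
      have : (fun p : ℝ × ℝ => (Set.Ici p.2).indicator (1 : ℝ → ENNReal) p.1) =
          {p : ℝ × ℝ | p.2 ≤ p.1}.indicator 1 := by
        ext p
        simp [Set.indicator]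
      rw [this]
      exact measurable_one.indicator (measurableSet_le measurable_snd measurable_fst)
    exact ((hr _).comp measurable_fst).mul (hind.mul
      (((hr _).comp measurable_snd).mul ((hf.comp measurable_snd).pow_const 2)))
  calc _ ≤ ∫⁻ s in Set.Ioi (0 : ℝ), 2 * ∫⁻ t in Set.Ioi (0 : ℝ),
        ENNReal.ofReal (s ^ (-(3 / 2) : ℝ)) *
        ((Set.Ici t).indicator 1 s * (ENNReal.ofReal (t ^ (1 / 2 : ℝ)) * f t ^ 2)) :=
        setLIntegral_mono' measurableSet_Ioi hcs
    _ = 2 * ∫⁻ t in Set.Ioi (0 : ℝ), ∫⁻ s in Set.Ioi (0 : ℝ),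
        ENNReal.ofReal (s ^ (-(3 / 2) : ℝ)) *
        ((Set.Ici t).indicator 1 s * (ENNReal.ofReal (t ^ (1 / 2 : ℝ)) * f t ^ 2)) := by
        rw [lintegral_const_mul' _ _ (by norm_num), lintegral_lintegral_swap hmeas.aemeasurable]
    _ = 2 * ∫⁻ t in Set.Ioi (0 : ℝ), 2 * f t ^ 2 := by
        congr 1
        refine setLIntegral_congr_fun measurableSet_Ioi fun t ht => ?_
        have ht0 : (0 : ℝ) < t := ht
        have hsub : Set.Ici t ⊆ Set.Ioi (0 : ℝ) := fun s hs => ht0.trans_le hs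
        calc ∫⁻ s in Set.Ioi (0 : ℝ), ENNReal.ofReal (s ^ (-(3 / 2) : ℝ)) *
              ((Set.Ici t).indicator 1 s * (ENNReal.ofReal (t ^ (1 / 2 : ℝ)) * f t ^ 2))
            = ∫⁻ s in Set.Ioi (0 : ℝ), (Set.Ici t).indicator
                (fun s => ENNReal.ofReal (s ^ (-(3 / 2) : ℝ)) *
                  (ENNReal.ofReal (t ^ (1 / 2 : ℝ)) * f t ^ 2)) s := by
              refine lintegral_congr fun s => ?_
              by_cases hs : s ∈ Set.Ici t <;> simp [hs]
          _ = (∫⁻ s in Set.Ici t, ENNReal.ofReal (s ^ (-(3 / 2) : ℝ))) *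
                (ENNReal.ofReal (t ^ (1 / 2 : ℝ)) * f t ^ 2) := by
              rw [setLIntegral_indicator measurableSet_Ici, Set.inter_eq_left.2 hsub,
                lintegral_mul_const _ (hr _)]
          _ = 2 * f t ^ 2 := by
              rw [lintegral_Ici_rpow_neg ht0, ← mul_assoc, ← ENNReal.ofReal_mul (by positivity),
                mul_assoc, ← Real.rpow_add ht0]
              norm_num
    _ = 4 * ∫⁻ t in Set.Ioi (0 : ℝ), f t ^ 2 := by
        rw [lintegral_const_mul' _ _ (by norm_num), ← mul_assoc]
        norm_num

end TraceForm

end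

/-! ### The Gagliardo estimate over a flat base -/

noncomputable section

namespace TraceForm

lemma ofReal_inv_pow_succ {n : ℕ} (hn : 1 ≤ n) {s : ℝ} (hs : 0 ≤ s) :
    ENNReal.ofReal ((s ^ (n + 1))⁻¹) =
      ENNReal.ofReal ((s ^ (n - 1))⁻¹) * ENNReal.ofReal ((s ^ 2)⁻¹) := by
  rw [← ENNReal.ofReal_mul (by positivity), ← mul_inv, ← pow_add,
    show n - 1 + 2 = n + 1 by omega]

lemma ofReal_inv_pow_mul_sq_le {n : ℕ} (hn : 1 ≤ n) {s : ℝ} (hs : 0 ≤ s) :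
    ENNReal.ofReal ((s ^ (n + 1))⁻¹) * ENNReal.ofReal s ^ 2 ≤ ENNReal.ofReal ((s ^ (n - 1))⁻¹) := by
  rw [ofReal_inv_pow_succ hn hs, ← ENNReal.ofReal_pow hs, mul_assoc,
    ← ENNReal.ofReal_mul (by positivity)]
  refine mul_le_of_le_one_right' ?_
  rw [ENNReal.ofReal_le_one]
  exact inv_mul_le_one

/-- The contribution of the vertical segments to the Gagliardo seminorm of a trace. -/
lemma exists_lintegral_vertical_le {n : ℕ} (hn : 1 ≤ n) : ∃ C : ENNReal, C ≠ ⊤ ∧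
    ∀ F : Eu n × ℝ → ENNReal, Measurable F →
      ∫⁻ a, ∫⁻ b, ENNReal.ofReal ((‖a - b‖ ^ (n + 1))⁻¹) *
        (∫⁻ t in Set.Ioc 0 ‖a - b‖, F (a, t)) ^ 2 ≤
        C * ∫⁻ a, ∫⁻ t in Set.Ioi (0 : ℝ), F (a, t) ^ 2 := by
  obtain ⟨C, hC, h⟩ := exists_lintegral_norm_inv_pow hn
  refine ⟨C * 4, ENNReal.mul_ne_top hC (by norm_num), fun F hF => ?_⟩
  rw [← lintegral_const_mul' _ _ (ENNReal.mul_ne_top hC (by norm_num))]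
  refine lintegral_mono fun a => ?_
  have hmono : Monotone fun s : ℝ => ∫⁻ t in Set.Ioc 0 s, F (a, t) := fun s s' hs =>
    lintegral_mono_set (Set.Ioc_subset_Ioc_right hs)
  have hH : Measurable fun s : ℝ =>
      ENNReal.ofReal ((s ^ 2)⁻¹) * (∫⁻ t in Set.Ioc 0 s, F (a, t)) ^ 2 :=
    (by fun_prop : Measurable fun s : ℝ => ENNReal.ofReal ((s ^ 2)⁻¹)).mul
      (hmono.measurable.pow_const 2)
  calc ∫⁻ b, ENNReal.ofReal ((‖a - b‖ ^ (n + 1))⁻¹) * (∫⁻ t in Set.Ioc 0 ‖a - b‖, F (a, t)) ^ 2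
      = ∫⁻ z : Eu n, ENNReal.ofReal ((‖z‖ ^ (n + 1))⁻¹) *
          (∫⁻ t in Set.Ioc 0 ‖z‖, F (a, t)) ^ 2 :=
        lintegral_sub_left_eq_self (fun z : Eu n => ENNReal.ofReal ((‖z‖ ^ (n + 1))⁻¹) *
          (∫⁻ t in Set.Ioc 0 ‖z‖, F (a, t)) ^ 2) a
    -- Split the weight as ‖z‖^(-(n-1)) ‖z‖^(-2): the first factor cancels the polar Jacobian, the
    -- second is the Hardy weight.
    _ = C * ∫⁻ s in Set.Ioi (0 : ℝ),
          ENNReal.ofReal ((s ^ 2)⁻¹) * (∫⁻ t in Set.Ioc 0 s, F (a, t)) ^ 2 := by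
        rw [← h _ hH]
        simp_rw [ofReal_inv_pow_succ hn (norm_nonneg _), mul_assoc]
    _ ≤ C * (4 * ∫⁻ t in Set.Ioi (0 : ℝ), F (a, t) ^ 2) :=
        mul_le_mul_right (lintegral_hardy (hF.comp measurable_prodMk_left)) _
    _ = C * 4 * ∫⁻ t in Set.Ioi (0 : ℝ), F (a, t) ^ 2 := by rw [mul_assoc]

/-- The contribution of the horizontal segments to the Gagliardo seminorm of a trace. -/
lemma exists_lintegral_horizontal_eq {n : ℕ} (hn : 1 ≤ n) : ∃ C : ENNReal, C ≠ ⊤ ∧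
    ∀ F : Eu n × ℝ → ENNReal, Measurable F →
      ∫⁻ a, ∫⁻ b, ENNReal.ofReal ((‖a - b‖ ^ (n - 1))⁻¹) *
        ∫⁻ θ in Set.Ioc (0 : ℝ) 1, F (a + θ • (b - a), ‖a - b‖) ^ 2 =
        C * ∫⁻ a, ∫⁻ t in Set.Ioi (0 : ℝ), F (a, t) ^ 2 := by
  obtain ⟨C, hC, h⟩ := exists_lintegral_norm_inv_pow hn
  refine ⟨C, hC, fun F hF => ?_⟩
  have hF2 : Measurable fun p => F p ^ 2 := hF.pow_const 2
  have hk : Measurable fun s : ℝ => ENNReal.ofReal ((s ^ (n - 1))⁻¹) := by fun_prop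
  have hm3 : Measurable fun p : (Eu n × Eu n) × ℝ => F (p.1.1 + p.2 • p.1.2, ‖p.1.2‖) ^ 2 :=
    hF2.comp (by fun_prop)
  have hm2 : Measurable fun p : Eu n × Eu n =>
      ENNReal.ofReal ((‖p.2‖ ^ (n - 1))⁻¹) *
        ∫⁻ θ in Set.Ioc (0 : ℝ) 1, F (p.1 + θ • p.2, ‖p.2‖) ^ 2 :=
    (hk.comp (by fun_prop)).mul hm3.lintegral_prod_right'
  calc ∫⁻ a, ∫⁻ b, ENNReal.ofReal ((‖a - b‖ ^ (n - 1))⁻¹) *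
        ∫⁻ θ in Set.Ioc (0 : ℝ) 1, F (a + θ • (b - a), ‖a - b‖) ^ 2
      = ∫⁻ a, ∫⁻ z : Eu n, ENNReal.ofReal ((‖z‖ ^ (n - 1))⁻¹) *
          ∫⁻ θ in Set.Ioc (0 : ℝ) 1, F (a + θ • z, ‖z‖) ^ 2 := by
        refine lintegral_congr fun a => ?_
        rw [← lintegral_sub_right_eq_self (fun z : Eu n => ENNReal.ofReal ((‖z‖ ^ (n - 1))⁻¹) *
          ∫⁻ θ in Set.Ioc (0 : ℝ) 1, F (a + θ • z, ‖z‖) ^ 2) a]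
        simp_rw [norm_sub_rev a]
    _ = ∫⁻ z : Eu n, ∫⁻ a, ENNReal.ofReal ((‖z‖ ^ (n - 1))⁻¹) *
          ∫⁻ θ in Set.Ioc (0 : ℝ) 1, F (a + θ • z, ‖z‖) ^ 2 :=
        lintegral_lintegral_swap hm2.aemeasurable
    -- For fixed z, translation invariance in a removes θ. The height ‖z‖ then becomes the radial
    -- variable, which is why the horizontal piece is taken at height ‖a - b‖.
    _ = ∫⁻ z : Eu n, ENNReal.ofReal ((‖z‖ ^ (n - 1))⁻¹) * ∫⁻ a, F (a, ‖z‖) ^ 2 := by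
        refine lintegral_congr fun z => ?_
        rw [lintegral_const_mul' _ _ ENNReal.ofReal_ne_top]
        congr 1
        have hm : Measurable fun p : Eu n × ℝ => F (p.1 + p.2 • z, ‖z‖) ^ 2 :=
          hF2.comp (by fun_prop)
        rw [lintegral_lintegral_swap hm.aemeasurable]
        have hθ : ∀ θ : ℝ, ∫⁻ a, F (a + θ • z, ‖z‖) ^ 2 = ∫⁻ a, F (a, ‖z‖) ^ 2 := fun θ =>
          lintegral_add_right_eq_self (fun a : Eu n => F (a, ‖z‖) ^ 2) (θ • z)
        rw [lintegral_congr hθ]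
        simp
    _ = C * ∫⁻ s in Set.Ioi (0 : ℝ), ∫⁻ a, F (a, s) ^ 2 :=
        h _ (hF2.lintegral_prod_left')
    _ = C * ∫⁻ a, ∫⁻ t in Set.Ioi (0 : ℝ), F (a, t) ^ 2 := by
        rw [lintegral_lintegral_swap]
        exact (hF2.comp measurable_swap).aemeasurable

lemma measurable_lintegral_Ioc_norm_sub {n : ℕ} {F : Eu n × ℝ → ENNReal} (hF : Measurable F) :
    Measurable fun p : Eu n × Eu n => ∫⁻ t in Set.Ioc 0 ‖p.1 - p.2‖, F (p.1, t) := by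
  have hS : MeasurableSet {q : (Eu n × Eu n) × ℝ | 0 < q.2 ∧ q.2 ≤ ‖q.1.1 - q.1.2‖} :=
    (measurableSet_lt measurable_const measurable_snd).inter
      (measurableSet_le measurable_snd (by fun_prop))
  have hm : Measurable fun q : (Eu n × Eu n) × ℝ => F (q.1.1, q.2) := hF.comp (by fun_prop)
  have h := (hm.indicator hS).lintegral_prod_right' (ν := volume)
  refine (congrArg Measurable (funext fun p => ?_)).mp h
  rw [← lintegral_indicator measurableSet_Ioc]
  rfl

lemma add_add_sq_le_four_mul (a b c : ENNReal) :
    (a + b + c) ^ 2 ≤ 4 * (a ^ 2 + b ^ 2 + c ^ 2) := by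
  calc (a + b + c) ^ 2 ≤ 2 * ((a + b) ^ 2 + c ^ 2) := add_sq_le_two_mul _ _
    _ ≤ 2 * (2 * (a ^ 2 + b ^ 2) + 2 * c ^ 2) := by
        gcongr
        · exact add_sq_le_two_mul _ _
        · exact le_mul_of_one_le_left' (by norm_num)
    _ = 4 * (a ^ 2 + b ^ 2 + c ^ 2) := by ring

/-- A function whose increments are controlled by integrals of `F` over a vertical segment above
each of the two points and a horizontal segment joining their tops has Gagliardo seminorm bounded by
the `L²` norm of `F`. -/
lemma exists_lintegral_gagliardo_le {n : ℕ} (hn : 1 ≤ n) {K : ENNReal} (hK : K ≠ ⊤) :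
    ∃ C : ENNReal, C ≠ ⊤ ∧ ∀ (B : Set (Eu n)) (W : Eu n → ℝ) (F : Eu n × ℝ → ENNReal),
      MeasurableSet B → Measurable F →
      (∀ a ∈ B, ∀ b ∈ B, ‖W a - W b‖ₑ ≤ (∫⁻ t in Set.Ioc 0 ‖a - b‖, F (a, t)) +
        (∫⁻ t in Set.Ioc 0 ‖a - b‖, F (b, t)) + K * ENNReal.ofReal ‖a - b‖ *
          ∫⁻ θ in Set.Ioc (0 : ℝ) 1, F (a + θ • (b - a), ‖a - b‖)) →
      ∫⁻ a in B, ∫⁻ b in B, ENNReal.ofReal ((‖a - b‖ ^ (n + 1))⁻¹) * ‖W a - W b‖ₑ ^ 2 ≤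
        C * ∫⁻ a, ∫⁻ t in Set.Ioi (0 : ℝ), F (a, t) ^ 2 := by
  obtain ⟨C₁, hC₁, h₁⟩ := exists_lintegral_vertical_le hn
  obtain ⟨C₂, hC₂, h₂⟩ := exists_lintegral_horizontal_eq hn
  refine ⟨4 * (C₁ + C₁ + K ^ 2 * C₂), by finiteness, fun B W F hB hF hW => ?_⟩
  obtain ⟨k, hk⟩ : ∃ k : Eu n → Eu n → ENNReal, ∀ a b,
      ENNReal.ofReal ((‖a - b‖ ^ (n + 1))⁻¹) = k a b := ⟨_, fun _ _ => rfl⟩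
  obtain ⟨V, hV⟩ : ∃ V : Eu n → Eu n → ENNReal, ∀ a b,
      ∫⁻ t in Set.Ioc 0 ‖a - b‖, F (a, t) = V a b := ⟨_, fun _ _ => rfl⟩
  obtain ⟨H, hH⟩ : ∃ H : Eu n → Eu n → ENNReal, ∀ a b,
      ENNReal.ofReal ((‖a - b‖ ^ (n - 1))⁻¹) *
        ∫⁻ θ in Set.Ioc (0 : ℝ) 1, F (a + θ • (b - a), ‖a - b‖) ^ 2 = H a b :=
    ⟨_, fun _ _ => rfl⟩
  have hkm : Measurable fun p : Eu n × Eu n => k p.1 p.2 := by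
    simp_rw [← hk]
    fun_prop
  have hVm : Measurable fun p : Eu n × Eu n => V p.1 p.2 := by
    simp_rw [← hV]
    exact measurable_lintegral_Ioc_norm_sub hF
  have h₁F := h₁ F hF
  have h₂F := h₂ F hF
  simp_rw [hk, hV] at h₁F
  simp_rw [hH] at h₂F
  have hpt : ∀ a ∈ B, ∀ b ∈ B, k a b * ‖W a - W b‖ₑ ^ 2 ≤
      4 * (k a b * V a b ^ 2 + k b a * V b a ^ 2 + K ^ 2 * H a b) := by
    intro a ha b hb
    have hsq : (∫⁻ θ in Set.Ioc (0 : ℝ) 1, F (a + θ • (b - a), ‖a - b‖)) ^ 2 ≤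
        ∫⁻ θ in Set.Ioc (0 : ℝ) 1, F (a + θ • (b - a), ‖a - b‖) ^ 2 := by
      have hm : Measurable fun θ : ℝ => F (a + θ • (b - a), ‖a - b‖) := hF.comp (by fun_prop)
      refine (sq_lintegral_le hm.aemeasurable).trans ?_
      simp
    have hba : V b a = ∫⁻ t in Set.Ioc 0 ‖a - b‖, F (b, t) := by rw [← hV, norm_sub_rev]
    have hkba : k b a = k a b := by rw [← hk, ← hk, norm_sub_rev]
    calc k a b * ‖W a - W b‖ₑ ^ 2
        ≤ k a b * (4 * (V a b ^ 2 + V b a ^ 2 + (K * ENNReal.ofReal ‖a - b‖ *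
            ∫⁻ θ in Set.Ioc (0 : ℝ) 1, F (a + θ • (b - a), ‖a - b‖)) ^ 2)) := by
          gcongr
          refine le_trans ?_ (add_add_sq_le_four_mul _ _ _)
          gcongr
          rw [hba, ← hV]
          exact hW a ha b hb
      _ = 4 * (k a b * V a b ^ 2 + k a b * V b a ^ 2 +
            K ^ 2 * (k a b * ENNReal.ofReal ‖a - b‖ ^ 2 *
            (∫⁻ θ in Set.Ioc (0 : ℝ) 1, F (a + θ • (b - a), ‖a - b‖)) ^ 2)) := by ring
      _ ≤ 4 * (k a b * V a b ^ 2 + k b a * V b a ^ 2 + K ^ 2 * H a b) := by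
          rw [hkba, ← hH]
          gcongr
          rw [← hk]
          -- The squared length of the horizontal piece lowers the singularity from order n + 1 to n
          -- - 1.
          exact ofReal_inv_pow_mul_sq_le hn (norm_nonneg _)
  have hkV : Measurable fun p : Eu n × Eu n => k p.1 p.2 * V p.1 p.2 ^ 2 :=
    hkm.mul (hVm.pow_const 2)
  have hkV' : Measurable fun p : Eu n × Eu n => k p.2 p.1 * V p.2 p.1 ^ 2 :=
    hkV.comp measurable_swap
  simp_rw [hk]
  calc ∫⁻ a in B, ∫⁻ b in B, k a b * ‖W a - W b‖ₑ ^ 2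
      ≤ ∫⁻ a in B, ∫⁻ b in B, 4 * (k a b * V a b ^ 2 + k b a * V b a ^ 2 + K ^ 2 * H a b) :=
        setLIntegral_mono' hB fun a ha => setLIntegral_mono' hB fun b hb => hpt a ha b hb
    _ ≤ ∫⁻ a, ∫⁻ b, 4 * (k a b * V a b ^ 2 + k b a * V b a ^ 2 + K ^ 2 * H a b) :=
        (setLIntegral_le_lintegral _ _).trans
          (lintegral_mono fun a => setLIntegral_le_lintegral _ _)
    _ = 4 * ((∫⁻ a, ∫⁻ b, k a b * V a b ^ 2) + (∫⁻ a, ∫⁻ b, k b a * V b a ^ 2) +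
          K ^ 2 * ∫⁻ a, ∫⁻ b, H a b) := by
        simp_rw [lintegral_const_mul' _ _ (by norm_num : (4 : ENNReal) ≠ ⊤)]
        congr 1
        have i1 : Measurable fun a => ∫⁻ b, k a b * V a b ^ 2 := hkV.lintegral_prod_right'
        have i2 : Measurable fun a => ∫⁻ b, k b a * V b a ^ 2 := hkV'.lintegral_prod_right'
        have i12 : Measurable fun a =>
          (∫⁻ b, k a b * V a b ^ 2) + ∫⁻ b, k b a * V b a ^ 2 := i1.add i2
        rw [← lintegral_const_mul' _ _ (by finiteness : K ^ 2 ≠ ⊤), ← lintegral_add_left i1,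
          ← lintegral_add_left i12]
        refine lintegral_congr fun a => ?_
        have e1 : Measurable fun b => k a b * V a b ^ 2 := hkV.comp measurable_prodMk_left
        have e2 : Measurable fun b => k b a * V b a ^ 2 := hkV.comp measurable_prodMk_right
        have e12 : Measurable fun b => k a b * V a b ^ 2 + k b a * V b a ^ 2 := e1.add e2
        rw [lintegral_add_left e12, lintegral_add_left e1,
          lintegral_const_mul' _ _ (by finiteness)]
    _ ≤ 4 * (C₁ * (∫⁻ a, ∫⁻ t in Set.Ioi (0 : ℝ), F (a, t) ^ 2) +
          C₁ * (∫⁻ a, ∫⁻ t in Set.Ioi (0 : ℝ), F (a, t) ^ 2) +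
          K ^ 2 * (C₂ * ∫⁻ a, ∫⁻ t in Set.Ioi (0 : ℝ), F (a, t) ^ 2)) := by
        gcongr
        · rw [lintegral_lintegral_swap hkV'.aemeasurable]
          exact h₁F
        · exact h₂F.le
    _ = _ := by ring

end TraceForm

end

/-! ### Graph coordinates and paths through the collar -/

noncomputable section

namespace TraceForm

variable {d : ℕ} {D : Set (Eu d)} {x : Eu d} {R : ℝ}
  {T : Eu d ≃ᵃⁱ[ℝ] WithLp 2 (Eu (d - 1) × ℝ)} {g : Eu (d - 1) → ℝ} {L : NNReal}

lemma affineIsometryEquiv_symm_eq :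
    ⇑T.symm = (fun y => y + T.symm 0) ∘ T.symm.linearIsometryEquiv := by
  ext1 z
  have := T.symm.map_vadd 0 z
  simpa using this

lemma measurePreserving_affineIsometryEquiv_symm :
    MeasurePreserving T.symm (volume : Measure (WithLp 2 (Eu (d - 1) × ℝ))) volume := by
  rw [affineIsometryEquiv_symm_eq]
  exact (measurePreserving_add_right volume (T.symm 0)).comp
    T.symm.linearIsometryEquiv.measurePreserving

/-- A vertical shear has unit Jacobian and a rigid motion preserves volume, so graph coordinates
introduce no density. -/
lemma measurePreserving_graphPoint (hg : Continuous g) :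
    MeasurePreserving (fun p : Eu (d - 1) × ℝ => graphPoint T g p.1 p.2) volume volume := by
  have hs : MeasurePreserving (fun p : Eu (d - 1) × ℝ => (p.1, g p.1 + p.2)) volume volume :=
    (MeasurePreserving.id volume).skew_product
      (g := fun a t => g a + t) (by
        have := hg.measurable
        unfold Function.uncurry
        fun_prop)
      (Eventually.of_forall fun a => (measurePreserving_add_left volume (g a)).map_eq)
  exact measurePreserving_affineIsometryEquiv_symm.comp
    ((WithLp.volume_preserving_toLp (Eu (d - 1)) ℝ).comp hs)

lemma contDiff_graphPoint (hg : ContDiff ℝ ∞ g) :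
    ContDiff ℝ ∞ fun p : Eu (d - 1) × ℝ => graphPoint T g p.1 p.2 := by
  have h1 : ContDiff ℝ ∞ fun p : Eu (d - 1) × ℝ => WithLp.toLp 2 (p.1, g p.1 + p.2) :=
    (WithLp.prodContinuousLinearEquiv 2 ℝ (Eu (d - 1)) ℝ).symm.contDiff.comp
      (contDiff_fst.prodMk ((hg.comp contDiff_fst).add contDiff_snd))
  have h2 : ContDiff ℝ ∞ T.symm := by
    rw [affineIsometryEquiv_symm_eq]
    exact (contDiff_id.add contDiff_const).comp T.symm.linearIsometryEquiv.contDiff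
  exact h2.comp h1

lemma graphPoint_eq_add_smul_up (a : Eu (d - 1)) (t : ℝ) :
    graphPoint T g a t = graphPoint T g a 0 + t • up T := by
  apply T.injective
  rw [map_add_smul_up]
  simp [graphPoint, ← WithLp.toLp_add]

/-- The norm of the derivative of `w` in graph coordinates, cut off to a collar. -/
def collarDeriv (B : Set (Eu (d - 1))) (R : ℝ) (T : Eu d ≃ᵃⁱ[ℝ] WithLp 2 (Eu (d - 1) × ℝ))
    (g : Eu (d - 1) → ℝ) (w : Eu d → ℝ) : Eu (d - 1) × ℝ → ENNReal :=
  (B ×ˢ Set.Ioo 0 (2 * R)).indicator fun p => ‖fderiv ℝ w (graphPoint T g p.1 p.2)‖ₑ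

lemma measurable_collarDeriv {B : Set (Eu (d - 1))} (hB : MeasurableSet B) (hg : Continuous g)
    {w : Eu d → ℝ} (hw : ContDiff ℝ ∞ w) : Measurable (collarDeriv B R T g w) :=
  (((hw.continuous_fderiv (by simp)).comp (continuous_graphPoint hg)).enorm.measurable).indicator
    (hB.prod measurableSet_Ioo)

lemma enorm_sub_vertical_le {B : Set (Eu (d - 1))} {w : Eu d → ℝ} (hw : ContDiff ℝ ∞ w)
    {a : Eu (d - 1)} (ha : a ∈ B) {s : ℝ} (hs : 0 ≤ s) (hsR : s < 2 * R) :
    ‖w (graphPoint T g a s) - w (graphPoint T g a 0)‖ₑ ≤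
      ∫⁻ t in Set.Ioc 0 s, collarDeriv B R T g w (a, t) := by
  have hγ : ContDiff ℝ ∞ fun t : ℝ => graphPoint T g a 0 + t • up T := by fun_prop
  have hf : (fun t => w (graphPoint T g a t)) = fun t => w (graphPoint T g a 0 + t • up T) := by
    ext t
    rw [graphPoint_eq_add_smul_up a t]
  have hc : ContDiff ℝ ∞ fun t => w (graphPoint T g a t) := hf ▸ hw.comp hγ
  have h := enorm_sub_le_lintegral_deriv_of_contDiffOn_Icc
    ((hc.of_le (by simp)).contDiffOn (s := Set.Icc 0 s)) hs
  refine h.trans ?_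
  rw [← restrict_Ioc_eq_restrict_Icc]
  refine setLIntegral_mono' measurableSet_Ioc fun t ht => ?_
  rw [collarDeriv, Set.indicator_of_mem (show (a, t) ∈ B ×ˢ Set.Ioo 0 (2 * R) from
    ⟨ha, ht.1, ht.2.trans_lt hsR⟩)]
  have hd : HasDerivAt (fun t => w (graphPoint T g a t))
      (fderiv ℝ w (graphPoint T g a t) (up T)) t := by
    rw [hf, graphPoint_eq_add_smul_up a t]
    have h1 : HasDerivAt (fun t : ℝ => graphPoint T g a 0 + t • up T) (up T) t := by
      simpa using ((hasDerivAt_id t).smul_const (up T)).const_add (graphPoint T g a 0)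
    exact ((hw.differentiable (by simp)) _).hasFDerivAt.comp_hasDerivAt t h1
  rw [hd.deriv]
  refine enorm_le_iff_norm_le.2 ?_
  refine (ContinuousLinearMap.le_opNorm _ _).trans ?_
  rw [norm_up, mul_one]

/-- Integrate the derivative along the lift of the base segment to constant height above the graph.
The lift has speed at most (1 + L) ‖a - b‖, and convexity of B keeps the segment in the collar. -/
lemma enorm_sub_horizontal_le {B : Set (Eu (d - 1))} (hBo : IsOpen B) (hBc : Convex ℝ B)
    (hg : ContDiff ℝ ∞ g) (hL : LipschitzOnWith L g B) {w : Eu d → ℝ} (hw : ContDiff ℝ ∞ w)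
    {a b : Eu (d - 1)} (ha : a ∈ B) (hb : b ∈ B) {s : ℝ} (hs : 0 < s) (hsR : s < 2 * R) :
    ‖w (graphPoint T g b s) - w (graphPoint T g a s)‖ₑ ≤
      ((1 + L : NNReal) : ENNReal) * ENNReal.ofReal ‖a - b‖ *
        ∫⁻ θ in Set.Ioc (0 : ℝ) 1, collarDeriv B R T g w (a + θ • (b - a), s) := by
  set γ : ℝ → Eu d := fun θ => graphPoint T g (a + θ • (b - a)) s with hγdef
  have hl : ContDiff ℝ ∞ fun θ : ℝ => (a + θ • (b - a), s) := by fun_prop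
  have hγ : ContDiff ℝ ∞ γ := (contDiff_graphPoint hg).comp hl
  have hc : ContDiff ℝ ∞ fun θ => w (γ θ) := hw.comp hγ
  have h := enorm_sub_le_lintegral_deriv_of_contDiffOn_Icc
    ((hc.of_le (by simp)).contDiffOn (s := Set.Icc 0 1)) zero_le_one
  have e1 : γ 1 = graphPoint T g b s := by simp [hγdef]
  have e0 : γ 0 = graphPoint T g a s := by simp [hγdef]
  rw [e1, e0] at h
  refine h.trans ?_
  rw [← restrict_Ioc_eq_restrict_Icc, ← lintegral_const_mul' _ _ (by finiteness)]
  refine setLIntegral_mono' measurableSet_Ioc fun θ hθ => ?_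
  have hmem : a + θ • (b - a) ∈ B := hBc.add_smul_sub_mem ha hb ⟨hθ.1.le, hθ.2⟩
  rw [collarDeriv, Set.indicator_of_mem (show (a + θ • (b - a), s) ∈ B ×ˢ Set.Ioo 0 (2 * R) from
    ⟨hmem, hs, hsR⟩)]
  have hlip : LipschitzOnWith ((1 + L) * ‖b - a‖₊) γ {θ | a + θ • (b - a) ∈ B} := by
    refine LipschitzOnWith.of_dist_le_mul fun θ hθ θ' hθ' => ?_
    refine ((lipschitzOnWith_graphPoint hL s).dist_le_mul _ hθ _ hθ').trans ?_
    rw [dist_add_left, dist_eq_norm, ← sub_smul, norm_smul, NNReal.coe_mul, coe_nnnorm,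
      dist_eq_norm, mul_assoc, mul_comm ‖b - a‖]
  have hnhds : {θ : ℝ | a + θ • (b - a) ∈ B} ∈ 𝓝 θ :=
    (hBo.preimage (by fun_prop : Continuous fun θ : ℝ => a + θ • (b - a))).mem_nhds hmem
  have hdγ := norm_deriv_le_of_lipschitzOn hnhds hlip
  have hd : HasDerivAt (fun θ => w (γ θ)) (fderiv ℝ w (γ θ) (deriv γ θ)) θ :=
    ((hw.differentiable (by simp)) _).hasFDerivAt.comp_hasDerivAt θ
      ((hγ.differentiable (by simp)) θ).hasDerivAt
  rw [hd.deriv]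
  calc ‖fderiv ℝ w (γ θ) (deriv γ θ)‖ₑ ≤ ‖fderiv ℝ w (γ θ)‖ₑ * ‖deriv γ θ‖ₑ :=
        ContinuousLinearMap.le_opENorm _ _
    _ ≤ ‖fderiv ℝ w (γ θ)‖ₑ * (((1 + L : NNReal) : ENNReal) * ENNReal.ofReal ‖a - b‖) := by
        gcongr
        rw [ofReal_norm, enorm_eq_nnnorm, enorm_eq_nnnorm, ← ENNReal.coe_mul,
          ENNReal.coe_le_coe, ← nnnorm_neg (a - b), neg_sub]
        exact hdγ
    _ = _ := mul_comm _ _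

namespace IsGraphBox

/-- The boundary points are joined by going up to height ‖a - b‖, across, and down again. -/
lemma enorm_sub_le (h : IsGraphBox D x R T g L) {w : Eu d → ℝ} (hw : ContDiff ℝ ∞ w)
    {a b : Eu (d - 1)} (ha : a ∈ Metric.ball (T x).fst R) (hb : b ∈ Metric.ball (T x).fst R) :
    ‖w (graphPoint T g a 0) - w (graphPoint T g b 0)‖ₑ ≤
      (∫⁻ t in Set.Ioc 0 ‖a - b‖, collarDeriv (Metric.ball (T x).fst R) R T g w (a, t)) +
      (∫⁻ t in Set.Ioc 0 ‖a - b‖, collarDeriv (Metric.ball (T x).fst R) R T g w (b, t)) +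
      ((1 + L : NNReal) : ENNReal) * ENNReal.ofReal ‖a - b‖ *
        ∫⁻ θ in Set.Ioc (0 : ℝ) 1,
          collarDeriv (Metric.ball (T x).fst R) R T g w (a + θ • (b - a), ‖a - b‖) := by
  rcases eq_or_ne a b with rfl | hab
  · simp
  have hs : 0 < ‖a - b‖ := norm_pos_iff.2 (sub_ne_zero.2 hab)
  -- Two points of the base ball are less than 2R apart, which is the height available in the
  -- collar.
  have hsR : ‖a - b‖ < 2 * R := by
    rw [← dist_eq_norm, two_mul]
    exact (dist_triangle_right a b (T x).fst).trans_lt (add_lt_add ha hb)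
  have h1 := enorm_sub_vertical_le (T := T) (g := g) hw ha hs.le hsR
  have h2 := enorm_sub_vertical_le (T := T) (g := g) hw hb hs.le hsR
  have h3 := enorm_sub_horizontal_le (T := T) Metric.isOpen_ball (convex_ball _ _) h.contDiff
    h.lipschitz hw ha hb hs hsR
  refine le_trans ?_ (add_le_add (add_le_add h1 h2) h3)
  rw [← enorm_neg (w (graphPoint T g a ‖a - b‖) - w (graphPoint T g a 0)), neg_sub,
    ← enorm_neg (w (graphPoint T g b ‖a - b‖) - w (graphPoint T g a ‖a - b‖)), neg_sub]
  refine le_trans ?_ (add_le_add_left (enorm_add_le _ _) _)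
  refine le_trans ?_ (enorm_add_le _ _)
  refine le_of_eq ?_
  congr 1
  ring

/-- Graph coordinates are globally volume preserving and map the collar into D. -/
lemma lintegral_collarDeriv_le (h : IsGraphBox D x R T g L) (hD : IsOpen D) {w : Eu d → ℝ}
    (hw : ContDiff ℝ ∞ w) :
    ∫⁻ a, ∫⁻ t in Set.Ioi (0 : ℝ), collarDeriv (Metric.ball (T x).fst R) R T g w (a, t) ^ 2 ≤
      ∫⁻ y in D, ‖fderiv ℝ w y‖ₑ ^ 2 := by
  have hF := measurable_collarDeriv (R := R) (T := T)
    (Metric.isOpen_ball (x := (T x).fst) (ε := R)).measurableSet h.contDiff.continuous hw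
  have hm : Measurable (D.indicator fun y => ‖fderiv ℝ w y‖ₑ ^ 2) :=
    ((hw.continuous_fderiv (by simp)).enorm.measurable.pow_const 2).indicator hD.measurableSet
  calc _ ≤ ∫⁻ a, ∫⁻ t, collarDeriv (Metric.ball (T x).fst R) R T g w (a, t) ^ 2 :=
        lintegral_mono fun a => setLIntegral_le_lintegral _ _
    _ = ∫⁻ p, collarDeriv (Metric.ball (T x).fst R) R T g w p ^ 2 := by
        rw [Measure.volume_eq_prod, lintegral_prod _ (hF.pow_const 2).aemeasurable]
    _ ≤ ∫⁻ p : Eu (d - 1) × ℝ,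
          D.indicator (fun y => ‖fderiv ℝ w y‖ₑ ^ 2) (graphPoint T g p.1 p.2) := by
        refine lintegral_mono fun p => ?_
        by_cases hp : p ∈ Metric.ball (T x).fst R ×ˢ Set.Ioo 0 (2 * R)
        · rw [collarDeriv, Set.indicator_of_mem hp,
            Set.indicator_of_mem (h.mem_domain _ hp.1 _ hp.2)]
        · rw [collarDeriv, Set.indicator_of_notMem hp]
          simp
    _ = ∫⁻ y in D, ‖fderiv ℝ w y‖ₑ ^ 2 := by
        rw [(measurePreserving_graphPoint h.contDiff.continuous).lintegral_comp hm,
          lintegral_indicator hD.measurableSet]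

end IsGraphBox

end TraceForm

end

/-! ### The trace inequality -/

noncomputable section

namespace TraceForm

variable {d : ℕ} {D : Set (Eu d)} {x : Eu d} {R : ℝ}
  {T : Eu d ≃ᵃⁱ[ℝ] WithLp 2 (Eu (d - 1) × ℝ)} {g : Eu (d - 1) → ℝ} {L : NNReal}

/-- The integrand of the Gagliardo seminorm. -/
def gagliardoKernel (w : Eu d → ℝ) (p : Eu d × Eu d) : ENNReal :=
  ‖w p.1 - w p.2‖ₑ ^ 2 * ENNReal.ofReal ((dist p.1 p.2 ^ d)⁻¹)

lemma measurable_gagliardoKernel {w : Eu d → ℝ} (hw : Measurable w) :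
    Measurable (gagliardoKernel w) := by
  unfold gagliardoKernel
  have h1 : Measurable fun p : Eu d × Eu d => w p.1 - w p.2 :=
    (hw.comp measurable_fst).sub (hw.comp measurable_snd)
  have h2 : Measurable fun p : Eu d × Eu d => dist p.1 p.2 := measurable_dist
  exact (h1.enorm.pow_const 2).mul ((h2.pow_const d).inv.ennreal_ofReal)

lemma gagliardo_eq_lintegral_prod {σ : Measure (Eu d)} [SFinite σ] {w : Eu d → ℝ}
    (hw : Measurable w) : gagliardo σ w = ∫⁻ p, gagliardoKernel w p ∂(σ.prod σ) := by
  rw [lintegral_prod _ (measurable_gagliardoKernel hw).aemeasurable]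
  rfl

lemma gagliardoKernel_le_of_le_dist {w : Eu d → ℝ} {η : ℝ} (hη : 0 < η) {p : Eu d × Eu d}
    (hp : η ≤ dist p.1 p.2) :
    gagliardoKernel w p ≤
      2 * ENNReal.ofReal ((η ^ d)⁻¹) * (‖w p.1‖ₑ ^ 2 + ‖w p.2‖ₑ ^ 2) := by
  have h1 : ‖w p.1 - w p.2‖ₑ ^ 2 ≤ 2 * (‖w p.1‖ₑ ^ 2 + ‖w p.2‖ₑ ^ 2) :=
    (pow_le_pow_left' enorm_sub_le 2).trans (add_sq_le_two_mul _ _)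
  have h2 : ENNReal.ofReal ((dist p.1 p.2 ^ d)⁻¹) ≤ ENNReal.ofReal ((η ^ d)⁻¹) := by
    gcongr
  calc gagliardoKernel w p
      ≤ 2 * (‖w p.1‖ₑ ^ 2 + ‖w p.2‖ₑ ^ 2) * ENNReal.ofReal ((η ^ d)⁻¹) := mul_le_mul' h1 h2
    _ = _ := by ring

/-- Projection to the base shortens distances, so the singular weight only grows when it is computed
there. -/
lemma gagliardoKernel_graphPoint_le (w : Eu d → ℝ) (a b : Eu (d - 1)) :
    gagliardoKernel w (graphPoint T g a 0, graphPoint T g b 0) ≤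
      ENNReal.ofReal ((‖a - b‖ ^ d)⁻¹) *
        ‖w (graphPoint T g a 0) - w (graphPoint T g b 0)‖ₑ ^ 2 := by
  rcases eq_or_ne a b with rfl | hab
  · simp [gagliardoKernel]
  have hs : 0 < ‖a - b‖ := norm_pos_iff.2 (sub_ne_zero.2 hab)
  rw [gagliardoKernel, mul_comm]
  gcongr
  rw [← dist_eq_norm]
  exact dist_le_dist_graphPoint a b 0 0

namespace IsGraphBox

lemma setLIntegral_surfaceMeasure_le (h : IsGraphBox D x R T g L) {f : Eu d → ENNReal}
    (hf : Measurable f) :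
    ∫⁻ y in Metric.ball x R, f y ∂(surfaceMeasure D) ≤
      ((1 + L : NNReal) : ENNReal) ^ (d - 1) *
        ∫⁻ b in Metric.ball (T x).fst R, f (graphPoint T g b 0) := by
  refine (lintegral_mono' h.surfaceMeasure_restrict_le le_rfl).trans ?_
  rw [lintegral_smul_measure, smul_eq_mul,
    lintegral_map hf (continuous_graphPoint_left h.contDiff.continuous 0).measurable]

/-- Both surface integrals are pulled back to the base at a bounded cost, where the up-across-down
estimate in dimension d - 1 ≥ 1 applies. -/
lemma exists_setLIntegral_gagliardoKernel_le (h : IsGraphBox D x R T g L) (hd : 2 ≤ d)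
    (hD : IsOpen D) [SFinite (surfaceMeasure D)] :
    ∃ C : ENNReal, C ≠ ⊤ ∧ ∀ w : Eu d → ℝ, ContDiff ℝ ∞ w →
      ∫⁻ p in Metric.ball x R ×ˢ Metric.ball x R, gagliardoKernel w p
        ∂((surfaceMeasure D).prod (surfaceMeasure D)) ≤ C * ∫⁻ y in D, ‖fderiv ℝ w y‖ₑ ^ 2 := by
  obtain ⟨C, hC, hflat⟩ := exists_lintegral_gagliardo_le (n := d - 1) (by omega)
    (K := ((1 + L : NNReal) : ENNReal)) ENNReal.coe_ne_top
  obtain ⟨K, hK⟩ : ∃ K : ENNReal, K = ((1 + L : NNReal) : ENNReal) ^ (d - 1) := ⟨_, rfl⟩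
  have hKt : K ≠ ⊤ := by rw [hK]; finiteness
  refine ⟨K * (K * C), by finiteness, fun w hw => ?_⟩
  have hm := measurable_gagliardoKernel hw.continuous.measurable
  have hgp : Measurable fun a => graphPoint T g a 0 :=
    (continuous_graphPoint_left h.contDiff.continuous 0).measurable
  have hdd : d - 1 + 1 = d := by omega
  rw [← Measure.prod_restrict, lintegral_prod _ hm.aemeasurable]
  calc ∫⁻ y in Metric.ball x R, ∫⁻ z in Metric.ball x R, gagliardoKernel w (y, z)
        ∂(surfaceMeasure D) ∂(surfaceMeasure D)
      ≤ ∫⁻ y in Metric.ball x R, (K * ∫⁻ b in Metric.ball (T x).fst R,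
          gagliardoKernel w (y, graphPoint T g b 0)) ∂(surfaceMeasure D) :=
        lintegral_mono fun y => hK ▸ h.setLIntegral_surfaceMeasure_le
          (hm.comp measurable_prodMk_left)
    _ ≤ K * ∫⁻ a in Metric.ball (T x).fst R, K * ∫⁻ b in Metric.ball (T x).fst R,
          gagliardoKernel w (graphPoint T g a 0, graphPoint T g b 0) := by
        have hm' : Measurable fun y => K * ∫⁻ b in Metric.ball (T x).fst R,
            gagliardoKernel w (y, graphPoint T g b 0) :=
          (Measurable.lintegral_prod_right' (hm.comp
            (measurable_fst.prodMk (hgp.comp measurable_snd)))).const_mul K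
        rw [hK] at hm' ⊢
        exact h.setLIntegral_surfaceMeasure_le hm'
    _ = K * (K * ∫⁻ a in Metric.ball (T x).fst R, ∫⁻ b in Metric.ball (T x).fst R,
          gagliardoKernel w (graphPoint T g a 0, graphPoint T g b 0)) := by
        rw [lintegral_const_mul' _ _ hKt]
    _ ≤ K * (K * (C * ∫⁻ y in D, ‖fderiv ℝ w y‖ₑ ^ 2)) := by
        gcongr
        refine le_trans ?_ ((hflat _ (fun a => w (graphPoint T g a 0)) _
          Metric.isOpen_ball.measurableSet
          (measurable_collarDeriv (R := R) Metric.isOpen_ball.measurableSet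
            h.contDiff.continuous hw) fun a ha b hb => h.enorm_sub_le hw ha hb).trans
          (mul_le_mul_right (h.lintegral_collarDeriv_le hD hw) C))
        refine lintegral_mono fun a => lintegral_mono fun b => ?_
        rw [hdd]
        exact gagliardoKernel_graphPoint_le w a b
    _ = _ := by ring

end IsGraphBox

lemma setLIntegral_gagliardoKernel_le_of_le_dist {σ : Measure (Eu d)} [IsFiniteMeasure σ]
    {S : Set (Eu d × Eu d)} (hS : MeasurableSet S) {η : ℝ} (hη : 0 < η)
    (h : ∀ p ∈ S, η ≤ dist p.1 p.2) {w : Eu d → ℝ} (hw : Measurable w) :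
    ∫⁻ p in S, gagliardoKernel w p ∂(σ.prod σ) ≤
      4 * ENNReal.ofReal ((η ^ d)⁻¹) * σ Set.univ * ∫⁻ y, ‖w y‖ₑ ^ 2 ∂σ := by
  have hw2 : Measurable fun y => ‖w y‖ₑ ^ 2 := hw.enorm.pow_const 2
  have h1 : ∫⁻ p : Eu d × Eu d, ‖w p.1‖ₑ ^ 2 ∂(σ.prod σ) = σ Set.univ * ∫⁻ y, ‖w y‖ₑ ^ 2 ∂σ := by
    have hm : Measurable fun p : Eu d × Eu d => ‖w p.1‖ₑ ^ 2 := hw2.comp measurable_fst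
    rw [lintegral_prod _ hm.aemeasurable]
    simp only [lintegral_const]
    rw [lintegral_mul_const _ hw2, mul_comm]
  have h2 : ∫⁻ p : Eu d × Eu d, ‖w p.2‖ₑ ^ 2 ∂(σ.prod σ) = σ Set.univ * ∫⁻ y, ‖w y‖ₑ ^ 2 ∂σ := by
    have hm : Measurable fun p : Eu d × Eu d => ‖w p.2‖ₑ ^ 2 := hw2.comp measurable_snd
    rw [lintegral_prod _ hm.aemeasurable]
    simp only [lintegral_const]
    rw [mul_comm]
  calc ∫⁻ p in S, gagliardoKernel w p ∂(σ.prod σ)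
      ≤ ∫⁻ p in S, 2 * ENNReal.ofReal ((η ^ d)⁻¹) * (‖w p.1‖ₑ ^ 2 + ‖w p.2‖ₑ ^ 2) ∂(σ.prod σ) :=
        setLIntegral_mono' hS fun p hp => gagliardoKernel_le_of_le_dist hη (h p hp)
    _ ≤ ∫⁻ p, 2 * ENNReal.ofReal ((η ^ d)⁻¹) * (‖w p.1‖ₑ ^ 2 + ‖w p.2‖ₑ ^ 2) ∂(σ.prod σ) :=
        setLIntegral_le_lintegral _ _
    _ = 2 * ENNReal.ofReal ((η ^ d)⁻¹) * (σ Set.univ * (∫⁻ y, ‖w y‖ₑ ^ 2 ∂σ) +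
          σ Set.univ * ∫⁻ y, ‖w y‖ₑ ^ 2 ∂σ) := by
        have hm : Measurable fun p : Eu d × Eu d => ‖w p.1‖ₑ ^ 2 := hw2.comp measurable_fst
        rw [lintegral_const_mul' _ _ (by finiteness), lintegral_add_left hm, h1, h2]
    _ = _ := by ring

/-- The trace inequality: the Gagliardo seminorm on the boundary is controlled by the Dirichlet
integral and the boundary `L²` norm. -/
lemma IsSmoothBoundedDomain.exists_gagliardo_le (hD : IsSmoothBoundedDomain D) (hd : 2 ≤ d) :
    ∃ C : ENNReal, C ≠ ⊤ ∧ ∀ w : Eu d → ℝ, ContDiff ℝ ∞ w →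
      gagliardo (surfaceMeasure D) w ≤
        C * ((∫⁻ y in D, ‖fderiv ℝ w y‖ₑ ^ 2) + ∫⁻ y, ‖w y‖ₑ ^ 2 ∂(surfaceMeasure D)) := by
  have := hD.isFiniteMeasure
  set σ := surfaceMeasure D
  have key : ∃ C : ENNReal, C ≠ ⊤ ∧ ∀ w : Eu d → ℝ, ContDiff ℝ ∞ w →
      ∫⁻ p in frontier D ×ˢ frontier D, gagliardoKernel w p ∂(σ.prod σ) ≤
        C * ((∫⁻ y in D, ‖fderiv ℝ w y‖ₑ ^ 2) + ∫⁻ y, ‖w y‖ₑ ^ 2 ∂σ) := by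
    refine (hD.isCompact_frontier.prod hD.isCompact_frontier).induction_on
      (p := fun S => ∃ C : ENNReal, C ≠ ⊤ ∧ ∀ w : Eu d → ℝ, ContDiff ℝ ∞ w →
        ∫⁻ p in S, gagliardoKernel w p ∂(σ.prod σ) ≤
          C * ((∫⁻ y in D, ‖fderiv ℝ w y‖ₑ ^ 2) + ∫⁻ y, ‖w y‖ₑ ^ 2 ∂σ)) ?_ ?_ ?_ ?_
    · exact ⟨0, ENNReal.zero_ne_top, fun w hw => by simp⟩
    · rintro s t hst ⟨C, hC, h⟩
      exact ⟨C, hC, fun w hw => (lintegral_mono_set hst).trans (h w hw)⟩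
    · rintro s t ⟨C, hC, h⟩ ⟨C', hC', h'⟩
      refine ⟨C + C', by finiteness, fun w hw => (lintegral_union_le _ _ _).trans ?_⟩
      rw [add_mul]
      exact add_le_add (h w hw) (h' w hw)
    · rintro ⟨y, z⟩ ⟨hy, hz⟩
      -- Near a diagonal point one graph box contains both variables. Near an off-diagonal point,
      -- balls of radius a third of the distance keep the variables separated, and the L² norm
      -- suffices.
      rcases eq_or_ne y z with rfl | hyz
      · obtain ⟨R, T, g, L, hbox⟩ := hD.exists_isGraphBox hy
        obtain ⟨C, hC, h⟩ := hbox.exists_setLIntegral_gagliardoKernel_le hd hD.isOpen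
        refine ⟨_, mem_nhdsWithin_of_mem_nhds (prod_mem_nhds (Metric.ball_mem_nhds _ hbox.pos)
          (Metric.ball_mem_nhds _ hbox.pos)), C, hC, fun w hw => (h w hw).trans ?_⟩
        gcongr
        exact le_self_add
      · have hη : 0 < dist y z / 3 := by
          have := dist_pos.2 hyz
          positivity
        refine ⟨_, mem_nhdsWithin_of_mem_nhds (prod_mem_nhds (Metric.ball_mem_nhds _ hη)
          (Metric.ball_mem_nhds _ hη)), 4 * ENNReal.ofReal (((dist y z / 3) ^ d)⁻¹) * σ Set.univ,
          by finiteness, fun w hw => ?_⟩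
        refine (setLIntegral_gagliardoKernel_le_of_le_dist
          (Metric.isOpen_ball.measurableSet.prod Metric.isOpen_ball.measurableSet) hη ?_
          hw.continuous.measurable).trans ?_
        · rintro ⟨p, q⟩ ⟨hp, hq⟩
          have h1 : dist p y < dist y z / 3 := hp
          have h2 : dist q z < dist y z / 3 := hq
          have h3 := dist_triangle4 y p q z
          rw [dist_comm y p] at h3
          show dist y z / 3 ≤ dist p q
          linarith
        · gcongr
          exact le_add_self
  obtain ⟨C, hC, h⟩ := key
  refine ⟨C, hC, fun w hw => ?_⟩
  rw [gagliardo_eq_lintegral_prod hw.continuous.measurable]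
  refine le_trans (le_of_eq ?_) (h w hw)
  have hr : σ.restrict (frontier D) = σ := Measure.restrict_eq_self_of_ae_mem ae_mem_frontier
  rw [← Measure.prod_restrict, hr]

lemma enorm_gradient (w : Eu d → ℝ) (y : Eu d) : ‖gradient w y‖ₑ = ‖fderiv ℝ w y‖ₑ := by
  simp [gradient, enorm_eq_nnnorm]

lemma eventually_lintegral_sq_le {α E : Type*} [MeasurableSpace α] {μ : Measure α}
    [NormedAddCommGroup E] {f : ℕ → α → E} {u : α → E}
    (h : Tendsto (fun k => ∫⁻ y, ‖f k y - u y‖ₑ ^ 2 ∂μ) atTop (𝓝 0)) (hu : MemLp u 2 μ) :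
    ∃ C : ENNReal, C ≠ ⊤ ∧ ∀ᶠ k in atTop, ∫⁻ y, ‖f k y‖ₑ ^ 2 ∂μ ≤ C := by
  have hut : ∫⁻ y, ‖u y‖ₑ ^ 2 ∂μ ≠ ⊤ := by
    rw [← eLpNorm_two_sq]
    exact ENNReal.pow_ne_top hu.eLpNorm_ne_top
  refine ⟨2 * (1 + ∫⁻ y, ‖u y‖ₑ ^ 2 ∂μ), by finiteness, ?_⟩
  filter_upwards [h.eventually_le_const zero_lt_one] with k hk
  calc ∫⁻ y, ‖f k y‖ₑ ^ 2 ∂μ ≤ ∫⁻ y, 2 * (‖f k y - u y‖ₑ ^ 2 + ‖u y‖ₑ ^ 2) ∂μ :=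
        lintegral_mono fun y => enorm_sq_le_two_mul _ _
    _ = 2 * ((∫⁻ y, ‖f k y - u y‖ₑ ^ 2 ∂μ) + ∫⁻ y, ‖u y‖ₑ ^ 2 ∂μ) := by
        rw [lintegral_const_mul' _ _ (by norm_num),
          lintegral_add_right' _ (hu.aestronglyMeasurable.enorm.pow_const 2)]
    _ ≤ _ := by gcongr

/-- The trace inequality bounds the seminorms of the smooth approximants uniformly, and lower
semicontinuity under almost everywhere convergence passes the bound to φ. -/
lemma HasTrace.mem_HHalfBoundary (hD : IsSmoothBoundedDomain D) (hd : 2 ≤ d) {u : Eu d → ℝ}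
    {φ : L2Boundary D} (h : HasTrace D u φ) : φ ∈ HHalfBoundary D := by
  obtain ⟨hu, w, hw, -, hgrad, hbd⟩ := h
  have := hD.isFiniteMeasure
  obtain ⟨C, hC, hCw⟩ := hD.exists_gagliardo_le hd
  have hw1 : ∀ k, ContDiff ℝ 1 (w k) := fun k => (hw k).of_le (by simp)
  have hbd2 := tendsto_eLpNorm_two_iff.1 hbd
  obtain ⟨C₁, hC₁, h₁⟩ := eventually_lintegral_sq_le hbd2 (Lp.memLp φ)
  obtain ⟨C₂, hC₂, h₂⟩ : ∃ C₂ : ENNReal, C₂ ≠ ⊤ ∧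
      ∀ᶠ k in atTop, ∫⁻ y in D, ‖fderiv ℝ (w k) y‖ₑ ^ 2 ≤ C₂ := by
    simp_rw [← enorm_gradient]
    refine eventually_lintegral_sq_le (u := weakGrad D u) ?_ (weakGrad_spec hu.2).memLp
    refine (tendsto_eLpNorm_two_iff.1 hgrad).congr fun k => ?_
    refine lintegral_congr_ae ?_
    filter_upwards [weakGrad_sub_ae_eq hD.isOpen (mem_H1_of_contDiff hD.isBounded (hw1 k)) hu,
      weakGrad_ae_eq hD.isOpen (isWeakGradient_gradient hD.isBounded (hw1 k))] with y h1 h2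
    rw [h1, Pi.sub_apply, h2]
  have hmeas : ∀ k, AEStronglyMeasurable (w k) (surfaceMeasure D) := fun k =>
    (hw k).continuous.aestronglyMeasurable
  have hφm : Measurable φ := (Lp.stronglyMeasurable φ).measurable
  -- L² convergence on the boundary yields an almost everywhere convergent subsequence; through the
  -- two projections it converges almost everywhere for the product measure, as Fatou's lemma
  -- requires.
  obtain ⟨ns, hns, hae⟩ := (tendstoInMeasure_of_tendsto_eLpNorm two_ne_zero hmeas
    (Lp.aestronglyMeasurable φ) hbd).exists_seq_tendsto_ae
  rw [mem_HHalfBoundary_iff, gagliardo_eq_lintegral_prod hφm]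
  refine (lintegral_le_of_ae_tendsto (F := fun k => gagliardoKernel (w (ns k)))
    (C := C * (C₂ + C₁)) (fun k =>
      (measurable_gagliardoKernel (hw _).continuous.measurable).aemeasurable) ?_ ?_).trans_lt
      (by finiteness)
  · filter_upwards [Measure.quasiMeasurePreserving_fst.ae hae,
      Measure.quasiMeasurePreserving_snd.ae hae] with p h1 h2
    refine ENNReal.Tendsto.mul_const ?_ (Or.inr ENNReal.ofReal_ne_top)
    exact ((ENNReal.continuous_pow 2).tendsto _).comp (h1.sub h2).enorm
  · filter_upwards [hns.tendsto_atTop.eventually h₁, hns.tendsto_atTop.eventually h₂] with k h1 h2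
    rw [← gagliardo_eq_lintegral_prod (hw _).continuous.measurable]
    refine (hCw _ (hw _)).trans ?_
    gcongr

end TraceForm

end

/-! ### Conclusion -/

theorem mainTheorem6 {d : ℕ} (hd : 2 ≤ d) (D : Set (TraceForm.Eu d))
    (hD : TraceForm.IsSmoothBoundedDomain D)
    (κ : TraceForm.Eu d → Matrix (Fin d) (Fin d) ℝ) (hκ : TraceForm.IsConductivity D κ) :
    TraceForm.extendedDomain D κ = TraceForm.H1 D ∧
      (TraceForm.traceDirichletForm D κ).domain = TraceForm.HHalfBoundary D := by
  have h : TraceForm.extendedDomain D κ = TraceForm.H1 D :=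
    Set.Subset.antisymm (TraceForm.extendedDomain_subset_H1 hD hκ)
      (TraceForm.H1_subset_extendedDomain hD.isOpen κ)
  refine ⟨h, Set.Subset.antisymm ?_ fun φ hφ => ?_⟩
  · rintro φ ⟨u, -, hu⟩
    exact hu.mem_HHalfBoundary hD hd
  · obtain ⟨u, hu⟩ := TraceForm.exists_hasTrace_of_mem_HHalfBoundary (by omega) hD hφ
    exact ⟨u, h ▸ hu.1, hu⟩
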